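/- **Notation.** For $v,u$ in the Schwartz space $\mathcal S(\mathbb R)$ (complex-valued functions) let $$\mathrm{Wig}(v,u)(x,\xi)=\int_{\mathbb R}\overline{v(x+t)}\,u(x-t)\,e^{2i\pi\xi t}\,dt .$$ For $h\in\mathcal S(\mathbb R^2)$ and $\operatorname{Re}\nu>1$ put $$\langle\mathfrak E_{-\nu},h\rangle=\sum_{(j,k)\in\mathbb Z^2\setminus\{(0,0)\}}\int_0^\infty t^{\nu}h(jt,kt)\,dt ;$$ for the other $\nu\neq\pm1$, $\langle\mathfrak E_{-\nu},h\rangle$ denotes the value at $\nu$ of the holomorphic continuation of this function to $\mathbb C\setminus\{1,-1\}$. For $Q\ge 1$ put $$c_Q(v,u)=\sum_{(j,k)\neq(0,0)}\Big(\prod_{p\mid\gcd(j,k),\ p\text{ odd prime}}(1-p)\Big)\,Q^{-1}\,\mathrm{Wig}(v,u)\!\left(\tfrac jQ,\tfrac kQ\right),$$ and for $\operatorname{Re}s>2$ define $$F_0(s)=\frac1{2i\pi}\int_{\operatorname{Re}\nu=1}\bigl(1+2^{-s+\nu}\bigr)^{-1}\frac{\zeta(s-\nu)}{\zeta(2(s-\nu))}\cdot\frac{(1-2^{-\nu})^{-1}}{\zeta(\nu)}\,\langle\mathfrak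 E_{-\nu},\mathrm{Wig}(v,u)\rangle\,d\nu .\qquad(*)$$ **Theorem.** (0) For all $v,u\in\mathcal S(\mathbb R)$ and $\operatorname{Re}s>2$, the integral $(*)$ converges absolutely, $F_0$ is analytic in $\operatorname{Re}s>2$, and there $F_0(s)=\sum_{Q}Q^{-s}c_Q(v,u)$, the sum, absolutely convergent, being taken over the squarefree odd integers $Q\ge1$. (1) Assume that, for every pair $v,u$ of compactly supported $C^\infty$ functions on $\mathbb R$, the function $F_0$ defined by $(*)$ for $\operatorname{Re}s>2$ extends to an analytic function in the half-plane $\operatorname{Re}s>\frac32$. Then every zero of $\zeta$ has real part $\le\frac12$; in other words, the Riemann hypothesis holds. (2) Let $\rho\in\mathbb C$, $\rho\neq1$, $\operatorname{Re}\rho>\frac12$, and let $v,u\in\mathcal S(\mathbb R)$ be such that $\langle\mathfrak E_{-\rho},\mathrm{Wig}(v,u)\rangle\neq0$. If $F_0$, defined for $\operatorname{Re}s>2$ by the series in (0), can be continued analytically along a path in the half-plane $\operatorname{Re}s>\frac32$ connecting a point with real part $>2$ to the point $1+\rho$, then $\zeta(\rho)\neq0$. -/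

import Mathlib

open Complex MeasureTheory Set Filter Topology
open scoped SchwartzMap ContDiff

noncomputable section

namespace PseudoArith

/-- The Wigner function
`Wig(v,u)(x,ξ) = ∫ conj (v (x+t)) u (x-t) exp (2 π i ξ t) dt`. The scalar product
`(v | Ψ(S) u)` of the Weyl calculus is the pairing `⟨S, Wig(v,u)⟩`. -/
def wigner (v u : ℝ → ℂ) (p : ℝ × ℝ) : ℂ :=
  ∫ t : ℝ, (starRingEnd ℂ) (v (p.1 + t)) * u (p.1 - t) *
    Complex.exp (2 * Real.pi * I * (p.2 : ℂ) * (t : ℂ))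

/-- The nonzero points of the lattice `ℤ²`. -/
abbrev LatticePt : Type := {m : ℤ × ℤ // m ≠ 0}

/-- `∑_{(j,k) ≠ (0,0)} ∫_0^∞ t^ν h(jt, kt) dt`, the value of `⟨E_{-ν}, h⟩` for `Re ν > 1`. -/
def eisensteinSum (ν : ℂ) (h : ℝ × ℝ → ℂ) : ℂ :=
  ∑' m : LatticePt, ∫ t in Ioi (0 : ℝ),
    (t : ℂ) ^ ν * h ((m.1.1 : ℝ) * t, (m.1.2 : ℝ) * t)

/-- `g` is a holomorphic continuation to `ℂ \ {1, -1}` of `ν ↦ ⟨E_{-ν}, h⟩`, `Re ν > 1`. -/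
def IsEisensteinContinuation (h : ℝ × ℝ → ℂ) (g : ℂ → ℂ) : Prop :=
  DifferentiableOn ℂ g ({1, -1} : Set ℂ)ᶜ ∧ ∀ ν : ℂ, 1 < ν.re → g ν = eisensteinSum ν h

open Classical in
/-- The pairing `⟨E_{-ν}, h⟩` of the Eisenstein distribution `E_{-ν}`, `ν ≠ ±1`, with a function
`h` in the Schwartz space of the plane: the value at `ν` of the holomorphic continuation to
`ℂ \ {1, -1}` of the series above. (The continuation is unique, see `eisenstein_eq`; the values at
the poles `ν = ±1` have no meaning.) -/
def eisenstein (ν : ℂ) (h : ℝ × ℝ → ℂ) : ℂ :=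
  if hg : ∃ g : ℂ → ℂ, IsEisensteinContinuation h g then hg.choose ν else 0

theorem IsEisensteinContinuation.unique {h : ℝ × ℝ → ℂ} {g₁ g₂ : ℂ → ℂ}
    (h₁ : IsEisensteinContinuation h g₁) (h₂ : IsEisensteinContinuation h g₂) {ν : ℂ}
    (hν : ν ≠ 1) (hν' : ν ≠ -1) : g₁ ν = g₂ ν := by
  have hfin : ({1, -1} : Set ℂ).Finite := Set.toFinite _
  have hopen : IsOpen ({1, -1} : Set ℂ)ᶜ := hfin.isClosed.isOpen_compl
  have hconn : IsPreconnected ({1, -1} : Set ℂ)ᶜ :=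
    (hfin.countable.isConnected_compl_of_one_lt_rank (by simp)).isPreconnected
  have h2 : (2 : ℂ) ∈ ({1, -1} : Set ℂ)ᶜ := by
    simp only [mem_compl_iff, mem_insert_iff, mem_singleton_iff, not_or]
    constructor <;> norm_num [Complex.ext_iff]
  have hnear : g₁ =ᶠ[𝓝 (2 : ℂ)] g₂ := by
    have : {z : ℂ | 1 < z.re} ∈ 𝓝 (2 : ℂ) :=
      (isOpen_lt continuous_const Complex.continuous_re).mem_nhds (by norm_num)
    filter_upwards [this] with z hz
    rw [h₁.2 z hz, h₂.2 z hz]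
  exact (h₁.1.analyticOnNhd hopen).eqOn_of_preconnected_of_eventuallyEq
    (h₂.1.analyticOnNhd hopen) hconn h2 hnear (by simp [hν, hν'])

theorem eisenstein_eq {h : ℝ × ℝ → ℂ} {g : ℂ → ℂ} (hg : IsEisensteinContinuation h g) {ν : ℂ}
    (hν : ν ≠ 1) (hν' : ν ≠ -1) : eisenstein ν h = g ν := by
  have hex : ∃ g : ℂ → ℂ, IsEisensteinContinuation h g := ⟨g, hg⟩
  rw [eisenstein, dif_pos hex]
  exact hex.choose_spec.unique hg hν hν'

/-- The product of the factors `1 - p` over the odd primes `p` dividing `r`. -/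
def oddCoeff (r : ℕ) : ℤ := ∏ p ∈ r.primeFactors.erase 2, (1 - (p : ℤ))

/-- The pairing of `T_{∞/2} = ∑_{(j,k) ≠ (0,0)} oddCoeff (gcd(j,k)) δ(x-j) δ(ξ-k)` with `h`. -/
def tHalfInfty (h : ℝ × ℝ → ℂ) : ℂ :=
  ∑' m : LatticePt, (oddCoeff (Int.gcd m.1.1 m.1.2) : ℂ) * h ((m.1.1 : ℝ), (m.1.2 : ℝ))

/-- The rescaling `(t^{2iπE} h)(x,ξ) = t h(tx, tξ)`. -/
def rescale (t : ℝ) (h : ℝ × ℝ → ℂ) (p : ℝ × ℝ) : ℂ := (t : ℂ) * h (t * p.1, t * p.2)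

/-- `(v | Ψ(Q^{2iπE} T_{∞/2}) u) = ⟨Q^{2iπE} T_{∞/2}, Wig(v,u)⟩`; the transpose of `Q^{2iπE}`
is `Q^{-2iπE}`, the rescaling by `1/Q`. -/
def hermForm (v u : ℝ → ℂ) (Q : ℕ) : ℂ :=
  tHalfInfty (rescale ((Q : ℝ)⁻¹) (wigner v u))

/-- The set of squarefree odd positive integers. -/
abbrev SqfOdd : Type := {Q : ℕ // Squarefree Q ∧ Odd Q}

/-- The general term of the series for `F_0(s)`. -/
def F0Term (v u : ℝ → ℂ) (s : ℂ) (Q : SqfOdd) : ℂ :=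
  ((Q : ℕ) : ℂ) ^ (-s) * hermForm v u Q

/-- `F_0(s)` defined by the series over squarefree odd integers. -/
def F0Series (v u : ℝ → ℂ) (s : ℂ) : ℂ := ∑' Q : SqfOdd, F0Term v u s Q

/-- The integrand of the line integral for `F_0(s)`. -/
def F0Integrand (v u : ℝ → ℂ) (s ν : ℂ) : ℂ :=
  (1 + (2 : ℂ) ^ (-s + ν))⁻¹ * (riemannZeta (s - ν) / riemannZeta (2 * (s - ν))) *
    ((1 - (2 : ℂ) ^ (-ν))⁻¹ / riemannZeta ν) * eisenstein ν (wigner v u)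

/-- `F_0(s)` defined by the line integral `(2πi)⁻¹ ∫_{Re ν = 1} … dν`, parametrized by
`ν = 1 + iy`, `dν = i dy`. -/
def F0 (v u : ℝ → ℂ) (s : ℂ) : ℂ :=
  (2 * Real.pi * I)⁻¹ * ∫ y : ℝ, F0Integrand v u s (1 + y * I) * I

/-- The germ of `F` at `a` can be continued analytically along the path `γ` from `a` to `b`:
there are functions `G t`, analytic at `γ t`, depending on `t` in a locally coherent way,
starting from the germ of `F`. -/
def ContinuesAlong (F : ℂ → ℂ) {a b : ℂ} (γ : Path a b) : Prop :=
  ∃ G : unitInterval → ℂ → ℂ,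
    (∀ t, AnalyticAt ℂ (G t) (γ t)) ∧
    G 0 =ᶠ[𝓝 a] F ∧
    ∀ t, ∀ᶠ t' in 𝓝 t, G t' =ᶠ[𝓝 (γ t')] G t

end PseudoArith

end

/-! Put K(ν) = (1 − 2^{-ν})⁻¹ ζ(ν)⁻¹ ⟨E_{-ν}, Wig(v,u)⟩ (`lineKernel`). The pole of the pairing at ν
= 1 is cancelled by that of ζ, so K is analytic for Re ν ≥ 1. In the strip 1 ≤ Re ν ≤ 2 it decays
faster than any power: multiplying the pairing by ν only replaces (v,u) by the pairs (v', xu) and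
(xv, u') (`mul_eisReg`), while the 3-4-1 inequality bounds (s − 1)ζ(s) from below by a power of the
height (`exists_le_norm_riemannZeta₁`). Hence L(x) = (2π)⁻¹ ∫ x^{1+iy} K(1+iy) dy (`lineIntegral`)
converges absolutely and is O(x).

Let Θ(t) be the sum of Wig(v,u) over the nonzero points of tℤ². The pairing is the Mellin transform
of Θ at ν + 1. Expanding 1/ζ and inverting this transform give L(x) = ∑ μ(n) (n/x) Θ(n/x) over odd
n, and for an integer Q this is the coefficient c_Q (`thetaSeries_natCast`). The remaining factor of
the integrand is the Dirichlet series of the squarefree odd integers at s − ν, so termwise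
integration yields F₀(s) = ∑ Q^{-s} L(Q), which is assertion (0).

For the criterion, the number N(x) of squarefree odd integers up to x is δx + O(x^θ) whenever 1/2 <
θ ≤ 1, with δ ≠ 0. Partial summation against N replaces the series by δ times a Mellin integral of
L, up to an error converging for Re s > 3/2. Since the Mellin transform of L at −ν is K(ν), the
outcome is F₀(s) = δ K(s − 1) + B(s) with B analytic for Re s > 3/2 (`exists_F0_eq`). No contour is
moved across the critical strip.

Thus ζ₁(s − 1) F₀(s), where ζ₁(s) = (s − 1)ζ(s), extends analytically to Re s > 3/2, and at s = 1 +
ρ with ζ(ρ) = 0 its value is a nonzero multiple of ⟨E_{-ρ}, Wig(v,u)⟩. If F₀ itself continues to 1 +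
ρ, the product vanishes there, and so does the pairing: this is (2). For (1),
`exists_eisenstein_ne_zero` supplies test functions with a nonzero pairing. -/

noncomputable section

namespace PseudoArith

/-! ### Polynomial upper and lower bounds for (s − 1) ζ(s) -/

/-- The fractional part, cut off to `(1, ∞)`. -/
def fractCut : ℝ → ℂ := indicator (Ioi 1) (fun t => ((Int.fract t : ℝ) : ℂ))

theorem norm_fractCut_le (t : ℝ) : ‖fractCut t‖ ≤ 1 := by
  unfold fractCut
  by_cases h : t ∈ Ioi (1 : ℝ)
  · rw [indicator_of_mem h, norm_real, Real.norm_of_nonneg (Int.fract_nonneg t)]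
    exact (Int.fract_lt_one t).le
  · simp [indicator_of_notMem h]

theorem measurable_fractCut : Measurable fractCut :=
  (Complex.measurable_ofReal.comp measurable_fract).indicator measurableSet_Ioi

theorem differentiableAt_mellin_fractCut {s : ℂ} (hs : s.re < 0) :
    DifferentiableAt ℂ (mellin fractCut) s := by
  refine mellin_differentiableAt_of_isBigO_rpow (a := 0) (b := s.re - 1) ?_ ?_ hs ?_ (by linarith)
  · refine LocallyIntegrable.locallyIntegrableOn ?_ _
    refine (locallyIntegrable_const (1 : ℝ)).mono measurable_fractCut.aestronglyMeasurable ?_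
    exact ae_of_all _ fun t => by simpa using norm_fractCut_le t
  · refine Asymptotics.IsBigO.of_bound 1 (Eventually.of_forall fun t => ?_)
    simpa using norm_fractCut_le t
  · refine Asymptotics.IsBigO.of_bound 1 ?_
    filter_upwards [nhdsWithin_le_nhds (Iio_mem_nhds (zero_lt_one' ℝ))] with t ht
    have : fractCut t = 0 := indicator_of_notMem (by simpa using ht.le) _
    rw [this, norm_zero]; positivity

theorem mellin_fractCut (s : ℂ) :
    mellin fractCut s = ∫ t in Ioi (1 : ℝ), (t : ℂ) ^ (s - 1) * ((Int.fract t : ℝ) : ℂ) := by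
  rw [mellin]
  have : ∀ t : ℝ, (t : ℂ) ^ (s - 1) • fractCut t =
      indicator (Ioi 1) (fun t : ℝ => (t : ℂ) ^ (s - 1) * ((Int.fract t : ℝ) : ℂ)) t := by
    intro t
    unfold fractCut
    by_cases h : t ∈ Ioi (1 : ℝ)
    · simp only [indicator_of_mem h, smul_eq_mul]
    · simp only [indicator_of_notMem h, smul_zero]
  simp_rw [this]
  rw [setIntegral_indicator measurableSet_Ioi, inter_eq_right.mpr (Ioi_subset_Ioi zero_le_one)]

theorem norm_mellin_fractCut_le {s : ℂ} (hs : s.re ≤ -1 / 2) : ‖mellin fractCut s‖ ≤ 2 := by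
  rw [mellin_fractCut]
  have hint : IntegrableOn (fun t : ℝ => t ^ (s.re - 1)) (Ioi 1) :=
    integrableOn_Ioi_rpow_of_lt (by linarith) zero_lt_one
  refine (norm_integral_le_of_norm_le hint ?_).trans ?_
  · refine (ae_restrict_mem measurableSet_Ioi).mono fun t ht => ?_
    have ht0 : (0 : ℝ) < t := zero_lt_one.trans ht
    rw [norm_mul, norm_cpow_eq_rpow_re_of_pos ht0, norm_real,
      Real.norm_of_nonneg (Int.fract_nonneg t)]
    simpa using mul_le_of_le_one_right (by positivity) (Int.fract_lt_one t).le
  · rw [integral_Ioi_rpow_of_lt (by linarith) zero_lt_one]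
    simp only [Real.one_rpow, sub_add_cancel]
    rw [neg_div, ← div_neg, div_le_iff₀ (by linarith)]
    linarith

/-- Abel summation of ∑ n^{-s} with ⌊t⌋ = t − {t}: the main part integrates to s/(s − 1), whose pole
the factor s − 1 clears. -/
theorem riemannZeta₁_eq_of_one_lt {s : ℂ} (hs : 1 < s.re) :
    riemannZeta₁ s = s - s * (s - 1) * mellin fractCut (-s) := by
  have hs1 : s ≠ 1 := by rintro rfl; simp at hs
  have hs1' : s - 1 ≠ 0 := sub_ne_zero.mpr hs1
  have hz : riemannZeta s = LSeries (fun _ => (1 : ℂ)) s := by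
    rw [← LSeries_one_eq_riemannZeta hs]; rfl
  have hL := LSeries_eq_mul_integral' (fun _ => (1 : ℂ)) zero_le_one (s := s) hs
    (by
      refine Asymptotics.IsBigO.of_bound 1 (Eventually.of_forall fun n => ?_)
      simp)
  have hint1 : IntegrableOn (fun t : ℝ => (t : ℂ) ^ (-s)) (Ioi 1) :=
    integrableOn_Ioi_cpow_of_lt (by simpa using hs) zero_lt_one
  have hint2 : IntegrableOn (fun t : ℝ => (t : ℂ) ^ (-s - 1) * ((Int.fract t : ℝ) : ℂ))
      (Ioi 1) := by
    have h1 : IntegrableOn (fun t : ℝ => (t : ℂ) ^ (-s - 1)) (Ioi 1) :=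
      integrableOn_Ioi_cpow_of_lt (by simp; linarith) zero_lt_one
    refine Integrable.mono h1 (h1.aestronglyMeasurable.mul
      (Complex.measurable_ofReal.comp measurable_fract).aestronglyMeasurable) ?_
    refine ae_of_all _ fun t => ?_
    rw [norm_mul, norm_real, Real.norm_of_nonneg (Int.fract_nonneg t)]
    exact mul_le_of_le_one_right (norm_nonneg _) (Int.fract_lt_one t).le
  have hsplit : ∫ t in Ioi (1 : ℝ), (∑ k ∈ Finset.Icc 1 ⌊t⌋₊, (1 : ℂ)) * (t : ℂ) ^ (-(s + 1)) =
      (∫ t in Ioi (1 : ℝ), (t : ℂ) ^ (-s)) - mellin fractCut (-s) := by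
    rw [mellin_fractCut, ← integral_sub hint1 hint2]
    refine setIntegral_congr_fun measurableSet_Ioi fun t ht => ?_
    have ht0 : (0 : ℝ) < t := zero_lt_one.trans ht
    have h1 : (∑ k ∈ Finset.Icc 1 ⌊t⌋₊, (1 : ℂ)) = (t : ℂ) - ((Int.fract t : ℝ) : ℂ) := by
      rw [Finset.sum_const, Nat.card_Icc, Nat.add_sub_cancel, nsmul_eq_mul, mul_one,
        ← ofReal_sub, Int.self_sub_fract, ← natCast_floor_eq_intCast_floor ht0.le]
      simp
    have h2 : (t : ℂ) ^ (-s) = t * (t : ℂ) ^ (-s - 1) := by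
      rw [cpow_sub _ _ (by exact_mod_cast ht0.ne'), cpow_one, mul_div_cancel₀]
      exact_mod_cast ht0.ne'
    simp only [h1, h2]
    rw [neg_add, ← sub_eq_add_neg]
    ring
  rw [hsplit, ← hz, integral_Ioi_cpow_of_lt (by simpa using hs) zero_lt_one] at hL
  have h3 : riemannZeta₁ s = (s - 1) * riemannZeta s := by
    rw [riemannZeta_eq_inv_sub_mul hs1, mul_inv_cancel_left₀ hs1']
  rw [h3, hL]
  have h4 : -s + 1 ≠ 0 := by
    intro h; apply hs1'; linear_combination -h
  simp only [ofReal_one, one_cpow]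
  field_simp
  ring

/-- The integral of the fractional part converges for Re s > 0, so the identity theorem carries the
formula there. -/
theorem riemannZeta₁_eq {s : ℂ} (hs : 0 < s.re) :
    riemannZeta₁ s = s - s * (s - 1) * mellin fractCut (-s) := by
  have hopen : IsOpen {z : ℂ | 0 < z.re} := isOpen_lt continuous_const Complex.continuous_re
  have h1 : AnalyticOnNhd ℂ riemannZeta₁ {z : ℂ | 0 < z.re} :=
    differentiable_riemannZeta₁.differentiableOn.analyticOnNhd hopen
  have h2 : AnalyticOnNhd ℂ (fun s => s - s * (s - 1) * mellin fractCut (-s))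
      {z : ℂ | 0 < z.re} := by
    refine DifferentiableOn.analyticOnNhd (fun z hz => ?_) hopen
    have : DifferentiableAt ℂ (fun s => mellin fractCut (-s)) z :=
      (differentiableAt_mellin_fractCut (s := -z) (by simpa using hz)).comp z (by fun_prop)
    exact DifferentiableAt.differentiableWithinAt (by fun_prop)
  refine h1.eqOn_of_preconnected_of_eventuallyEq h2
    (convex_halfSpace_re_gt 0).isPreconnected (z₀ := 2) (by simp) ?_ hs
  have : {z : ℂ | 1 < z.re} ∈ 𝓝 (2 : ℂ) :=
    (isOpen_lt continuous_const Complex.continuous_re).mem_nhds (by simp)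
  filter_upwards [this] with z hz using riemannZeta₁_eq_of_one_lt hz

/-- The range reaches down to Re s = 1/2 so that Cauchy's estimate on circles of radius 1/2 is
available wherever Re s ≥ 1. -/
theorem norm_riemannZeta₁_le {s : ℂ} (hs : 1 / 2 ≤ s.re) :
    ‖riemannZeta₁ s‖ ≤ 3 * (1 + ‖s‖) ^ 2 := by
  rw [riemannZeta₁_eq (by linarith)]
  have h1 : ‖mellin fractCut (-s)‖ ≤ 2 := norm_mellin_fractCut_le (by simp; linarith)
  have h2 : ‖s - 1‖ ≤ ‖s‖ + 1 := by simpa using norm_sub_le s 1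
  calc ‖s - s * (s - 1) * mellin fractCut (-s)‖
      ≤ ‖s‖ + ‖s‖ * ‖s - 1‖ * ‖mellin fractCut (-s)‖ := by
        refine (norm_sub_le _ _).trans ?_
        rw [norm_mul, norm_mul]
    _ ≤ ‖s‖ + ‖s‖ * (‖s‖ + 1) * 2 := by gcongr
    _ ≤ _ := by nlinarith [norm_nonneg s]

theorem norm_deriv_riemannZeta₁_le {s : ℂ} (hs : 1 ≤ s.re) :
    ‖deriv riemannZeta₁ s‖ ≤ 24 * (1 + ‖s‖) ^ 2 := by
  -- The constant is 12 = 3 · 2², since 1 + |z| ≤ 2(1 + |s|) on the circle; dividing by the radius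
  -- doubles it.
  have h : ∀ z ∈ Metric.sphere s (1 / 2), ‖riemannZeta₁ z‖ ≤ 12 * (1 + ‖s‖) ^ 2 := by
    intro z hz
    rw [mem_sphere_iff_norm] at hz
    have h1 : |(z - s).re| ≤ 1 / 2 := hz ▸ abs_re_le_norm _
    have h2 : ‖z‖ ≤ ‖s‖ + 1 / 2 := by
      have := norm_add_le s (z - s)
      rw [add_sub_cancel, hz] at this
      exact this
    have h3 : 1 / 2 ≤ z.re := by
      rw [sub_re] at h1
      linarith [(abs_le.mp h1).1]
    refine (norm_riemannZeta₁_le h3).trans ?_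
    have : (1 + ‖z‖) ^ 2 ≤ (2 * (1 + ‖s‖)) ^ 2 := by
      gcongr
      linarith [norm_nonneg s]
    linarith
  have := Complex.norm_deriv_le_of_forall_mem_sphere_norm_le (by norm_num : (0 : ℝ) < 1 / 2)
    differentiable_riemannZeta₁.diffContOnCl h
  linarith

theorem norm_riemannZeta₁_sub_le {a b t : ℝ} (ha : 1 ≤ a) (hab : a ≤ b) (hb : b ≤ 2) :
    ‖riemannZeta₁ (b + t * I) - riemannZeta₁ (a + t * I)‖ ≤
      216 * (1 + |t|) ^ 2 * (b - a) := by
  have hbd : ∀ z ∈ {z : ℂ | 1 ≤ z.re ∧ ‖z‖ ≤ 2 + |t|},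
      ‖deriv riemannZeta₁ z‖ ≤ 216 * (1 + |t|) ^ 2 := by
    rintro z ⟨hz1, hz2⟩
    refine (norm_deriv_riemannZeta₁_le hz1).trans ?_
    have : (1 + ‖z‖) ^ 2 ≤ (3 * (1 + |t|)) ^ 2 := by
      gcongr
      linarith [abs_nonneg t]
    linarith
  have hconv : Convex ℝ {z : ℂ | 1 ≤ z.re ∧ ‖z‖ ≤ 2 + |t|} := by
    have h1 := (convex_halfSpace_re_ge 1).inter (convex_closedBall (0 : ℂ) (2 + |t|))
    convert h1 using 1
    ext z; simp
  have hmem : ∀ x : ℝ, 1 ≤ x → x ≤ 2 → (x + t * I : ℂ) ∈ {z : ℂ | 1 ≤ z.re ∧ ‖z‖ ≤ 2 + |t|} := by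
    intro x hx hx2
    refine ⟨by simpa using hx, (norm_add_le _ _).trans ?_⟩
    simp only [norm_mul, norm_I, mul_one, norm_real, Real.norm_eq_abs]
    rw [abs_of_nonneg (by linarith : (0:ℝ) ≤ x)]
    linarith
  have := hconv.norm_image_sub_le_of_norm_deriv_le
    (fun z _ => differentiable_riemannZeta₁.differentiableAt) hbd
    (hmem a ha (hab.trans hb)) (hmem b (ha.trans hab) hb)
  refine this.trans (le_of_eq ?_)
  have : ((b : ℂ) + t * I - (a + t * I)) = ((b - a : ℝ) : ℂ) := by push_cast; ring
  rw [this, norm_real, Real.norm_of_nonneg (by linarith)]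

theorem riemannZeta₁_eq_mul {s : ℂ} (hs : s ≠ 1) :
    riemannZeta₁ s = (s - 1) * riemannZeta s := by
  rw [riemannZeta_eq_inv_sub_mul hs, mul_inv_cancel_left₀ (sub_ne_zero.mpr hs)]

theorem riemannZeta₁_ne_zero_of_one_le_re {s : ℂ} (hs : 1 ≤ s.re) : riemannZeta₁ s ≠ 0 := by
  by_cases h : s = 1
  · simp [h]
  · rw [riemannZeta₁_eq_mul h]
    exact mul_ne_zero (sub_ne_zero.mpr h) (riemannZeta_ne_zero_of_one_le_re hs)

theorem norm_riemannZeta_product_ge_one {x : ℝ} (hx : 0 < x) (y : ℝ) :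
    1 ≤ ‖riemannZeta (1 + x)‖ ^ 3 * ‖riemannZeta (1 + x + I * y)‖ ^ 4 *
      ‖riemannZeta (1 + x + 2 * I * y)‖ := by
  have := DirichletCharacter.norm_LFunction_product_ge_one (N := 1) 1 hx y
  rw [DirichletCharacter.LFunctionTrivChar, DirichletCharacter.LFunction_modOne_eq,
    DirichletCharacter.LFunction_modOne_eq, norm_mul, norm_mul, norm_pow, norm_pow] at this
  exact this

/-- The consequence of the `3-4-1` inequality to the right of the line `Re s = 1`. -/
theorem rpow_le_norm_riemannZeta₁ {x t : ℝ} (hx : 0 < x) (hx1 : x ≤ 1) (ht : 1 ≤ |t|) :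
    x ^ 3 ≤ 12000000 * ‖riemannZeta₁ (1 + x + t * I)‖ ^ 4 := by
  have h341 := norm_riemannZeta_product_ge_one hx t
  have ht0 : t ≠ 0 := by rintro rfl; norm_num at ht
  have hN : ∀ y : ℝ, ‖(1 + x + y * I : ℂ)‖ ≤ 2 + |y| := by
    intro y
    refine (norm_add_le _ _).trans ?_
    have : ‖(1 + x : ℂ)‖ = 1 + x := by
      rw [← ofReal_one, ← ofReal_add, norm_real, Real.norm_of_nonneg (by linarith)]
    rw [this]; simp only [norm_mul, norm_I, mul_one, norm_real, Real.norm_eq_abs]; linarith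
  have hB : ∀ y : ℝ, ‖riemannZeta₁ (1 + x + y * I)‖ ≤ 3 * (3 + |y|) ^ 2 := by
    intro y
    refine (norm_riemannZeta₁_le (by simp; linarith)).trans ?_
    have : (1 + ‖(1 + x + y * I : ℂ)‖) ^ 2 ≤ (3 + |y|) ^ 2 :=
      pow_le_pow_left₀ (by positivity) (by linarith [hN y]) 2
    linarith
  have e0 : ‖riemannZeta₁ (1 + x)‖ = x * ‖riemannZeta (1 + x)‖ := by
    rw [riemannZeta₁_eq_mul, norm_mul]
    · simp [abs_of_pos hx]
    · simpa using hx.ne'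
  have e1 : |t| * ‖riemannZeta (1 + x + I * t)‖ ≤ ‖riemannZeta₁ (1 + x + t * I)‖ := by
    rw [riemannZeta₁_eq_mul, norm_mul, mul_comm I]
    · gcongr
      simpa using abs_im_le_norm (1 + x + t * I - 1 : ℂ)
    · intro h; apply ht0; simpa using congrArg im h
  have e2 : |2 * t| * ‖riemannZeta (1 + x + 2 * I * t)‖ ≤
      ‖riemannZeta₁ (1 + x + (2 * t : ℝ) * I)‖ := by
    have : (1 + x + 2 * I * t : ℂ) = 1 + x + (2 * t : ℝ) * I := by push_cast; ring
    rw [this, riemannZeta₁_eq_mul, norm_mul]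
    · gcongr
      simpa using abs_im_le_norm (1 + x + (2 * t : ℝ) * I - 1 : ℂ)
    · intro h; apply ht0; simpa using congrArg im h
  have b0 := hB 0
  simp only [ofReal_zero, zero_mul, add_zero, abs_zero] at b0
  have b2 := hB (2 * t)
  set T := |t| with hT
  have hT2 : |2 * t| = 2 * T := by rw [abs_mul, abs_two]
  rw [hT2] at e2 b2
  set A := ‖riemannZeta (1 + x)‖
  set B := ‖riemannZeta (1 + x + I * t)‖
  set C := ‖riemannZeta (1 + x + 2 * I * t)‖
  set D := ‖riemannZeta₁ (1 + x + t * I)‖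
  have hA : x * A ≤ 27 := by rw [e0] at b0; linarith
  have hC : C ≤ 75 * T := by
    have h1 : 2 * T * C ≤ 3 * (5 * T) ^ 2 := by
      refine (e2.trans b2).trans ?_
      gcongr; linarith
    have h2 : 2 * T * C ≤ 2 * T * (75 * T) := by nlinarith
    exact le_of_mul_le_mul_left h2 (by linarith)
  have hA0 : 0 ≤ A := norm_nonneg _
  have hB0 : 0 ≤ B := norm_nonneg _
  have hC0 : 0 ≤ C := norm_nonneg _
  have hA3 : (x * A) ^ 3 ≤ 27 ^ 3 := by gcongr
  have hB4 : (T * B) ^ 4 ≤ D ^ 4 := by gcongr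
  have h5 : x ^ 3 ≤ (x * A) ^ 3 * B ^ 4 * C := by
    calc x ^ 3 = x ^ 3 * 1 := by ring
      _ ≤ x ^ 3 * (A ^ 3 * B ^ 4 * C) := by gcongr
      _ = _ := by ring
  -- The bounds 27 and 75 T come from the upper bound at heights 0 and 2t. Since T ≥ 1, the factor T
  -- may be raised to T⁴, which is what T B ≤ D requires.
  calc x ^ 3 ≤ (x * A) ^ 3 * B ^ 4 * C := h5
    _ ≤ 27 ^ 3 * B ^ 4 * (75 * T) := by gcongr
    _ = 1476225 * (B ^ 4 * T) := by ring
    _ ≤ 1476225 * (B ^ 4 * T ^ 4) := by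
        gcongr
        exact le_self_pow₀ ht (by norm_num)
    _ = 1476225 * (T * B) ^ 4 := by ring
    _ ≤ 1476225 * D ^ 4 := by gcongr
    _ ≤ _ := by
      have : 0 ≤ D ^ 4 := by positivity
      linarith

/-- At distance at least d⁴ from the line the 3-4-1 inequality gives a lower bound of order d³. This
exceeds, for small d, the variation of order d⁴ of ζ₁ over the remaining interval, so the bound can
be carried to the line itself. -/
theorem pow_three_le_norm_riemannZeta₁ {d x t : ℝ} (hd : 0 < d) (hx : d ^ 4 ≤ x) (hx1 : x ≤ 1)
    (ht : 1 ≤ |t|) : d ^ 3 ≤ 60 * ‖riemannZeta₁ (1 + x + t * I)‖ := by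
  have hx0 : 0 < x := lt_of_lt_of_le (by positivity) hx
  have h := rpow_le_norm_riemannZeta₁ hx0 hx1 ht
  set D := ‖riemannZeta₁ (1 + x + t * I)‖
  have hD : 0 ≤ D := norm_nonneg _
  refine le_of_pow_le_pow_left₀ (n := 4) (by norm_num) (by positivity) ?_
  calc (d ^ 3) ^ 4 = (d ^ 4) ^ 3 := by ring
    _ ≤ x ^ 3 := by gcongr
    _ ≤ 12000000 * D ^ 4 := h
    _ ≤ (60 * D) ^ 4 := by
      have : 0 ≤ D ^ 4 := by positivity
      nlinarith

/-- A polynomial lower bound for `(s - 1) ζ(s)` in the closed strip `1 ≤ Re s ≤ 2`. -/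
theorem exists_le_norm_riemannZeta₁ :
    ∃ c : ℝ, 0 < c ∧ ∀ σ t : ℝ, 1 ≤ σ → σ ≤ 2 →
      c ≤ ‖riemannZeta₁ (σ + t * I)‖ * (1 + |t|) ^ 6 := by
  have hK : IsCompact (Icc (1 : ℝ) 2 ×ˢ Icc (-1 : ℝ) 1) := isCompact_Icc.prod isCompact_Icc
  have hcont : ContinuousOn (fun p : ℝ × ℝ => ‖riemannZeta₁ (p.1 + p.2 * I)‖)
      (Icc (1 : ℝ) 2 ×ˢ Icc (-1 : ℝ) 1) := by
    refine Continuous.continuousOn ?_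
    have := differentiable_riemannZeta₁.continuous
    fun_prop
  obtain ⟨p, hp, hmin⟩ := hK.exists_isMinOn ⟨(1, 0), by simp⟩ hcont
  set c₁ := ‖riemannZeta₁ (p.1 + p.2 * I)‖
  have hc₁ : 0 < c₁ := by
    refine norm_pos_iff.mpr (riemannZeta₁_ne_zero_of_one_le_re ?_)
    simpa using hp.1.1
  -- κ = 1/(216 · 120). With d = κ/T² the derivative bound lets ζ₁ vary by at most 216 T² d⁴ =
  -- d³/120 between σ and 1 + d⁴, half of the lower bound d³/60 at the right end.
  set κ : ℝ := 1 / 25920 with hκ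
  refine ⟨min c₁ (κ ^ 3 / 120), lt_min hc₁ (by positivity), fun σ t h1 h2 => ?_⟩
  have hge1 : (1 : ℝ) ≤ (1 + |t|) ^ 6 := one_le_pow₀ (by linarith [abs_nonneg t])
  rcases le_total |t| 1 with ht | ht
  · have := hmin (show (σ, t) ∈ Icc (1 : ℝ) 2 ×ˢ Icc (-1 : ℝ) 1 from ⟨⟨h1, h2⟩, abs_le.mp ht⟩)
    refine (min_le_left _ _).trans (le_trans this ?_)
    exact le_mul_of_one_le_right (norm_nonneg _) hge1
  · refine (min_le_right _ _).trans ?_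
    set T := 1 + |t| with hT
    have hT1 : 2 ≤ T := by linarith
    set d : ℝ := κ / T ^ 2 with hd
    have hd0 : 0 < d := by positivity
    have hd1 : d ≤ 1 := by
      rw [hd, div_le_one (by positivity)]
      nlinarith [show κ ≤ 1 by rw [hκ]; norm_num]
    have key : d ^ 3 ≤ 120 * ‖riemannZeta₁ (σ + t * I)‖ := by
      rcases le_total (d ^ 4) (σ - 1) with h | h
      · have := pow_three_le_norm_riemannZeta₁ hd0 h (by linarith) ht
        have e : (1 + ((σ - 1 : ℝ) : ℂ) + t * I) = σ + t * I := by push_cast; ring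
        rw [e] at this
        linarith [norm_nonneg (riemannZeta₁ (σ + t * I))]
      · have hd4 : d ^ 4 ≤ 1 := pow_le_one₀ hd0.le hd1
        have h3 := pow_three_le_norm_riemannZeta₁ hd0 le_rfl hd4 ht
        have h4 := norm_riemannZeta₁_sub_le (t := t) h1 (by linarith : σ ≤ 1 + d ^ 4)
          (by linarith)
        have e : (1 + ((d ^ 4 : ℝ) : ℂ) + t * I) = ((1 + d ^ 4 : ℝ) : ℂ) + t * I := by
          push_cast; ring
        rw [e] at h3
        have h5 := norm_sub_norm_le (riemannZeta₁ (((1 + d ^ 4 : ℝ) : ℂ) + t * I))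
          (riemannZeta₁ (σ + t * I))
        have h6 : 216 * T ^ 2 * (1 + d ^ 4 - σ) ≤ d ^ 3 / 120 := by
          calc 216 * T ^ 2 * (1 + d ^ 4 - σ) ≤ 216 * T ^ 2 * d ^ 4 := by gcongr; linarith
            _ = 216 * d ^ 3 * (T ^ 2 * d) := by ring
            _ = 216 * d ^ 3 * κ := by rw [hd, mul_div_cancel₀ _ (by positivity)]
            _ = d ^ 3 / 120 := by rw [hκ]; ring
        linarith
    have : d ^ 3 * T ^ 6 = κ ^ 3 := by rw [hd]; field_simp
    rw [← this]
    have hT6 : 0 ≤ T ^ 6 := by positivity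
    nlinarith

/-! ### Euler products of the odd Möbius function and of the squarefree odd integers -/

open ArithmeticFunction in
/-- The Möbius function restricted to the odd integers. -/
def oddMoebius (n : ℕ) : ℤ := if Odd n then moebius n else 0

open Classical in
/-- The indicator function of the squarefree odd integers. -/
def sqfOddInd (n : ℕ) : ℤ := if Squarefree n ∧ Odd n then 1 else 0

theorem norm_oddMoebius_le (n : ℕ) : ‖(oddMoebius n : ℂ)‖ ≤ 1 := by
  rw [Complex.norm_intCast]
  unfold oddMoebius
  split_ifs
  · exact_mod_cast ArithmeticFunction.abs_moebius_le_one
  · simp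

theorem abs_oddMoebius_le (n : ℕ) : |(oddMoebius n : ℝ)| ≤ 1 := by
  simpa [Complex.norm_intCast] using norm_oddMoebius_le n

theorem norm_sqfOddInd_le (n : ℕ) : ‖(sqfOddInd n : ℂ)‖ ≤ 1 := by
  unfold sqfOddInd
  split_ifs <;> simp

theorem oddMoebius_mul {m n : ℕ} (h : m.Coprime n) :
    oddMoebius (m * n) = oddMoebius m * oddMoebius n := by
  unfold oddMoebius
  simp only [Nat.odd_mul]
  by_cases hm : Odd m <;> by_cases hn : Odd n <;>
    simp [hm, hn, ArithmeticFunction.isMultiplicative_moebius.2 h]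

theorem sqfOddInd_mul {m n : ℕ} (h : m.Coprime n) :
    sqfOddInd (m * n) = sqfOddInd m * sqfOddInd n := by
  unfold sqfOddInd
  simp only [Nat.odd_mul, Nat.squarefree_mul h]
  by_cases hm : Odd m <;> by_cases hn : Odd n <;> by_cases hm' : Squarefree m <;>
    by_cases hn' : Squarefree n <;> simp [hm, hn, hm', hn']

theorem not_squarefree_prime_pow {p e : ℕ} (hp : p.Prime) : ¬ Squarefree (p ^ (e + 2)) := by
  intro h
  have := h p ⟨p ^ e, by ring⟩
  exact hp.not_isUnit this

theorem oddMoebius_prime_pow {p e : ℕ} (hp : p.Prime) : oddMoebius (p ^ (e + 2)) = 0 := by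
  unfold oddMoebius
  rw [ArithmeticFunction.moebius_eq_zero_of_not_squarefree (not_squarefree_prime_pow hp), ite_self]

theorem sqfOddInd_prime_pow {p e : ℕ} (hp : p.Prime) : sqfOddInd (p ^ (e + 2)) = 0 := by
  unfold sqfOddInd
  rw [if_neg (fun h => not_squarefree_prime_pow hp h.1)]

theorem oddMoebius_prime {p : ℕ} (hp : p.Prime) : oddMoebius p = if p = 2 then 0 else -1 := by
  unfold oddMoebius
  rcases hp.eq_two_or_odd' with rfl | h
  · simp
  · rw [if_pos h, if_neg, ArithmeticFunction.moebius_apply_prime hp]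
    rintro rfl; exact absurd h (by decide)

theorem sqfOddInd_prime {p : ℕ} (hp : p.Prime) : sqfOddInd p = if p = 2 then 0 else 1 := by
  unfold sqfOddInd
  rcases hp.eq_two_or_odd' with rfl | h
  · simp
  · rw [if_pos ⟨hp.squarefree, h⟩, if_neg]
    rintro rfl; exact absurd h (by decide)

theorem norm_natCast_cpow_neg {s : ℂ} (hs : 0 < s.re) (n : ℕ) :
    ‖(n : ℂ) ^ (-s)‖ = (n : ℝ) ^ (-s.re) := by
  rw [← ofReal_natCast, norm_cpow_eq_rpow_re_of_nonneg (Nat.cast_nonneg n)]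
  · simp
  · simpa using hs.ne'

theorem summable_norm_mul_cpow {g : ℕ → ℤ} (hg : ∀ n, ‖(g n : ℂ)‖ ≤ 1) {s : ℂ} (hs : 1 < s.re) :
    Summable fun n : ℕ => ‖(g n : ℂ) * (n : ℂ) ^ (-s)‖ := by
  refine Summable.of_nonneg_of_le (fun n => norm_nonneg _) (fun n => ?_)
    (Real.summable_nat_rpow.mpr (by linarith : -s.re < -1))
  rw [norm_mul, norm_natCast_cpow_neg (by linarith)]
  exact mul_le_of_le_one_left (by positivity) (hg n)

/-- Since g kills the prime powers beyond the first, each local factor of the Euler product reduces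
to its first two terms. -/
theorem hasProd_of_squarefree_support {g : ℕ → ℤ} (h1 : g 1 = 1)
    (hmul : ∀ {m n : ℕ}, m.Coprime n → g (m * n) = g m * g n)
    (hg : ∀ n, ‖(g n : ℂ)‖ ≤ 1) (hpow : ∀ {p e : ℕ}, p.Prime → g (p ^ (e + 2)) = 0)
    {s : ℂ} (hs : 1 < s.re) :
    HasProd (fun p : Nat.Primes => 1 + (g p : ℂ) * (p : ℂ) ^ (-s))
      (∑' n : ℕ, (g n : ℂ) * (n : ℂ) ^ (-s)) := by
  have hs0 : -s ≠ 0 := by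
    intro h; rw [neg_eq_zero] at h; rw [h] at hs; simp at hs; linarith
  have key := EulerProduct.eulerProduct_hasProd (f := fun n : ℕ => (g n : ℂ) * (n : ℂ) ^ (-s))
    (by simp [h1])
    (fun {m n} h => by
      rw [hmul h, Nat.cast_mul, ← ofReal_natCast m, ← ofReal_natCast n,
        mul_cpow_ofReal_nonneg (Nat.cast_nonneg m) (Nat.cast_nonneg n)]
      push_cast; ring)
    (summable_norm_mul_cpow hg hs) (by simp [zero_cpow hs0])
  convert key using 1
  funext p
  rw [tsum_eq_sum (s := Finset.range 2)]
  · simp [Finset.sum_range_succ, h1]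
  · intro e he
    obtain ⟨k, rfl⟩ := Nat.exists_eq_add_of_le' (by
      have := mt Finset.mem_range.mpr he; omega : 2 ≤ e)
    simp [hpow p.2]

theorem norm_prime_cpow_lt_one {p : ℕ} (hp : p.Prime) {s : ℂ} (hs : 0 < s.re) :
    ‖(p : ℂ) ^ (-s)‖ < 1 := by
  rw [norm_natCast_cpow_neg hs]
  exact Real.rpow_lt_one_of_one_lt_of_neg (by exact_mod_cast hp.one_lt) (by linarith)

theorem one_sub_ne_zero_of_norm_lt_one {z : ℂ} (hz : ‖z‖ < 1) : 1 - z ≠ 0 := by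
  intro h
  rw [sub_eq_zero] at h
  rw [← h] at hz; simp at hz

theorem one_add_ne_zero_of_norm_lt_one {z : ℂ} (hz : ‖z‖ < 1) : 1 + z ≠ 0 := by
  have := one_sub_ne_zero_of_norm_lt_one (z := -z) (by simpa using hz)
  simpa using this

theorem one_sub_two_cpow_ne_zero {s : ℂ} (hs : 0 < s.re) : 1 - (2 : ℂ) ^ (-s) ≠ 0 := by
  simpa using one_sub_ne_zero_of_norm_lt_one (norm_prime_cpow_lt_one Nat.prime_two hs)

theorem one_add_two_cpow_ne_zero {s : ℂ} (hs : 0 < s.re) : 1 + (2 : ℂ) ^ (-s) ≠ 0 := by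
  simpa using one_add_ne_zero_of_norm_lt_one (norm_prime_cpow_lt_one Nat.prime_two hs)

/-- Serves to correct the single Euler factor at 2. -/
theorem hasProd_primes_two (c : ℂ) :
    HasProd (fun p : Nat.Primes => if (p : ℕ) = 2 then c else 1) c := by
  simpa using hasProd_single (f := fun p : Nat.Primes => if (p : ℕ) = 2 then c else 1)
    (⟨2, Nat.prime_two⟩ : Nat.Primes) fun p hp => if_neg fun h => hp (Subtype.ext h)

/-- Against the Euler product of ζ all local factors cancel except the one at 2, where the Möbius
factor is missing. -/
theorem tsum_oddMoebius {s : ℂ} (hs : 1 < s.re) :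
    ∑' n : ℕ, (oddMoebius n : ℂ) * (n : ℂ) ^ (-s) =
      (1 - (2 : ℂ) ^ (-s))⁻¹ / riemannZeta s := by
  have h1 := hasProd_of_squarefree_support (g := oddMoebius) (by simp [oddMoebius])
    oddMoebius_mul norm_oddMoebius_le oddMoebius_prime_pow hs
  have h2 := h1.mul (riemannZeta_eulerProduct_hasProd hs)
  have h3 := hasProd_primes_two (1 - (2 : ℂ) ^ (-s))⁻¹
  have h4 := h2.unique (by
    convert h3 using 2 with p
    rw [oddMoebius_prime p.2]
    split_ifs with h
    · simp [h]
    · have := one_sub_ne_zero_of_norm_lt_one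
        (norm_prime_cpow_lt_one p.2 (by linarith : 0 < s.re))
      push_cast
      rw [neg_one_mul, ← sub_eq_add_neg, mul_inv_cancel₀ this])
  rw [← h4, mul_div_cancel_right₀]
  exact riemannZeta_ne_zero_of_one_lt_re hs

/-- At an odd prime 1 + p^{-s} = (1 − p^{-2s})/(1 − p^{-s}); the absent factor at 2 is restored by 1
+ 2^{-s}. -/
theorem tsum_sqfOddInd {s : ℂ} (hs : 1 < s.re) :
    ∑' n : ℕ, (sqfOddInd n : ℂ) * (n : ℂ) ^ (-s) =
      (1 + (2 : ℂ) ^ (-s))⁻¹ * (riemannZeta s / riemannZeta (2 * s)) := by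
  have hs2 : 1 < (2 * s).re := by simp; linarith
  have h1 := hasProd_of_squarefree_support (g := sqfOddInd) (by simp [sqfOddInd])
    sqfOddInd_mul norm_sqfOddInd_le sqfOddInd_prime_pow hs
  have h2 := (h1.mul (riemannZeta_eulerProduct_hasProd hs2)).mul
    (hasProd_primes_two (1 + (2 : ℂ) ^ (-s)))
  have h4 := h2.unique (by
    convert riemannZeta_eulerProduct_hasProd hs using 2 with p
    rw [sqfOddInd_prime p.2]
    have hlt := norm_prime_cpow_lt_one p.2 (by linarith : 0 < s.re)
    have ha := one_sub_ne_zero_of_norm_lt_one hlt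
    have hb := one_add_ne_zero_of_norm_lt_one hlt
    have he : (p : ℂ) ^ (-(2 * s)) = ((p : ℂ) ^ (-s)) ^ 2 := by
      rw [← cpow_nat_mul]; congr 1; push_cast; ring
    have hp2 : (if (p : ℕ) = 2 then 1 + (2 : ℂ) ^ (-s) else 1) =
        (if (p : ℕ) = 2 then 1 + (p : ℂ) ^ (-s) else 1) := by
      split_ifs with h <;> simp [h]
    rw [he, hp2]
    have hf : 1 - ((p : ℂ) ^ (-s)) ^ 2 = (1 - (p : ℂ) ^ (-s)) * (1 + (p : ℂ) ^ (-s)) := by ring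
    rw [hf]
    split_ifs with h
    · push_cast; field_simp; ring
    · push_cast; field_simp)
  have h5 := one_add_two_cpow_ne_zero (s := s) (by linarith)
  have h6 := riemannZeta_ne_zero_of_one_lt_re hs2
  rw [← h4, ← mul_div_assoc, eq_div_iff h6, mul_comm, eq_comm, inv_mul_eq_iff_eq_mul₀ h5]
  ring

/-- Divisors that are not squarefree contribute nothing, so r may be replaced by its radical, for
which the sum factors over the primes. The identity is the source of the weights 1 − p in the
lattice sum. -/
theorem sum_divisors_oddMoebius_mul {r : ℕ} (hr : r ≠ 0) :
    ∑ n ∈ r.divisors, oddMoebius n * (n : ℤ) = oddCoeff r := by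
  let F : ArithmeticFunction ℤ := ⟨fun n => oddMoebius n * (n : ℤ), by simp⟩
  have hF : F.IsMultiplicative := by
    refine ⟨by simp [F, oddMoebius], fun {m n} h => ?_⟩
    simp only [F, ArithmeticFunction.coe_mk, oddMoebius_mul h]
    push_cast; ring
  set s := ∏ p ∈ r.primeFactors, p with hs
  have hsq : Squarefree s := by
    have := Finset.squarefree_prod_of_pairwise_isCoprime (s := r.primeFactors) (f := fun p => p)
      (fun p hp q hq hpq => by
        exact Nat.coprime_iff_isRelPrime.mp ((Nat.coprime_primes (Nat.prime_of_mem_primeFactors hp)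
          (Nat.prime_of_mem_primeFactors hq)).mpr hpq))
      (fun p hp => (Nat.prime_of_mem_primeFactors hp).squarefree)
    exact this
  have hpf : s.primeFactors = r.primeFactors :=
    Nat.primeFactors_prod fun p hp => Nat.prime_of_mem_primeFactors hp
  have hdvd : s ∣ r := Nat.prod_primeFactors_dvd r
  have h1 := hF.prodPrimeFactors_one_add_of_squarefree hsq
  rw [hpf] at h1
  have h2 : ∑ n ∈ s.divisors, F n = ∑ n ∈ r.divisors, F n := by
    refine Finset.sum_subset (Nat.divisors_subset_of_dvd hr hdvd) fun n hn hn' => ?_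
    have hnr : n ∣ r := Nat.dvd_of_mem_divisors hn
    have : ¬ Squarefree n := by
      intro hnsq
      apply hn'
      rw [Nat.mem_divisors]
      refine ⟨?_, hsq.ne_zero⟩
      rw [← Nat.prod_primeFactors_of_squarefree hnsq]
      exact Finset.prod_dvd_prod_of_subset _ _ _ (Nat.primeFactors_mono hnr hr)
    simp [F, oddMoebius, ArithmeticFunction.moebius_eq_zero_of_not_squarefree this]
  change ∑ n ∈ r.divisors, F n = _
  rw [← h2, ← h1, oddCoeff]
  have h3 : ∏ p ∈ r.primeFactors.erase 2, (1 + F p) = ∏ p ∈ r.primeFactors, (1 + F p) := by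
    refine Finset.prod_subset (Finset.erase_subset _ _) fun p hp hp' => ?_
    have : p = 2 := by
      by_contra h; exact hp' (Finset.mem_erase.mpr ⟨h, hp⟩)
    subst this
    simp [F, oddMoebius]
  rw [← h3]
  refine Finset.prod_congr rfl fun p hp => ?_
  rw [Finset.mem_erase] at hp
  simp [F, oddMoebius_prime (Nat.prime_of_mem_primeFactors hp.2), hp.1]
  ring

/-! ### Counting the squarefree odd integers -/

theorem sq_dvd_squarefree_mul_sq {a b d : ℕ} (ha : Squarefree a) (hb : b ≠ 0)
    (h : d ^ 2 ∣ a * b ^ 2) : d ∣ b := by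
  -- With the gcd removed, d'² is prime to b'² and therefore divides a, which forces d' = 1.
  obtain ⟨g, d', b', hg, hcop, rfl, rfl⟩ := Nat.exists_coprime' (Nat.gcd_pos_of_pos_right d (Nat.pos_of_ne_zero hb))
  have h1 : d' ^ 2 ∣ a * b' ^ 2 := by
    have : (d' * g) ^ 2 = d' ^ 2 * g ^ 2 := by ring
    rw [this, show a * (b' * g) ^ 2 = a * b' ^ 2 * g ^ 2 by ring] at h
    exact Nat.dvd_of_mul_dvd_mul_right (by positivity) h
  have h2 : d' ^ 2 ∣ a := (Nat.Coprime.pow 2 2 hcop).dvd_of_dvd_mul_right h1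
  have h3 : IsUnit d' := ha d' (by rwa [← sq])
  rw [Nat.isUnit_iff.mp h3, one_mul]
  exact dvd_mul_left _ _

/-- Detection of squarefree odd integers by the Möbius function. -/
theorem sum_oddMoebius_sq_dvd {n N : ℕ} (hn : n ∈ Finset.Icc 1 N) :
    ∑ d ∈ Finset.Icc 1 N, (if Odd n ∧ d ^ 2 ∣ n then oddMoebius d else 0) = sqfOddInd n := by
  obtain ⟨hn1, hnN⟩ := Finset.mem_Icc.mp hn
  by_cases ho : Odd n
  swap
  · simp [ho, sqfOddInd]
  obtain ⟨a, b, hab, ha⟩ := Nat.sq_mul_squarefree n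
  have hb : b ≠ 0 := by rintro rfl; simp at hab; omega
  have hbo : Odd b := by
    rw [← hab, Nat.odd_mul, Nat.odd_pow_iff two_ne_zero] at ho
    exact ho.1
  rw [← Finset.sum_filter]
  -- For n = b² a with a squarefree, d² ∣ n amounts to d ∣ b, and the Möbius sum over the divisors
  -- of b detects b = 1.
  have hset : Finset.filter (fun d => Odd n ∧ d ^ 2 ∣ n) (Finset.Icc 1 N) = b.divisors := by
    ext d
    simp only [Finset.mem_filter, Finset.mem_Icc, Nat.mem_divisors, ho, true_and]
    constructor
    · rintro ⟨_, h⟩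
      exact ⟨sq_dvd_squarefree_mul_sq ha hb (by rwa [mul_comm, hab]), hb⟩
    · rintro ⟨h, _⟩
      have h1 : d ^ 2 ∣ n := hab ▸ (pow_dvd_pow_of_dvd h 2).mul_right a
      refine ⟨⟨Nat.pos_of_dvd_of_pos h (Nat.pos_of_ne_zero hb), ?_⟩, h1⟩
      exact ((Nat.le_self_pow two_ne_zero d).trans (Nat.le_of_dvd hn1 h1)).trans hnN
  rw [hset]
  have h1 : ∑ d ∈ b.divisors, oddMoebius d = ∑ d ∈ b.divisors, ArithmeticFunction.moebius d := by
    refine Finset.sum_congr rfl fun d hd => ?_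
    rw [oddMoebius, if_pos (hbo.of_dvd_nat (Nat.dvd_of_mem_divisors hd))]
  rw [h1, ← ArithmeticFunction.coe_mul_zeta_apply, ArithmeticFunction.moebius_mul_coe_zeta,
    ArithmeticFunction.one_apply]
  unfold sqfOddInd
  by_cases hb1 : b = 1
  · subst hb1
    rw [if_pos rfl, if_pos]
    simp only [one_pow, one_mul] at hab
    exact ⟨hab ▸ ha, ho⟩
  · rw [if_neg hb1, if_neg]
    rintro ⟨hsq, _⟩
    apply hb1
    have := hsq b ⟨a, by rw [← hab]; ring⟩
    exact Nat.isUnit_iff.mp this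

theorem card_odd_Icc (M : ℕ) : ((Finset.Icc 1 M).filter Odd).card = (M + 1) / 2 := by
  induction M with
  | zero => simp
  | succ M ih =>
    rw [← Finset.insert_Icc_right_eq_Icc_add_one (by omega), Finset.filter_insert]
    split_ifs with h
    · rw [Finset.card_insert_of_notMem (by simp), ih]
      obtain ⟨k, hk⟩ := h
      omega
    · rw [ih]
      rw [Nat.not_odd_iff_even] at h
      obtain ⟨k, hk⟩ := h
      omega

/-- The number of odd multiples of `e` up to `N`. -/
theorem card_odd_multiples (N : ℕ) {e : ℕ} (he : Odd e) :
    ((Finset.Icc 1 N).filter fun n => Odd n ∧ e ∣ n).card = (N / e + 1) / 2 := by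
  have he0 : 0 < e := he.pos
  rw [← card_odd_Icc]
  symm
  refine Finset.card_bij (fun m _ => e * m) ?_ ?_ ?_
  · intro m hm
    simp only [Finset.mem_filter, Finset.mem_Icc] at hm ⊢
    refine ⟨⟨Nat.mul_pos he0 hm.1.1, ?_⟩, he.mul hm.2, dvd_mul_right _ _⟩
    rw [mul_comm]; exact (Nat.le_div_iff_mul_le he0).mp hm.1.2
  · intro a _ b _ h
    exact Nat.eq_of_mul_eq_mul_left he0 h
  · intro n hn
    simp only [Finset.mem_filter, Finset.mem_Icc] at hn
    obtain ⟨⟨h1, h2⟩, h3, m, rfl⟩ := hn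
    refine ⟨m, ?_, rfl⟩
    simp only [Finset.mem_filter, Finset.mem_Icc]
    refine ⟨⟨Nat.pos_of_mul_pos_left h1, ?_⟩, (Nat.odd_mul.mp h3).2⟩
    rw [Nat.le_div_iff_mul_le he0, mul_comm]; exact h2

/-- The density of the squarefree odd integers. -/
def sqfDensity : ℝ := (1 / 2) * ∑' d : ℕ, (oddMoebius d : ℝ) / (d : ℝ) ^ 2

/-- The number of squarefree odd integers up to `x`. -/
def sqfCount (x : ℝ) : ℝ := ∑ k ∈ Finset.Icc 1 ⌊x⌋₊, (sqfOddInd k : ℝ)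

theorem sqfDensity_ne_zero : sqfDensity ≠ 0 := by
  have h := tsum_oddMoebius (s := 2) (by simp)
  have h1 : ((∑' d : ℕ, (oddMoebius d : ℝ) / (d : ℝ) ^ 2 : ℝ) : ℂ) =
      ∑' n : ℕ, (oddMoebius n : ℂ) * (n : ℂ) ^ (-2 : ℂ) := by
    rw [ofReal_tsum]
    refine tsum_congr fun n => ?_
    rw [cpow_neg]
    push_cast
    rw [div_eq_mul_inv, ← cpow_natCast]
    simp
  intro h0
  have h2 : (∑' d : ℕ, (oddMoebius d : ℝ) / (d : ℝ) ^ 2 : ℝ) = 0 := by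
    unfold sqfDensity at h0
    linarith
  rw [h2, h] at h1
  have h3 := div_ne_zero (inv_ne_zero (one_sub_two_cpow_ne_zero (s := 2) (by simp)))
    (riemannZeta_ne_zero_of_one_lt_re (s := 2) (by simp))
  exact h3 (by rw [← h1, ofReal_zero])

theorem sqfCount_eq (x : ℝ) :
    sqfCount x = ∑' d : ℕ, (oddMoebius d : ℝ) * (((⌊x⌋₊ / d ^ 2 + 1) / 2 : ℕ) : ℝ) := by
  set N := ⌊x⌋₊ with hN
  have h1 : ∑ k ∈ Finset.Icc 1 N, sqfOddInd k =
      ∑ d ∈ Finset.Icc 1 N, oddMoebius d * (((N / d ^ 2 + 1) / 2 : ℕ) : ℤ) := by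
    rw [← Finset.sum_congr rfl fun n hn => sum_oddMoebius_sq_dvd hn, Finset.sum_comm]
    refine Finset.sum_congr rfl fun d _ => ?_
    rw [← Finset.sum_filter, Finset.sum_const, nsmul_eq_mul]
    by_cases hd : Odd d
    · rw [card_odd_multiples N hd.pow, mul_comm]
    · simp [oddMoebius, hd]
  rw [sqfCount, tsum_eq_sum (s := Finset.Icc 1 N), ← hN]
  · have h2 := congrArg (Int.cast : ℤ → ℝ) h1
    simpa only [Int.cast_sum, Int.cast_mul, Int.cast_natCast] using h2
  · intro d hd
    rcases Nat.eq_zero_or_pos d with rfl | hd0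
    · simp [oddMoebius]
    · have : N < d := by
        by_contra h
        exact hd (Finset.mem_Icc.mpr ⟨hd0, not_lt.mp h⟩)
      have h2 : N / d ^ 2 = 0 :=
        Nat.div_eq_of_lt (this.trans_le (Nat.le_self_pow two_ne_zero d))
      simp [h2]

/-- With y = x/d², the left side is y/2 for y < 1 and at most 1/2 for y ≥ 1. The power y^θ covers
both ranges at once, so that the sum over d need not be cut at √x. -/
theorem abs_half_floor_sub_le {x : ℝ} (hx : 0 ≤ x) {d : ℕ} (hd : 0 < d) {θ : ℝ} (h0 : 0 ≤ θ)
    (h1 : θ ≤ 1) :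
    |(((⌊x⌋₊ / d ^ 2 + 1) / 2 : ℕ) : ℝ) - 1 / 2 * (x / (d : ℝ) ^ 2)| ≤
      (x / (d : ℝ) ^ 2) ^ θ := by
  have hM : ⌊x⌋₊ / d ^ 2 = ⌊x / (d : ℝ) ^ 2⌋₊ := by
    rw [← Nat.floor_div_natCast]; norm_cast
  rw [hM]
  set y := x / (d : ℝ) ^ 2
  have hy : 0 ≤ y := by positivity
  rcases lt_or_ge y 1 with hlt | hge
  · rw [Nat.floor_eq_zero.mpr hlt]
    simp only [zero_add, Nat.reduceDiv, Nat.cast_zero, zero_sub, abs_neg]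
    rw [abs_of_nonneg (by positivity)]
    rcases hy.eq_or_lt with hy0 | hy0
    · rw [← hy0]; simp; exact Real.rpow_nonneg le_rfl _
    calc 1 / 2 * y ≤ y := by linarith
      _ = y ^ (1 : ℝ) := (Real.rpow_one y).symm
      _ ≤ y ^ θ := Real.rpow_le_rpow_of_exponent_ge hy0 hlt.le h1
  · refine le_trans ?_ (Real.one_le_rpow hge h0)
    have a1 := Nat.floor_le hy
    have a2 := Nat.lt_floor_add_one y
    set M := ⌊y⌋₊
    have b1 : (M : ℝ) ≤ 2 * (((M + 1) / 2 : ℕ) : ℝ) := by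
      have : M ≤ 2 * ((M + 1) / 2) := by omega
      exact_mod_cast this
    have b2 : 2 * (((M + 1) / 2 : ℕ) : ℝ) ≤ M + 1 := by
      have : 2 * ((M + 1) / 2) ≤ M + 1 := by omega
      exact_mod_cast this
    rw [abs_le]; constructor <;> linarith

/-- The counting function of the squarefree odd integers: density with a power-saving error. -/
theorem exists_abs_sqfCount_sub_le {θ : ℝ} (h0 : 1 / 2 < θ) (h1 : θ ≤ 1) :
    ∃ C : ℝ, 0 ≤ C ∧ ∀ x : ℝ, 0 < x → |sqfCount x - sqfDensity * x| ≤ C * x ^ θ := by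
  -- The sum of (x/d²)^θ over d converges because 2θ > 1. This is the origin of the exponent 1/2,
  -- and later of the line Re s = 3/2.
  refine ⟨∑' d : ℕ, (d : ℝ) ^ (-(2 * θ)), tsum_nonneg fun d => by positivity, fun x hx => ?_⟩
  have hs1 : Summable fun d : ℕ => (d : ℝ) ^ (-(2 * θ)) :=
    Real.summable_nat_rpow.mpr (by linarith)
  have hs2 : Summable fun d : ℕ => (oddMoebius d : ℝ) / (d : ℝ) ^ 2 := by
    refine Summable.of_norm_bounded (g := fun d : ℕ => ((d : ℝ) ^ 2)⁻¹)
      (Real.summable_nat_pow_inv.mpr one_lt_two) fun d => ?_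
    rw [norm_div, div_eq_mul_inv, Real.norm_eq_abs, Real.norm_of_nonneg (by positivity)]
    exact mul_le_of_le_one_left (by positivity) (abs_oddMoebius_le d)
  have hs3 : Summable fun d : ℕ => (oddMoebius d : ℝ) * (((⌊x⌋₊ / d ^ 2 + 1) / 2 : ℕ) : ℝ) := by
    refine summable_of_ne_finset_zero (s := Finset.Icc 1 ⌊x⌋₊) fun d hd => ?_
    rcases Nat.eq_zero_or_pos d with rfl | hd0
    · simp [oddMoebius]
    · have : ⌊x⌋₊ < d := by
        by_contra h
        exact hd (Finset.mem_Icc.mpr ⟨hd0, not_lt.mp h⟩)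
      have h2 : ⌊x⌋₊ / d ^ 2 = 0 :=
        Nat.div_eq_of_lt (this.trans_le (Nat.le_self_pow two_ne_zero d))
      simp [h2]
  have e : sqfCount x - sqfDensity * x = ∑' d : ℕ, (oddMoebius d : ℝ) *
      ((((⌊x⌋₊ / d ^ 2 + 1) / 2 : ℕ) : ℝ) - 1 / 2 * (x / (d : ℝ) ^ 2)) := by
    rw [sqfCount_eq, sqfDensity, ← tsum_mul_left, ← tsum_mul_right,
      ← hs3.tsum_sub ((hs2.mul_left (1 / 2)).mul_right x)]
    refine tsum_congr fun d => ?_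
    ring
  rw [e, ← tsum_mul_right, ← Real.norm_eq_abs]
  refine tsum_of_norm_bounded (hs1.mul_right _).hasSum fun d => ?_
  rcases Nat.eq_zero_or_pos d with rfl | hd
  · simp only [oddMoebius, Nat.not_odd_zero, if_false, Int.cast_zero, zero_mul, norm_zero]
    positivity
  · rw [norm_mul]
    calc _ ≤ 1 * (x / (d : ℝ) ^ 2) ^ θ := by
          gcongr
          · exact abs_oddMoebius_le d
          · exact abs_half_floor_sub_le hx.le hd (by linarith) h1
      _ = _ := by
        rw [one_mul, Real.div_rpow hx.le (by positivity), ← Real.rpow_natCast_mul (by positivity),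
          Real.rpow_neg (by positivity), div_eq_mul_inv, mul_comm]
        norm_num

/-! ### The Wigner function: rapid decay and derivative along rays -/

/-- Multiplication by the coordinate on the Schwartz space of the line. -/
def mulX (u : 𝓢(ℝ, ℂ)) : 𝓢(ℝ, ℂ) := SchwartzMap.smulLeftCLM ℂ (fun x : ℝ => (x : ℂ)) u

/-- Differentiation on the Schwartz space of the line. -/
def diffD (u : 𝓢(ℝ, ℂ)) : 𝓢(ℝ, ℂ) := SchwartzMap.derivCLM ℂ ℂ u

/-- Reflection on the Schwartz space of the line. -/
def reflect (u : 𝓢(ℝ, ℂ)) : 𝓢(ℝ, ℂ) :=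
  SchwartzMap.compCLMOfContinuousLinearEquiv ℂ (ContinuousLinearEquiv.neg ℝ) u

theorem mulX_apply (u : 𝓢(ℝ, ℂ)) (x : ℝ) : mulX u x = x * u x := by
  rw [mulX, SchwartzMap.smulLeftCLM_apply_apply Function.Complex.hasTemperateGrowth_ofReal, smul_eq_mul]

theorem reflect_apply (u : 𝓢(ℝ, ℂ)) (x : ℝ) : reflect u x = u (-x) := rfl

theorem hasDerivAt_schwartz (u : 𝓢(ℝ, ℂ)) (x : ℝ) : HasDerivAt u (diffD u x) x := by
  rw [diffD, SchwartzMap.derivCLM_apply]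
  exact u.differentiableAt.hasDerivAt

theorem schwartz_decay (u : 𝓢(ℝ, ℂ)) (N : ℕ) :
    ∃ C : ℝ, 0 ≤ C ∧ ∀ x : ℝ, (1 + |x|) ^ N * ‖u x‖ ≤ C := by
  refine ⟨max 0 (2 ^ N * (Finset.Iic (N, 0)).sup (fun m => SchwartzMap.seminorm ℝ m.1 m.2) u),
    le_max_left _ _, fun x => (le_max_right _ _).trans' ?_⟩
  simpa using SchwartzMap.one_add_le_sup_seminorm_apply (𝕜 := ℝ) (m := (N, 0)) (k := N) (n := 0)
    le_rfl le_rfl u x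

/-- The function `conj (v (a + r)) u (a - r)`, whose Fourier transform in `r` is the Wigner
function. -/
def kern (v u : 𝓢(ℝ, ℂ)) (a r : ℝ) : ℂ := (starRingEnd ℂ) (v (a + r)) * u (a - r)

/-- Both |a| and |r| are at most |a + r| + |a − r|, so 2N powers of decay in each of v and u give N
powers in a and N in r. -/
theorem kern_decay (v u : 𝓢(ℝ, ℂ)) (N : ℕ) :
    ∃ C : ℝ, 0 ≤ C ∧ ∀ a r : ℝ, ‖kern v u a r‖ ≤ C * ((1 + |a|) ^ N)⁻¹ * ((1 + |r|) ^ N)⁻¹ := by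
  obtain ⟨C₁, h₁, H₁⟩ := schwartz_decay v (2 * N)
  obtain ⟨C₂, h₂, H₂⟩ := schwartz_decay u (2 * N)
  refine ⟨C₁ * C₂, by positivity, fun a r => ?_⟩
  have hv := H₁ (a + r)
  have hu := H₂ (a - r)
  rw [kern, norm_mul, RCLike.norm_conj]
  set w := |a + r| with hw
  set z := |a - r| with hz
  have hw0 : 0 ≤ w := abs_nonneg _
  have hz0 : 0 ≤ z := abs_nonneg _
  have ha : 1 + |a| ≤ (1 + w) * (1 + z) := by
    have : |a| ≤ w + z := by
      have h := abs_add_le (a + r) (a - r)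
      have e : a + r + (a - r) = 2 * a := by ring
      rw [e, abs_mul, abs_two] at h
      linarith [abs_nonneg a]
    nlinarith [mul_nonneg hw0 hz0]
  have hr : 1 + |r| ≤ (1 + w) * (1 + z) := by
    have : |r| ≤ w + z := by
      have h := abs_sub (a + r) (a - r)
      have e : a + r - (a - r) = 2 * r := by ring
      rw [e, abs_mul, abs_two] at h
      linarith [abs_nonneg r]
    nlinarith [mul_nonneg hw0 hz0]
  rw [mul_assoc, ← mul_inv, ← div_eq_mul_inv, le_div_iff₀ (by positivity)]
  calc ‖v (a + r)‖ * ‖u (a - r)‖ * ((1 + |a|) ^ N * (1 + |r|) ^ N)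
      ≤ ‖v (a + r)‖ * ‖u (a - r)‖ * (((1 + w) * (1 + z)) ^ N * ((1 + w) * (1 + z)) ^ N) := by
        gcongr
    _ = ((1 + w) ^ (2 * N) * ‖v (a + r)‖) * ((1 + z) ^ (2 * N) * ‖u (a - r)‖) := by
        simp only [mul_pow, two_mul, pow_add]; ring
    _ ≤ C₁ * C₂ := by gcongr

theorem integrable_inv_one_add_abs_sq : Integrable fun r : ℝ => ((1 + |r|) ^ 2)⁻¹ := by
  have := integrable_one_add_norm (E := ℝ) (μ := volume) (r := 2) (by simp)
  refine this.congr (ae_of_all _ fun r => ?_)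
  simp only [Real.norm_eq_abs]
  rw [Real.rpow_neg (by positivity)]
  norm_cast

theorem continuous_kern (v u : 𝓢(ℝ, ℂ)) : Continuous fun q : ℝ × ℝ => kern v u q.1 q.2 := by
  have h1 := v.continuous
  have h2 := u.continuous
  unfold kern
  fun_prop

/-- The exponential factor in the Wigner function. -/
def wexp (ξ r : ℝ) : ℂ := Complex.exp (2 * Real.pi * I * (ξ : ℂ) * (r : ℂ))

theorem norm_wexp (ξ r : ℝ) : ‖wexp ξ r‖ = 1 := by
  have : 2 * Real.pi * I * (ξ : ℂ) * (r : ℂ) = ((2 * Real.pi * ξ * r : ℝ) : ℂ) * I := by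
    push_cast; ring
  rw [wexp, this, norm_exp_ofReal_mul_I]

theorem continuous_wexp : Continuous fun q : ℝ × ℝ => wexp q.1 q.2 := by
  unfold wexp
  fun_prop

theorem wigner_eq (v u : 𝓢(ℝ, ℂ)) (p : ℝ × ℝ) :
    wigner v u p = ∫ r : ℝ, kern v u p.1 r * wexp p.2 r := rfl

/-- The bounds are uniform in a, as domination requires when a moves; the version with |r| serves
differentiation in ξ. -/
theorem exists_integrable_bound (v u : 𝓢(ℝ, ℂ)) :
    ∃ C : ℝ, 0 ≤ C ∧ ∀ a r : ℝ, ‖kern v u a r‖ ≤ C * ((1 + |r|) ^ 2)⁻¹ ∧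
      |r| * ‖kern v u a r‖ ≤ C * ((1 + |r|) ^ 2)⁻¹ := by
  obtain ⟨C, hC, H⟩ := kern_decay v u 3
  refine ⟨C, hC, fun a r => ?_⟩
  have h1 : ‖kern v u a r‖ ≤ C * ((1 + |r|) ^ 3)⁻¹ := by
    refine (H a r).trans ?_
    gcongr
    refine mul_le_of_le_one_right hC (inv_le_one_of_one_le₀ (one_le_pow₀ ?_))
    linarith [abs_nonneg a]
  have h2 : (1 + |r|) * ((1 + |r|) ^ 3)⁻¹ = ((1 + |r|) ^ 2)⁻¹ := by
    have : 1 + |r| ≠ 0 := by positivity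
    field_simp
  have h0 : 0 ≤ ((1 + |r|) ^ 3)⁻¹ := by positivity
  constructor
  · refine h1.trans ?_
    rw [← h2]
    gcongr
    nlinarith [abs_nonneg r]
  · calc |r| * ‖kern v u a r‖ ≤ (1 + |r|) * (C * ((1 + |r|) ^ 3)⁻¹) := by
          gcongr
          linarith
      _ = _ := by rw [← h2]; ring

theorem integrable_kern_mul (v u : 𝓢(ℝ, ℂ)) (a ξ : ℝ) :
    Integrable fun r : ℝ => kern v u a r * wexp ξ r := by
  obtain ⟨C, hC, H⟩ := exists_integrable_bound v u
  refine (integrable_inv_one_add_abs_sq.const_mul C).mono' ?_ (ae_of_all _ fun r => ?_)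
  · have h1 := (continuous_kern v u).comp (Continuous.prodMk_right a)
    have h2 := continuous_wexp.comp (Continuous.prodMk_right ξ)
    exact (h1.mul h2).aestronglyMeasurable
  · rw [norm_mul, norm_wexp, mul_one]; exact (H a r).1

theorem integrable_mul_kern_mul (v u : 𝓢(ℝ, ℂ)) (a ξ : ℝ) :
    Integrable fun r : ℝ => (r : ℂ) * kern v u a r * wexp ξ r := by
  obtain ⟨C, hC, H⟩ := exists_integrable_bound v u
  refine (integrable_inv_one_add_abs_sq.const_mul C).mono' ?_ (ae_of_all _ fun r => ?_)
  · have h1 := (continuous_kern v u).comp (Continuous.prodMk_right a)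
    have h2 := continuous_wexp.comp (Continuous.prodMk_right ξ)
    exact ((continuous_ofReal.mul h1).mul h2).aestronglyMeasurable
  · rw [norm_mul, norm_wexp, mul_one, norm_mul, norm_real, Real.norm_eq_abs]; exact (H a r).2

theorem continuous_wigner (v u : 𝓢(ℝ, ℂ)) : Continuous (wigner v u) := by
  obtain ⟨C, hC, H⟩ := exists_integrable_bound v u
  have : wigner v u = fun p : ℝ × ℝ => ∫ r : ℝ, kern v u p.1 r * wexp p.2 r := rfl
  rw [this]
  refine continuous_of_dominated (bound := fun r => C * ((1 + |r|) ^ 2)⁻¹)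
    (fun p => (integrable_kern_mul v u p.1 p.2).aestronglyMeasurable)
    (fun p => ae_of_all _ fun r => ?_) (integrable_inv_one_add_abs_sq.const_mul C)
    (ae_of_all _ fun r => ?_)
  · rw [norm_mul, norm_wexp, mul_one]; exact (H p.1 r).1
  · have h1 := (continuous_kern v u).comp (f := fun p : ℝ × ℝ => (p.1, r)) (by fun_prop)
    have h2 := continuous_wexp.comp (f := fun p : ℝ × ℝ => (p.2, r)) (by fun_prop)
    exact h1.mul h2

theorem exists_norm_wigner_le (v u : 𝓢(ℝ, ℂ)) : ∃ C : ℝ, ∀ p, ‖wigner v u p‖ ≤ C := by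
  obtain ⟨C, hC, H⟩ := exists_integrable_bound v u
  refine ⟨∫ r : ℝ, C * ((1 + |r|) ^ 2)⁻¹, fun p => ?_⟩
  rw [wigner_eq]
  refine norm_integral_le_of_norm_le (integrable_inv_one_add_abs_sq.const_mul C)
    (ae_of_all _ fun r => ?_)
  rw [norm_mul, norm_wexp, mul_one]; exact (H p.1 r).1

theorem kern_mulX_left (v u : 𝓢(ℝ, ℂ)) (a r : ℝ) :
    kern (mulX v) u a r = (a + r) * kern v u a r := by
  simp only [kern, mulX_apply, map_mul, conj_ofReal]
  push_cast; ring

theorem kern_mulX_right (v u : 𝓢(ℝ, ℂ)) (a r : ℝ) :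
    kern v (mulX u) a r = (a - r) * kern v u a r := by
  simp only [kern, mulX_apply]
  push_cast; ring

theorem hasDerivAt_kern_right (v u : 𝓢(ℝ, ℂ)) (a r : ℝ) :
    HasDerivAt (kern v u a) (kern (diffD v) u a r - kern v (diffD u) a r) r := by
  have h1 : HasDerivAt (fun r => (starRingEnd ℂ) (v (a + r)))
      ((starRingEnd ℂ) (diffD v (a + r))) r := by
    have := ((hasDerivAt_schwartz v (a + r)).comp_const_add a r)
    exact this.star
  have h2 : HasDerivAt (fun r => u (a - r)) (-diffD u (a - r)) r := by
    exact (HasDerivAt.scomp r (hasDerivAt_schwartz u (a - r))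
      ((hasDerivAt_id r).const_sub a)).congr_deriv (by simp)
  refine (h1.mul h2).congr_deriv ?_
  simp only [kern]; ring

theorem hasDerivAt_wexp (ξ r : ℝ) :
    HasDerivAt (wexp ξ) (2 * Real.pi * I * ξ * wexp ξ r) r := by
  have h : HasDerivAt (fun r : ℝ => 2 * Real.pi * I * (ξ : ℂ) * (r : ℂ))
      (2 * Real.pi * I * (ξ : ℂ) * 1) r := (hasDerivAt_id r).ofReal_comp.const_mul _
  refine h.cexp.congr_deriv ?_
  simp only [wexp]; ring

/-- Because (a + r) + (a − r) = 2a. With its counterpart in ξ, which comes from integration by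
parts, it trades powers of the variables for a change of Schwartz functions, and decay of every
order follows by induction. -/
theorem wigner_mul_fst (v u : 𝓢(ℝ, ℂ)) (p : ℝ × ℝ) :
    2 * (p.1 : ℂ) * wigner v u p = wigner (mulX v) u p + wigner v (mulX u) p := by
  simp only [wigner_eq]
  rw [← integral_const_mul, ← integral_add (integrable_kern_mul _ _ _ _)
    (integrable_kern_mul _ _ _ _)]
  refine integral_congr_ae (ae_of_all _ fun r => ?_)
  simp only [kern_mulX_left, kern_mulX_right]
  ring

theorem wigner_mul_snd (v u : 𝓢(ℝ, ℂ)) (p : ℝ × ℝ) :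
    2 * Real.pi * I * (p.2 : ℂ) * wigner v u p =
      wigner v (diffD u) p - wigner (diffD v) u p := by
  simp only [wigner_eq]
  have key := integral_mul_deriv_eq_deriv_mul_of_integrable (u := kern v u p.1)
    (v := wexp p.2) (fun r _ => hasDerivAt_kern_right v u p.1 r)
    (fun r _ => hasDerivAt_wexp p.2 r) ?_ ?_ (integrable_kern_mul v u p.1 p.2)
  · rw [← integral_const_mul, ← integral_sub (integrable_kern_mul _ _ _ _)
      (integrable_kern_mul _ _ _ _)]
    rw [← integral_neg] at key
    have e1 : ∀ r, 2 * Real.pi * I * (p.2 : ℂ) * (kern v u p.1 r * wexp p.2 r) =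
        kern v u p.1 r * (2 * Real.pi * I * p.2 * wexp p.2 r) := fun r => by ring
    simp only [e1]
    rw [key]
    refine integral_congr_ae (ae_of_all _ fun r => ?_)
    simp only
    ring
  · have := (integrable_kern_mul v u p.1 p.2).const_mul (2 * Real.pi * I * p.2)
    refine this.congr (ae_of_all _ fun r => ?_)
    simp only [Pi.mul_apply]; ring
  · have := (integrable_kern_mul (diffD v) u p.1 p.2).sub
      (integrable_kern_mul v (diffD u) p.1 p.2)
    refine this.congr (ae_of_all _ fun r => ?_)
    simp only [Pi.mul_apply, Pi.sub_apply]; ring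

theorem exists_pow_fst_mul_wigner_le (N : ℕ) : ∀ v u : 𝓢(ℝ, ℂ),
    ∃ C : ℝ, ∀ p, |p.1| ^ N * ‖wigner v u p‖ ≤ C := by
  induction N with
  | zero => intro v u; simpa using exists_norm_wigner_le v u
  | succ N ih =>
    intro v u
    obtain ⟨C₁, h₁⟩ := ih (mulX v) u
    obtain ⟨C₂, h₂⟩ := ih v (mulX u)
    refine ⟨C₁ + C₂, fun p => ?_⟩
    have e : 2 * (|p.1| * ‖wigner v u p‖) ≤ ‖wigner (mulX v) u p‖ + ‖wigner v (mulX u) p‖ := by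
      have := norm_add_le (wigner (mulX v) u p) (wigner v (mulX u) p)
      rw [← wigner_mul_fst, norm_mul, norm_mul, norm_real, Real.norm_eq_abs, norm_ofNat] at this
      linarith
    have h0 : 0 ≤ |p.1| * ‖wigner v u p‖ := by positivity
    calc |p.1| ^ (N + 1) * ‖wigner v u p‖ = |p.1| ^ N * (|p.1| * ‖wigner v u p‖) := by ring
      _ ≤ |p.1| ^ N * (‖wigner (mulX v) u p‖ + ‖wigner v (mulX u) p‖) := by
        gcongr; linarith
      _ ≤ _ := by rw [mul_add]; exact add_le_add (h₁ p) (h₂ p)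

theorem exists_pow_snd_mul_wigner_le (N : ℕ) : ∀ v u : 𝓢(ℝ, ℂ),
    ∃ C : ℝ, ∀ p, |p.2| ^ N * ‖wigner v u p‖ ≤ C := by
  induction N with
  | zero => intro v u; simpa using exists_norm_wigner_le v u
  | succ N ih =>
    intro v u
    obtain ⟨C₁, h₁⟩ := ih v (diffD u)
    obtain ⟨C₂, h₂⟩ := ih (diffD v) u
    refine ⟨C₁ + C₂, fun p => ?_⟩
    have e : (2 * Real.pi) * (|p.2| * ‖wigner v u p‖) ≤
        ‖wigner v (diffD u) p‖ + ‖wigner (diffD v) u p‖ := by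
      have := norm_sub_le (wigner v (diffD u) p) (wigner (diffD v) u p)
      rw [← wigner_mul_snd, norm_mul, norm_mul, norm_real, Real.norm_eq_abs] at this
      simp only [norm_mul, norm_I, norm_ofNat, norm_real, Real.norm_eq_abs,
        abs_of_pos Real.pi_pos, mul_one] at this
      linarith
    have h0 : 0 ≤ |p.2| * ‖wigner v u p‖ := by positivity
    calc |p.2| ^ (N + 1) * ‖wigner v u p‖ = |p.2| ^ N * (|p.2| * ‖wigner v u p‖) := by ring
      _ ≤ |p.2| ^ N * (‖wigner v (diffD u) p‖ + ‖wigner (diffD v) u p‖) := by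
        gcongr; nlinarith [Real.pi_gt_three]
      _ ≤ _ := by rw [mul_add]; exact add_le_add (h₁ p) (h₂ p)

/-- Continuous functions on the plane decaying faster than any power of the norm. -/
structure RapidDecay (h : ℝ × ℝ → ℂ) : Prop where
  cont : Continuous h
  decay : ∀ N : ℕ, ∃ C : ℝ, 0 ≤ C ∧ ∀ p, ‖p‖ ^ N * ‖h p‖ ≤ C

theorem rapidDecay_wigner (v u : 𝓢(ℝ, ℂ)) : RapidDecay (wigner v u) := by
  refine ⟨continuous_wigner v u, fun N => ?_⟩
  obtain ⟨C₁, h₁⟩ := exists_pow_fst_mul_wigner_le N v u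
  obtain ⟨C₂, h₂⟩ := exists_pow_snd_mul_wigner_le N v u
  have hle : ∀ p, ‖p‖ ^ N * ‖wigner v u p‖ ≤ max C₁ C₂ := by
    intro p
    rw [Prod.norm_def, Real.norm_eq_abs, Real.norm_eq_abs]
    rcases max_choice |p.1| |p.2| with h | h <;> rw [h]
    · exact (h₁ p).trans (le_max_left _ _)
    · exact (h₂ p).trans (le_max_right _ _)
  exact ⟨max C₁ C₂, (hle 0).trans' (by positivity), hle⟩

/-- The derivative of the Wigner function along rays. -/
theorem hasDerivAt_wigner_ray (v u : 𝓢(ℝ, ℂ)) (p : ℝ × ℝ) (t : ℝ) :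
    HasDerivAt (fun t : ℝ => (t : ℂ) * wigner v u (p.1 * t, p.2 * t))
      (wigner (diffD v) (mulX u) (p.1 * t, p.2 * t) +
        wigner (mulX v) (diffD u) (p.1 * t, p.2 * t)) t := by
  obtain ⟨x, ξ⟩ := p
  simp only
  obtain ⟨C₁, hC₁, H₁⟩ := exists_integrable_bound (diffD v) u
  obtain ⟨C₂, hC₂, H₂⟩ := exists_integrable_bound v (diffD u)
  obtain ⟨C₃, hC₃, H₃⟩ := exists_integrable_bound v u
  set F : ℝ → ℝ → ℂ := fun t r => kern v u (x * t) r * wexp (ξ * t) r with hF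
  set F' : ℝ → ℝ → ℂ := fun t r =>
    (x * (kern (diffD v) u (x * t) r + kern v (diffD u) (x * t) r) +
      2 * Real.pi * I * ξ * (r * kern v u (x * t) r)) * wexp (ξ * t) r with hF'
  have hint' : ∀ t, Integrable (F' t) := by
    intro t
    have := (((integrable_kern_mul (diffD v) u (x * t) (ξ * t)).add
      (integrable_kern_mul v (diffD u) (x * t) (ξ * t))).const_mul (x : ℂ)).add
      ((integrable_mul_kern_mul v u (x * t) (ξ * t)).const_mul (2 * Real.pi * I * ξ))
    refine this.congr (ae_of_all _ fun r => ?_)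
    simp only [hF', Pi.add_apply]; ring
  have hderiv : ∀ r t, HasDerivAt (fun t => F t r) (F' t r) t := by
    intro r t
    have h1 : HasDerivAt (fun t => (starRingEnd ℂ) (v (x * t + r)))
        ((starRingEnd ℂ) (x * diffD v (x * t + r))) t := by
      have := HasDerivAt.scomp t (hasDerivAt_schwartz v (x * t + r))
        (((hasDerivAt_id t).const_mul x).add_const r)
      simpa using this.star
    have h2 : HasDerivAt (fun t => u (x * t - r)) (x * diffD u (x * t - r)) t := by
      exact (HasDerivAt.scomp t (hasDerivAt_schwartz u (x * t - r))
        (((hasDerivAt_id t).const_mul x).sub_const r)).congr_deriv (by simp)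
    have h3 : HasDerivAt (fun t => wexp (ξ * t) r)
        (2 * Real.pi * I * ξ * r * wexp (ξ * t) r) t := by
      have h : HasDerivAt (fun t : ℝ => 2 * Real.pi * I * ((ξ * t : ℝ) : ℂ) * (r : ℂ))
          (2 * Real.pi * I * ((ξ * 1 : ℝ) : ℂ) * r) t :=
        ((((hasDerivAt_id t).const_mul ξ).ofReal_comp).const_mul _).mul_const _
      refine h.cexp.congr_deriv ?_
      simp only [wexp, mul_one]; ring
    refine ((h1.mul h2).mul h3).congr_deriv ?_
    simp only [hF', kern, map_mul, conj_ofReal, Pi.mul_apply]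
    ring
  have hD : HasDerivAt (fun t => ∫ r, F t r) (∫ r, F' t r) t := by
    refine (hasDerivAt_integral_of_dominated_loc_of_deriv_le
      (bound := fun r => (|x| * (C₁ + C₂) + 2 * Real.pi * |ξ| * C₃) * ((1 + |r|) ^ 2)⁻¹)
      (F := F) (F' := F') (s := univ) univ_mem
      (Eventually.of_forall fun t => (integrable_kern_mul v u _ _).aestronglyMeasurable)
      (integrable_kern_mul v u _ _) (hint' t).aestronglyMeasurable
      (ae_of_all _ fun r t _ => ?_) (integrable_inv_one_add_abs_sq.const_mul _)
      (ae_of_all _ fun r t _ => hderiv r t)).2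
    rw [hF', norm_mul, norm_wexp, mul_one]
    refine (norm_add_le _ _).trans ?_
    simp only [norm_mul, norm_I, norm_ofNat, norm_real, Real.norm_eq_abs,
        abs_of_pos Real.pi_pos, mul_one]
    calc |x| * ‖kern (diffD v) u (x * t) r + kern v (diffD u) (x * t) r‖ +
          2 * Real.pi * |ξ| * (|r| * ‖kern v u (x * t) r‖)
        ≤ |x| * (C₁ * ((1 + |r|) ^ 2)⁻¹ + C₂ * ((1 + |r|) ^ 2)⁻¹) +
          2 * Real.pi * |ξ| * (C₃ * ((1 + |r|) ^ 2)⁻¹) :=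
          add_le_add (mul_le_mul_of_nonneg_left
            ((norm_add_le _ _).trans (add_le_add (H₁ _ _).1 (H₂ _ _).1)) (abs_nonneg _))
            (mul_le_mul_of_nonneg_left (H₃ _ _).2 (by positivity))
      _ = _ := by ring
  have hprod := (hasDerivAt_id t).ofReal_comp.mul hD
  refine hprod.congr_deriv ?_
  simp only [id_eq, ofReal_one, one_mul, wigner_eq]
  -- The factor r brought down by differentiation in ξ is integrated by parts. One resulting term
  -- cancels the derivative of the outer factor t; the others combine, with a = xt, into (a − r)
  -- kern(v', u) + (a + r) kern(v, u').
  have key := integral_mul_deriv_eq_deriv_mul_of_integrable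
    (u := fun r : ℝ => (r : ℂ) * kern v u (x * t) r)
    (u' := fun r : ℝ => kern v u (x * t) r + (r : ℂ) *
      (kern (diffD v) u (x * t) r - kern v (diffD u) (x * t) r))
    (v := wexp (ξ * t)) (v' := fun r => 2 * Real.pi * I * (ξ * t : ℝ) * wexp (ξ * t) r)
    (fun r _ => by
      exact (((hasDerivAt_id r).ofReal_comp).mul
        (hasDerivAt_kern_right v u (x * t) r)).congr_deriv (by simp))
    (fun r _ => hasDerivAt_wexp (ξ * t) r) ?_ ?_ (integrable_mul_kern_mul v u (x * t) (ξ * t))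
  · have e1 : ∫ r, F' t r = (x : ℂ) * (∫ r, (kern (diffD v) u (x * t) r * wexp (ξ * t) r +
        kern v (diffD u) (x * t) r * wexp (ξ * t) r)) + 2 * Real.pi * I * ξ *
        ∫ r : ℝ, (r : ℂ) * kern v u (x * t) r * wexp (ξ * t) r := by
      rw [← integral_const_mul, ← integral_const_mul, ← integral_add]
      · refine integral_congr_ae (ae_of_all _ fun r => ?_)
        simp only [hF']; ring
      · exact ((integrable_kern_mul _ _ _ _).add (integrable_kern_mul _ _ _ _)).const_mul _
      · exact (integrable_mul_kern_mul _ _ _ _).const_mul _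
    have e2 : ∫ r : ℝ, (r : ℂ) * kern v u (x * t) r *
        (2 * Real.pi * I * (ξ * t : ℝ) * wexp (ξ * t) r) = t * (2 * Real.pi * I * ξ *
        ∫ r : ℝ, (r : ℂ) * kern v u (x * t) r * wexp (ξ * t) r) := by
      rw [← integral_const_mul, ← integral_const_mul]
      refine integral_congr_ae (ae_of_all _ fun r => ?_)
      simp only; push_cast; ring
    let A : ℝ → ℂ := fun r => t * (x * (kern (diffD v) u (x * t) r * wexp (ξ * t) r +
      kern v (diffD u) (x * t) r * wexp (ξ * t) r))
    let B : ℝ → ℂ := fun r => -((kern v u (x * t) r + (r : ℂ) *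
      (kern (diffD v) u (x * t) r - kern v (diffD u) (x * t) r)) * wexp (ξ * t) r)
    have iA : Integrable A := (((integrable_kern_mul (diffD v) u (x * t) (ξ * t)).add
      (integrable_kern_mul v (diffD u) (x * t) (ξ * t))).const_mul (x : ℂ)).const_mul (t : ℂ)
    have iB : Integrable B := by
      refine Integrable.neg ?_
      have := (integrable_kern_mul v u (x * t) (ξ * t)).add
        ((integrable_mul_kern_mul (diffD v) u (x * t) (ξ * t)).sub
        (integrable_mul_kern_mul v (diffD u) (x * t) (ξ * t)))
      refine this.congr (ae_of_all _ fun r => ?_)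
      simp only [Pi.add_apply, Pi.sub_apply]; ring
    have iF : Integrable (F t) := integrable_kern_mul v u (x * t) (ξ * t)
    have hsum : ∫ r, (F t + (A + B)) r = (∫ r, F t r) + ((∫ r, A r) + ∫ r, B r) := by
      rw [integral_add' iF (iA.add iB), integral_add' iA iB]
    rw [e1, mul_add, ← e2, key, ← integral_const_mul, ← integral_const_mul, ← integral_neg,
      ← integral_add (integrable_kern_mul _ _ _ _) (integrable_kern_mul _ _ _ _)]
    refine (Eq.trans ?_ hsum).symm
    refine integral_congr_ae (ae_of_all _ fun r => ?_)
    simp only [kern_mulX_left, kern_mulX_right, Pi.add_apply, A, B, hF]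
    push_cast; ring
  · have := (integrable_mul_kern_mul v u (x * t) (ξ * t)).const_mul (2 * Real.pi * I * (ξ * t : ℝ))
    refine this.congr (ae_of_all _ fun r => ?_)
    simp only [Pi.mul_apply]; ring
  · have := (integrable_kern_mul v u (x * t) (ξ * t)).add
      ((integrable_mul_kern_mul (diffD v) u (x * t) (ξ * t)).sub
      (integrable_mul_kern_mul v (diffD u) (x * t) (ξ * t)))
    refine this.congr (ae_of_all _ fun r => ?_)
    simp only [Pi.add_apply, Pi.sub_apply, Pi.mul_apply]; ring

/-! ### Lattice sums, and the Eisenstein pairing as a Mellin transform -/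

/-- The sup norm of a lattice point. -/
def nrm (m : LatticePt) : ℝ := ‖((m.1.1 : ℝ), (m.1.2 : ℝ))‖

/-- The point `t m` of the ray through the lattice point `m`. -/
def ray (m : LatticePt) (t : ℝ) : ℝ × ℝ := ((m.1.1 : ℝ) * t, (m.1.2 : ℝ) * t)

/-- The sum of `h` over the nonzero points of the lattice `t ℤ²`. -/
def theta (h : ℝ × ℝ → ℂ) (t : ℝ) : ℂ := ∑' m : LatticePt, h (ray m t)

theorem one_le_nrm (m : LatticePt) : 1 ≤ nrm m := by
  obtain ⟨⟨j, k⟩, hm⟩ := m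
  simp only [nrm, Prod.norm_def, Real.norm_eq_abs]
  have : j ≠ 0 ∨ k ≠ 0 := by
    by_contra h
    push Not at h
    exact hm (by rw [h.1, h.2]; rfl)
  rcases this with h | h
  · refine le_max_of_le_left ?_
    exact_mod_cast Int.one_le_abs h
  · refine le_max_of_le_right ?_
    exact_mod_cast Int.one_le_abs h

theorem nrm_pos (m : LatticePt) : 0 < nrm m := zero_lt_one.trans_le (one_le_nrm m)

theorem norm_ray (m : LatticePt) {t : ℝ} (ht : 0 < t) : ‖ray m t‖ = nrm m * t := by
  have : ray m t = t • ((m.1.1 : ℝ), (m.1.2 : ℝ)) := by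
    simp [ray, mul_comm]
  rw [this, norm_smul, Real.norm_of_nonneg ht.le, mul_comm, nrm]

theorem summable_nrm_rpow {k : ℝ} (hk : 2 < k) : Summable fun m : LatticePt => nrm m ^ (-k) := by
  have h1 := (finTwoArrowEquiv ℤ).symm.summable_iff.mpr
    (EisensteinSeries.summable_one_div_norm_rpow hk)
  have h2 : Summable fun q : ℤ × ℤ => ‖((q.1 : ℝ), (q.2 : ℝ))‖ ^ (-k) := by
    refine h1.congr fun q => ?_
    simp only [Function.comp_apply, finTwoArrowEquiv_symm_apply, EisensteinSeries.norm_eq_max_natAbs,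
      Matrix.cons_val_zero, Matrix.cons_val_one, Prod.norm_def, Real.norm_eq_abs]
    congr 1
    push_cast [Nat.cast_natAbs]
    rfl
  exact h2.subtype _

theorem RapidDecay.exists_bound {h : ℝ × ℝ → ℂ} (hh : RapidDecay h) (N : ℕ) :
    ∃ C : ℝ, 0 ≤ C ∧ ∀ p, ‖h p‖ ≤ C * (1 + ‖p‖ ^ N)⁻¹ := by
  obtain ⟨C₀, h0, H0⟩ := hh.decay 0
  obtain ⟨C₁, h1, H1⟩ := hh.decay N
  refine ⟨C₀ + C₁, by positivity, fun p => ?_⟩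
  rw [← div_eq_mul_inv, le_div_iff₀ (by positivity)]
  have a := H0 p
  have b := H1 p
  rw [pow_zero, one_mul] at a
  linarith

theorem RapidDecay.exists_norm_ray_le {h : ℝ × ℝ → ℂ} (hh : RapidDecay h) (N : ℕ) :
    ∃ C : ℝ, 0 ≤ C ∧ ∀ (m : LatticePt) (t : ℝ), 0 < t →
      ‖h (ray m t)‖ ≤ C * (t ^ N)⁻¹ * nrm m ^ (-(N : ℝ)) := by
  obtain ⟨C, hC, H⟩ := hh.decay N
  refine ⟨C, hC, fun m t ht => ?_⟩
  have h1 := H (ray m t)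
  have h2 := nrm_pos m
  rw [norm_ray m ht, mul_pow] at h1
  rw [Real.rpow_neg h2.le, Real.rpow_natCast, mul_assoc, ← mul_inv, ← div_eq_mul_inv,
    le_div_iff₀ (by positivity)]
  linarith

theorem RapidDecay.summable_norm_ray {h : ℝ × ℝ → ℂ} (hh : RapidDecay h) {t : ℝ} (ht : 0 < t) :
    Summable fun m : LatticePt => ‖h (ray m t)‖ := by
  obtain ⟨C, hC, H⟩ := hh.exists_norm_ray_le 3
  refine Summable.of_nonneg_of_le (fun _ => norm_nonneg _) (fun m => H m t ht) ?_
  exact (summable_nrm_rpow (by norm_num)).mul_left _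

theorem RapidDecay.exists_tsum_norm_le {h : ℝ × ℝ → ℂ} (hh : RapidDecay h) {N : ℕ} (hN : 3 ≤ N) :
    ∃ C : ℝ, 0 ≤ C ∧ ∀ t : ℝ, 0 < t → ∑' m : LatticePt, ‖h (ray m t)‖ ≤ C * (t ^ N)⁻¹ := by
  obtain ⟨C, hC, H⟩ := hh.exists_norm_ray_le N
  have hs : Summable fun m : LatticePt => nrm m ^ (-(N : ℝ)) :=
    summable_nrm_rpow (by have : (3 : ℝ) ≤ N := by exact_mod_cast hN
                          linarith)
  have h0 : 0 ≤ ∑' m : LatticePt, nrm m ^ (-(N : ℝ)) :=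
    tsum_nonneg fun m => Real.rpow_nonneg (nrm_pos m).le _
  refine ⟨C * ∑' m : LatticePt, nrm m ^ (-(N : ℝ)), by positivity, fun t ht => ?_⟩
  refine ((hh.summable_norm_ray ht).tsum_le_tsum (H · t ht) (hs.mul_left _)).trans ?_
  rw [tsum_mul_left]
  exact le_of_eq (by ring)

theorem RapidDecay.exists_norm_theta_le {h : ℝ × ℝ → ℂ} (hh : RapidDecay h) {N : ℕ} (hN : 3 ≤ N) :
    ∃ C : ℝ, 0 ≤ C ∧ ∀ t : ℝ, 0 < t → ‖theta h t‖ ≤ C * (t ^ N)⁻¹ := by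
  obtain ⟨C, hC, H⟩ := hh.exists_tsum_norm_le hN
  exact ⟨C, hC, fun t ht => (norm_tsum_le_tsum_norm (hh.summable_norm_ray ht)).trans (H t ht)⟩

theorem RapidDecay.continuous_ray {h : ℝ × ℝ → ℂ} (hh : RapidDecay h) (m : LatticePt) :
    Continuous fun t => h (ray m t) := by
  have := hh.cont
  unfold ray
  fun_prop

theorem RapidDecay.continuousOn_theta {h : ℝ × ℝ → ℂ} (hh : RapidDecay h) :
    ContinuousOn (theta h) (Ioi 0) := by
  obtain ⟨C, hC, H⟩ := hh.exists_norm_ray_le 3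
  refine continuousOn_of_forall_continuousAt fun t ht => ?_
  have ht0 : (0 : ℝ) < t := ht
  have hc : ContinuousOn (theta h) (Ioi (t / 2)) := by
    refine continuousOn_tsum (u := fun m => C * ((t / 2) ^ 3)⁻¹ * nrm m ^ (-((3 : ℕ) : ℝ)))
      (fun m => (hh.continuous_ray m).continuousOn)
      ((summable_nrm_rpow (by norm_num)).mul_left _) fun m x hx => ?_
    have hx' : t / 2 < x := hx
    refine (H m x (by linarith)).trans ?_
    have := nrm_pos m
    gcongr
  exact hc.continuousAt (Ioi_mem_nhds (by linarith))

theorem integrableOn_rpow_mul_inv {σ : ℝ} (hσ : -1 < σ) {N : ℕ} (hN : σ + 1 < N) :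
    IntegrableOn (fun s : ℝ => s ^ σ * (1 + s ^ N)⁻¹) (Ioi 0) := by
  have hcont : ContinuousOn (fun s : ℝ => s ^ σ * (1 + s ^ N)⁻¹) (Ioi 0) := by
    refine ContinuousOn.mul (fun s hs => ?_) (fun s hs => ?_)
    · exact (Real.continuousAt_rpow_const s σ (Or.inl (ne_of_gt hs))).continuousWithinAt
    · have : (1 : ℝ) + s ^ N ≠ 0 := by
        have : (0 : ℝ) < s := hs
        positivity
      exact ContinuousAt.continuousWithinAt (by fun_prop (disch := assumption))
  rw [← Ioc_union_Ioi_eq_Ioi zero_le_one]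
  refine IntegrableOn.union ?_ ?_
  · have h1 : IntegrableOn (fun s : ℝ => s ^ σ) (Ioc 0 1) := by
      rw [← intervalIntegrable_iff_integrableOn_Ioc_of_le zero_le_one]
      exact intervalIntegral.intervalIntegrable_rpow' hσ
    refine Integrable.mono' h1
      ((hcont.mono Ioc_subset_Ioi_self).aestronglyMeasurable measurableSet_Ioc)
      ((ae_restrict_mem measurableSet_Ioc).mono fun s hs => ?_)
    have hs0 : 0 < s := hs.1
    rw [Real.norm_of_nonneg (by positivity)]
    refine mul_le_of_le_one_right (by positivity) (inv_le_one_of_one_le₀ ?_)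
    have : 0 ≤ s ^ N := by positivity
    linarith
  · have h1 : IntegrableOn (fun s : ℝ => s ^ (σ - N)) (Ioi 1) :=
      integrableOn_Ioi_rpow_of_lt (by linarith) zero_lt_one
    refine Integrable.mono' h1
      ((hcont.mono (Ioi_subset_Ioi zero_le_one)).aestronglyMeasurable measurableSet_Ioi)
      ((ae_restrict_mem measurableSet_Ioi).mono fun s hs => ?_)
    have hs0 : (0 : ℝ) < s := zero_lt_one.trans hs
    rw [Real.norm_of_nonneg (by positivity), Real.rpow_sub hs0, Real.rpow_natCast,
      div_eq_mul_inv]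
    gcongr
    linarith

theorem RapidDecay.integrableOn_cpow_mul_ray {h : ℝ × ℝ → ℂ} (hh : RapidDecay h) (m : LatticePt)
    {ν : ℂ} (hν : -1 < ν.re) :
    IntegrableOn (fun t : ℝ => (t : ℂ) ^ ν * h (ray m t)) (Ioi 0) := by
  obtain ⟨N, hN⟩ := exists_nat_gt (ν.re + 1)
  obtain ⟨C, hC, H⟩ := hh.exists_bound N
  refine Integrable.mono' ((integrableOn_rpow_mul_inv hν hN).const_mul C) ?_
    ((ae_restrict_mem measurableSet_Ioi).mono fun t ht => ?_)
  · refine ContinuousOn.aestronglyMeasurable (fun t ht => ?_) measurableSet_Ioi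
    exact ((continuousAt_ofReal_cpow_const t ν (Or.inr (ne_of_gt ht))).mul
      (hh.continuous_ray m).continuousAt).continuousWithinAt
  · have ht0 : (0 : ℝ) < t := ht
    rw [norm_mul, norm_cpow_eq_rpow_re_of_pos ht0]
    calc t ^ ν.re * ‖h (ray m t)‖ ≤ t ^ ν.re * (C * (1 + ‖ray m t‖ ^ N)⁻¹) := by
          gcongr; exact H _
      _ ≤ t ^ ν.re * (C * (1 + t ^ N)⁻¹) := by
          gcongr
          rw [norm_ray m ht0]
          exact le_mul_of_one_le_left ht0.le (one_le_nrm m)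
      _ = _ := by ring

/-- Rescaling t by the norm of m extracts the power; in a lattice of rank two it is summable once Re
ν + 1 > 2. -/
theorem RapidDecay.exists_integral_norm_ray_le {h : ℝ × ℝ → ℂ} (hh : RapidDecay h)
    {ν : ℂ} (hν : -1 < ν.re) :
    ∃ C : ℝ, ∀ m : LatticePt,
      ∫ t in Ioi (0 : ℝ), ‖(t : ℂ) ^ ν * h (ray m t)‖ ≤ C * nrm m ^ (-(ν.re + 1)) := by
  obtain ⟨N, hN⟩ := exists_nat_gt (ν.re + 1)
  obtain ⟨C, hC, H⟩ := hh.exists_bound N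
  set g : ℝ → ℝ := fun s => s ^ ν.re * (1 + s ^ N)⁻¹ with hg
  have hgi : IntegrableOn g (Ioi 0) := integrableOn_rpow_mul_inv hν hN
  refine ⟨C * ∫ s in Ioi (0 : ℝ), g s, fun m => ?_⟩
  have hm := nrm_pos m
  have hgm : IntegrableOn (fun t => g (nrm m * t)) (Ioi 0) := by
    rw [integrableOn_Ioi_comp_mul_left_iff _ _ hm, mul_zero]; exact hgi
  have e : ∫ t in Ioi (0 : ℝ), g (nrm m * t) = (nrm m)⁻¹ * ∫ s in Ioi (0 : ℝ), g s := by
    rw [integral_comp_mul_left_Ioi _ _ hm, mul_zero, smul_eq_mul]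
  have hle : ∫ t in Ioi (0 : ℝ), ‖(t : ℂ) ^ ν * h (ray m t)‖ ≤
      ∫ t in Ioi (0 : ℝ), C * nrm m ^ (-ν.re) * g (nrm m * t) := by
    refine setIntegral_mono_on (hh.integrableOn_cpow_mul_ray m hν).norm (hgm.const_mul _)
      measurableSet_Ioi fun t ht => ?_
    have ht0 : (0 : ℝ) < t := ht
    rw [norm_mul, norm_cpow_eq_rpow_re_of_pos ht0]
    have e2 : C * nrm m ^ (-ν.re) * g (nrm m * t) =
        t ^ ν.re * (C * (1 + ‖ray m t‖ ^ N)⁻¹) := by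
      rw [hg, norm_ray m ht0]
      simp only
      rw [Real.mul_rpow hm.le ht0.le, Real.rpow_neg hm.le]
      have : nrm m ^ ν.re ≠ 0 := (Real.rpow_pos_of_pos hm _).ne'
      field_simp
    rw [e2]
    gcongr
    exact H _
  refine hle.trans (le_of_eq ?_)
  rw [integral_const_mul, e, neg_add, Real.rpow_add hm, Real.rpow_neg_one]
  ring

theorem RapidDecay.summable_integral_norm_ray {h : ℝ × ℝ → ℂ} (hh : RapidDecay h)
    {ν : ℂ} (hν : 1 < ν.re) :
    Summable fun m : LatticePt => ∫ t in Ioi (0 : ℝ), ‖(t : ℂ) ^ ν * h (ray m t)‖ := by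
  obtain ⟨C, H⟩ := hh.exists_integral_norm_ray_le (ν := ν) (by linarith)
  exact Summable.of_nonneg_of_le (fun m => integral_nonneg fun _ => norm_nonneg _) H
    ((summable_nrm_rpow (by linarith)).mul_left C)

/-- The shift ν + 1 reflects the weight t^{s−1} in `mellin`, against t^ν in the pairing. -/
theorem RapidDecay.hasSum_eisenstein {h : ℝ × ℝ → ℂ} (hh : RapidDecay h)
    {ν : ℂ} (hν : 1 < ν.re) :
    HasSum (fun m : LatticePt => ∫ t in Ioi (0 : ℝ), (t : ℂ) ^ ν * h (ray m t))
      (mellin (theta h) (ν + 1)) := by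
  have key := hasSum_integral_of_summable_integral_norm
    (μ := volume.restrict (Ioi (0 : ℝ)))
    (fun m => hh.integrableOn_cpow_mul_ray m (ν := ν) (by linarith))
    (hh.summable_integral_norm_ray hν)
  have e : mellin (theta h) (ν + 1) =
      ∫ t in Ioi (0 : ℝ), ∑' m : LatticePt, (t : ℂ) ^ ν * h (ray m t) := by
    unfold mellin
    refine integral_congr_ae (ae_of_all _ fun t => ?_)
    simp only [theta, smul_eq_mul, add_sub_cancel_right]
    rw [tsum_mul_left]
  rw [e]
  exact key

theorem RapidDecay.mellin_theta {h : ℝ × ℝ → ℂ} (hh : RapidDecay h) {ν : ℂ} (hν : 1 < ν.re) :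
    mellin (theta h) (ν + 1) = eisensteinSum ν h :=
  (hh.hasSum_eisenstein hν).tsum_eq.symm

/-! ### Poisson summation and continuation of the Eisenstein pairing -/

theorem RapidDecay.hasSum_lattice {h : ℝ × ℝ → ℂ} (hh : RapidDecay h) {t : ℝ} (ht : 0 < t) :
    HasSum (fun q : ℤ × ℤ => h ((q.1 : ℝ) * t, (q.2 : ℝ) * t)) (h 0 + theta h t) := by
  set f : ℤ × ℤ → ℂ := fun q => h ((q.1 : ℝ) * t, (q.2 : ℝ) * t) with hf
  have h1 : HasSum (fun m : LatticePt => f m.1) (theta h t) :=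
    (hh.summable_norm_ray ht).of_norm.hasSum
  have h2 : HasSum (indicator {m : ℤ × ℤ | m ≠ 0} f) (theta h t) :=
    hasSum_subtype_iff_indicator.mp h1
  have h3 : HasSum (fun q : ℤ × ℤ => if q = 0 then h 0 else 0) (h 0) := hasSum_ite_eq 0 (h 0)
  convert h3.add h2 using 1
  funext q
  by_cases hq : q = 0
  · subst hq
    simp [hf, Prod.zero_eq_mk]
  · rw [if_neg hq, indicator_of_mem (show q ∈ {m : ℤ × ℤ | m ≠ 0} from hq), zero_add]

theorem summable_inv_one_add_abs_mul {c : ℝ} (hc : 0 < c) :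
    Summable fun k : ℤ => ((1 + |(k : ℝ) * c|) ^ 2)⁻¹ := by
  have h1 : Summable fun k : ℤ => (c ^ 2)⁻¹ * |(k : ℝ)| ^ (-2 : ℝ) :=
    (Real.summable_abs_int_rpow one_lt_two).mul_left _
  refine Summable.of_norm_bounded_eventually h1 ?_
  filter_upwards [(Set.finite_singleton (0 : ℤ)).compl_mem_cofinite] with k hk
  have hk0 : (k : ℝ) ≠ 0 := by exact_mod_cast hk
  have hk1 : 0 < |(k : ℝ)| := abs_pos.mpr hk0
  rw [Real.norm_of_nonneg (by positivity), Real.rpow_neg hk1.le, ← mul_inv, abs_mul, abs_of_pos hc]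
  have : |(k : ℝ)| ^ (2 : ℝ) = |(k : ℝ)| ^ 2 := by norm_cast
  rw [this, ← mul_pow, mul_comm c]
  gcongr
  linarith

theorem summable_kern (v u : 𝓢(ℝ, ℂ)) {s t : ℝ} (hs : 0 < s) (ht : 0 < t) :
    Summable fun q : ℤ × ℤ => kern v u ((q.1 : ℝ) * s) ((q.2 : ℝ) * t) := by
  obtain ⟨C, hC, H⟩ := kern_decay v u 2
  have h1 := ((summable_inv_one_add_abs_mul hs).mul_of_nonneg (summable_inv_one_add_abs_mul ht)
    (fun _ => by positivity) (fun _ => by positivity)).mul_left C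
  refine Summable.of_norm_bounded h1 fun q => ?_
  refine (H _ _).trans (le_of_eq ?_)
  ring

/-- Poisson summation in the second variable of the Wigner function. -/
theorem tsum_wigner_eq (v u : 𝓢(ℝ, ℂ)) (X : ℝ) {t : ℝ} (ht : 0 < t)
    (hs : Summable fun k : ℤ => wigner v u (X, (k : ℝ) * t)) :
    ∑' k : ℤ, wigner v u (X, (k : ℝ) * t) = (t : ℂ)⁻¹ * ∑' k : ℤ, kern v u X ((k : ℝ) * t⁻¹) := by
  set f : ℝ → ℂ := fun r => kern v u X (r * t⁻¹) with hf
  have hcont : Continuous f := by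
    have := (continuous_kern v u).comp (Continuous.prodMk_right X)
    exact this.comp (continuous_mul_const t⁻¹)
  have hF : ∀ n : ℤ, FourierTransform.fourier f (n : ℝ) =
      (t : ℂ) * wigner v u (X, ((-n : ℤ) : ℝ) * t) := by
    intro n
    rw [Real.fourier_eq' f, wigner_eq]
    have h1 := Measure.integral_comp_mul_right
      (fun s : ℝ => kern v u X s * wexp (((-n : ℤ) : ℝ) * t) s) t⁻¹
    rw [inv_inv, abs_of_pos ht] at h1
    simp only
    rw [← Complex.real_smul, ← h1]
    refine integral_congr_ae (ae_of_all _ fun r => ?_)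
    simp only [hf, smul_eq_mul, wexp]
    rw [mul_comm]
    congr 2
    have ht' : (t : ℂ) ≠ 0 := by exact_mod_cast ht.ne'
    simp only [RCLike.inner_apply, conj_trivial]
    push_cast
    field_simp
  have hO : f =O[cocompact ℝ] (|·| ^ (-2 : ℝ)) := by
    obtain ⟨C, hC, H⟩ := kern_decay v u 2
    refine Asymptotics.IsBigO.of_bound (C * t ^ 2) ?_
    filter_upwards [(isCompact_singleton (x := (0 : ℝ))).compl_mem_cocompact] with r hr
    have hr0 : 0 < |r| := abs_pos.mpr hr
    have e : |r| ^ (-2 : ℝ) = (|r| ^ 2)⁻¹ := by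
      rw [Real.rpow_neg hr0.le]; norm_cast
    rw [e, Real.norm_of_nonneg (by positivity)]
    refine (H X (r * t⁻¹)).trans ?_
    have h1 : ((1 + |X|) ^ 2)⁻¹ ≤ 1 := inv_le_one_of_one_le₀ (one_le_pow₀ (by
      linarith [abs_nonneg X]))
    have h2 : ((1 + |r * t⁻¹|) ^ 2)⁻¹ ≤ t ^ 2 * (|r| ^ 2)⁻¹ := by
      have : t ^ 2 * (|r| ^ 2)⁻¹ = ((|r| * t⁻¹) ^ 2)⁻¹ := by
        rw [mul_pow, inv_pow, mul_inv, inv_inv, mul_comm]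
      rw [this, abs_mul, abs_of_pos (inv_pos.mpr ht)]
      gcongr
      linarith
    calc C * ((1 + |X|) ^ 2)⁻¹ * ((1 + |r * t⁻¹|) ^ 2)⁻¹ ≤ C * 1 * (t ^ 2 * (|r| ^ 2)⁻¹) := by
          gcongr
      _ = _ := by ring
  have hsF : Summable fun n : ℤ => FourierTransform.fourier f (n : ℝ) := by
    simp only [hF]
    exact ((Equiv.neg ℤ).summable_iff.mpr hs).mul_left (t : ℂ)
  have key := Real.tsum_eq_tsum_fourier_of_rpow_decay_of_summable hcont one_lt_two hO hsF 0
  simp only [zero_add, hF] at key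
  have h0 : ∀ n : ℤ, fourier n ((0 : ℝ) : UnitAddCircle) = 1 := by
    intro n; simp
  simp only [h0, mul_one] at key
  have e := (Equiv.neg ℤ).tsum_eq (fun n : ℤ => wigner v u (X, (n : ℝ) * t))
  simp only [Equiv.neg_apply] at e
  rw [tsum_mul_left, e] at key
  rw [key, inv_mul_cancel_left₀ (by exact_mod_cast ht.ne')]

/-- In its second variable the Wigner function is a Fourier transform of `kern`. Poisson summation
in that variable alone produces a sum of `kern` in which the two coordinates are scaled by t and
1/t. -/
theorem lattice_sum_eq (v u : 𝓢(ℝ, ℂ)) {t : ℝ} (ht : 0 < t) :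
    wigner v u 0 + theta (wigner v u) t =
      (t : ℂ)⁻¹ * ∑' q : ℤ × ℤ, kern v u ((q.1 : ℝ) * t) ((q.2 : ℝ) * t⁻¹) := by
  have h1 := (rapidDecay_wigner v u).hasSum_lattice ht
  have h2 := summable_kern v u ht (inv_pos.mpr ht)
  have h3 : ∀ j : ℤ, Summable fun k : ℤ => wigner v u ((j : ℝ) * t, (k : ℝ) * t) :=
    fun j => h1.summable.prod_factor j
  have h4 : ∀ j : ℤ, ∑' k : ℤ, wigner v u ((j : ℝ) * t, (k : ℝ) * t) =
      (t : ℂ)⁻¹ * ∑' k : ℤ, kern v u ((j : ℝ) * t) ((k : ℝ) * t⁻¹) :=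
    fun j => tsum_wigner_eq v u _ ht (h3 j)
  have h5 := h1.summable.tsum_prod
  have h6 := h2.tsum_prod
  rw [← h1.tsum_eq, h5, h6, ← tsum_mul_left]
  exact tsum_congr h4

/-- Reflecting u exchanges the two arguments, hence t and 1/t: this symmetry is the functional
equation. -/
theorem kern_reflect (v u : 𝓢(ℝ, ℂ)) (a b : ℝ) : kern v (reflect u) a b = kern v u b a := by
  simp only [kern, reflect_apply, neg_sub, add_comm]

theorem lattice_sum_functional_equation (v u : 𝓢(ℝ, ℂ)) {t : ℝ} (ht : 0 < t) :
    wigner v u 0 + theta (wigner v u) (1 / t) =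
      (t : ℂ) ^ 2 * (wigner v (reflect u) 0 + theta (wigner v (reflect u)) t) := by
  rw [lattice_sum_eq v u (one_div_pos.mpr ht), lattice_sum_eq v (reflect u) ht,
    ← (Equiv.prodComm ℤ ℤ).tsum_eq]
  have ht' : (t : ℂ) ≠ 0 := by exact_mod_cast ht.ne'
  simp only [Equiv.prodComm_apply, Prod.fst_swap, Prod.snd_swap, kern_reflect, one_div, inv_inv,
    ofReal_inv]
  field_simp

theorem theta_isBigO {h : ℝ × ℝ → ℂ} (hh : RapidDecay h) (r : ℝ) :
    theta h =O[atTop] (· ^ r) := by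
  obtain ⟨N, hN⟩ := exists_nat_ge (max 3 (-r))
  have hN3 : 3 ≤ N := by exact_mod_cast (le_max_left _ _).trans hN
  have hNr : -(N : ℝ) ≤ r := by linarith [(le_max_right _ _).trans hN]
  obtain ⟨C, hC, H⟩ := hh.exists_norm_theta_le hN3
  refine Asymptotics.IsBigO.of_bound C ?_
  filter_upwards [eventually_ge_atTop 1] with t ht
  have ht0 : (0 : ℝ) < t := by linarith
  refine (H t ht0).trans ?_
  rw [Real.norm_of_nonneg (by positivity), ← Real.rpow_natCast, ← Real.rpow_neg ht0.le]
  gcongr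

/-- The pair of lattice sums of two Wigner functions exchanged by Poisson summation. -/
def wignerPair (v u : 𝓢(ℝ, ℂ)) : WeakFEPair ℂ where
  f t := wigner v u 0 + theta (wigner v u) t
  g t := wigner v (reflect u) 0 + theta (wigner v (reflect u)) t
  k := 2
  ε := 1
  -- The value at the origin, left out of `theta`, is the limit of the full sum at infinity. It
  -- causes the pole at ν = −1, and its reflected counterpart the pole at ν = 1.
  f₀ := wigner v u 0
  g₀ := wigner v (reflect u) 0
  hf_int := (continuousOn_const.add
    (rapidDecay_wigner v u).continuousOn_theta).locallyIntegrableOn measurableSet_Ioi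
  hg_int := (continuousOn_const.add
    (rapidDecay_wigner v (reflect u)).continuousOn_theta).locallyIntegrableOn measurableSet_Ioi
  hk := two_pos
  hε := one_ne_zero
  h_feq x hx := by
    have : x ^ (2 : ℝ) = x ^ 2 := by norm_cast
    rw [lattice_sum_functional_equation v u hx, this]
    simp
  hf_top r := by
    simp only [add_sub_cancel_left]
    exact theta_isBigO (rapidDecay_wigner v u) r
  hg_top r := by
    simp only [add_sub_cancel_left]
    exact theta_isBigO (rapidDecay_wigner v (reflect u)) r

theorem isEisensteinContinuation_wigner (v u : 𝓢(ℝ, ℂ)) :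
    IsEisensteinContinuation (wigner v u) fun ν => (wignerPair v u).Λ (ν + 1) := by
  refine ⟨fun ν hν => ?_, fun ν hν => ?_⟩
  · simp only [mem_compl_iff, mem_insert_iff, mem_singleton_iff, not_or] at hν
    have h0 : ν + 1 ≠ 0 := fun h => hν.2 (eq_neg_of_add_eq_zero_left h)
    have h2 : ν + 1 ≠ ((wignerPair v u).k : ℂ) := by
      intro h
      have : ν + 1 = 2 := by rw [h]; simp [wignerPair]
      exact hν.1 (by linear_combination this)
    have := (wignerPair v u).differentiableAt_Λ (Or.inl h0) (Or.inl h2)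
    exact (this.comp ν (differentiableAt_id.add_const 1)).differentiableWithinAt
  · have h2 : (wignerPair v u).k < (ν + 1).re := by
      simp only [wignerPair, add_re, one_re]
      linarith
    simp only
    rw [← ((wignerPair v u).hasMellin h2).2, ← (rapidDecay_wigner v u).mellin_theta hν]
    simp only [wignerPair, add_sub_cancel_left]

/-! ### Rapid decay on vertical lines -/

/-- The function `(ν - 1) ⟨E_{-ν}, Wig(v,u)⟩`, with its singularity at `1` removed. -/
def eisReg (v u : 𝓢(ℝ, ℂ)) (ν : ℂ) : ℂ :=
  (ν - 1) * (wignerPair v u).Λ₀ (ν + 1) - (ν - 1) / (ν + 1) * wigner v u 0 +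
    wigner v (reflect u) 0

theorem eisReg_eq_mul (v u : 𝓢(ℝ, ℂ)) {ν : ℂ} (h1 : ν ≠ 1) (h2 : ν ≠ -1) :
    eisReg v u ν = (ν - 1) * eisenstein ν (wigner v u) := by
  rw [eisenstein_eq (isEisensteinContinuation_wigner v u) h1 h2, WeakFEPair.Λ, eisReg]
  have h0 : ν - 1 ≠ 0 := sub_ne_zero.mpr h1
  have e : (((wignerPair v u).k : ℝ) : ℂ) - (ν + 1) = -(ν - 1) := by
    simp only [wignerPair]
    push_cast
    ring
  rw [e]
  simp only [wignerPair, smul_eq_mul]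
  have h3 : ν + 1 ≠ 0 := fun h => h2 (eq_neg_of_add_eq_zero_left h)
  field_simp
  ring

theorem eisenstein_eq_mellin (v u : 𝓢(ℝ, ℂ)) {ν : ℂ} (hν : 1 < ν.re) :
    eisenstein ν (wigner v u) = mellin (theta (wigner v u)) (ν + 1) := by
  have h1 : ν ≠ 1 := by rintro rfl; simp at hν
  have h2 : ν ≠ -1 := by rintro rfl; norm_num at hν
  have := (isEisensteinContinuation_wigner v u).2 ν hν
  simp only at this
  rw [eisenstein_eq (isEisensteinContinuation_wigner v u) h1 h2, this,
    (rapidDecay_wigner v u).mellin_theta hν]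

theorem differentiableAt_eisReg (v u : 𝓢(ℝ, ℂ)) {ν : ℂ} (hν : ν ≠ -1) :
    DifferentiableAt ℂ (eisReg v u) ν := by
  have h3 : ν + 1 ≠ 0 := fun h => hν (eq_neg_of_add_eq_zero_left h)
  have h := ((wignerPair v u).differentiable_Λ₀ (ν + 1)).comp ν
    ((differentiableAt_id (𝕜 := ℂ)).add_const (1 : ℂ))
  have h' : DifferentiableAt ℂ (fun ν => (wignerPair v u).Λ₀ (ν + 1)) ν := h
  unfold eisReg
  fun_prop (disch := assumption)

/-- Integration by parts of t^ν against t Wig(tm), whose derivative is again a sum of Wigner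
functions. The boundary terms vanish by Re ν > 0 at the origin and by rapid decay at infinity. -/
theorem mul_integral_cpow_mul_ray (v u : 𝓢(ℝ, ℂ)) (m : LatticePt) {ν : ℂ} (hν : 0 < ν.re) :
    ν * ∫ t in Ioi (0 : ℝ), (t : ℂ) ^ ν * wigner v u (ray m t) =
      -((∫ t in Ioi (0 : ℝ), (t : ℂ) ^ ν * wigner (diffD v) (mulX u) (ray m t)) +
        ∫ t in Ioi (0 : ℝ), (t : ℂ) ^ ν * wigner (mulX v) (diffD u) (ray m t)) := by
  have hν0 : ν ≠ 0 := by rintro rfl; simp at hν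
  have i1 := (rapidDecay_wigner (diffD v) (mulX u)).integrableOn_cpow_mul_ray m (ν := ν)
    (by linarith)
  have i2 := (rapidDecay_wigner (mulX v) (diffD u)).integrableOn_cpow_mul_ray m (ν := ν)
    (by linarith)
  have i0 := (rapidDecay_wigner v u).integrableOn_cpow_mul_ray m (ν := ν) (by linarith)
  have hd : ∀ t ∈ Ioi (0 : ℝ), HasDerivAt (fun t : ℝ => (t : ℂ) ^ ν) (ν * (t : ℂ) ^ (ν - 1)) t :=
    fun t ht => hasDerivAt_ofReal_cpow_const (ne_of_gt ht) hν0
  have hd2 : ∀ t ∈ Ioi (0 : ℝ), HasDerivAt (fun t : ℝ => (t : ℂ) * wigner v u (ray m t))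
      (wigner (diffD v) (mulX u) (ray m t) + wigner (mulX v) (diffD u) (ray m t)) t :=
    fun t _ => hasDerivAt_wigner_ray v u ((m.1.1 : ℝ), (m.1.2 : ℝ)) t
  have hprod : ∀ t : ℝ, t ∈ Ioi (0 : ℝ) → ν * (t : ℂ) ^ (ν - 1) * ((t : ℂ) * wigner v u (ray m t)) =
      ν * ((t : ℂ) ^ ν * wigner v u (ray m t)) := by
    intro t ht
    have : (t : ℂ) ≠ 0 := by exact_mod_cast (ne_of_gt ht)
    rw [cpow_sub _ _ this, cpow_one]
    field_simp
  have hzero : Tendsto ((fun t : ℝ => (t : ℂ) ^ ν) * fun t : ℝ => (t : ℂ) * wigner v u (ray m t))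
      (𝓝[>] 0) (𝓝 0) := by
    have c1 : ContinuousAt (fun t : ℝ => (t : ℂ) ^ ν * ((t : ℂ) * wigner v u (ray m t))) 0 :=
      (continuousAt_ofReal_cpow_const 0 ν (Or.inl hν)).mul
        (continuous_ofReal.mul ((rapidDecay_wigner v u).continuous_ray m)).continuousAt
    have := c1.tendsto
    simp only [ofReal_zero, zero_mul, mul_zero] at this
    exact this.mono_left nhdsWithin_le_nhds
  have hinf : Tendsto ((fun t : ℝ => (t : ℂ) ^ ν) * fun t : ℝ => (t : ℂ) * wigner v u (ray m t))
      atTop (𝓝 0) := by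
    obtain ⟨N, hN⟩ := exists_nat_gt (ν.re + 1)
    obtain ⟨C, hC, H⟩ := (rapidDecay_wigner v u).exists_norm_ray_le N
    have hlim : Tendsto (fun t : ℝ => C * nrm m ^ (-(N : ℝ)) * t ^ (-(N - ν.re - 1))) atTop
        (𝓝 (C * nrm m ^ (-(N : ℝ)) * 0)) :=
      (tendsto_rpow_neg_atTop (by linarith)).const_mul _
    rw [mul_zero] at hlim
    refine squeeze_zero_norm' ?_ hlim
    filter_upwards [eventually_gt_atTop 0] with t ht
    simp only [Pi.mul_apply, norm_mul, norm_cpow_eq_rpow_re_of_pos ht, norm_real,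
      Real.norm_of_nonneg ht.le]
    calc t ^ ν.re * (t * ‖wigner v u (ray m t)‖)
        ≤ t ^ ν.re * (t * (C * (t ^ N)⁻¹ * nrm m ^ (-(N : ℝ)))) := by gcongr; exact H m t ht
      _ = C * nrm m ^ (-(N : ℝ)) * (t ^ ν.re * t ^ (1 : ℝ) * t ^ (-(N : ℝ))) := by
          rw [Real.rpow_neg ht.le, Real.rpow_natCast, Real.rpow_one]; ring
      _ = _ := by
          rw [← Real.rpow_add ht, ← Real.rpow_add ht]
          congr 2
          ring
  have key := integral_Ioi_mul_deriv_eq_deriv_mul hd hd2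
    (by
      refine IntegrableOn.congr_fun (i1.add i2) (fun t _ => ?_) measurableSet_Ioi
      simp only [Pi.mul_apply, Pi.add_apply]
      ring)
    (IntegrableOn.congr_fun (i0.const_mul ν) (fun t ht => (hprod t ht).symm) measurableSet_Ioi)
    hzero hinf
  rw [setIntegral_congr_fun measurableSet_Ioi hprod, integral_const_mul] at key
  have e : ∫ t in Ioi (0 : ℝ), (t : ℂ) ^ ν *
      (wigner (diffD v) (mulX u) (ray m t) + wigner (mulX v) (diffD u) (ray m t)) =
      (∫ t in Ioi (0 : ℝ), (t : ℂ) ^ ν * wigner (diffD v) (mulX u) (ray m t)) +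
        ∫ t in Ioi (0 : ℝ), (t : ℂ) ^ ν * wigner (mulX v) (diffD u) (ray m t) := by
    rw [← integral_add i1 i2]
    exact integral_congr_ae (ae_of_all _ fun t => mul_add _ _ _)
  rw [e] at key
  rw [key]
  ring

theorem mul_eisReg_of_one_lt (v u : 𝓢(ℝ, ℂ)) {ν : ℂ} (hν : 1 < ν.re) :
    ν * eisReg v u ν = -(eisReg (diffD v) (mulX u) ν + eisReg (mulX v) (diffD u) ν) := by
  have h1 : ν ≠ 1 := by rintro rfl; simp at hν
  have h2 : ν ≠ -1 := by rintro rfl; norm_num at hν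
  have e : ν * mellin (theta (wigner v u)) (ν + 1) =
      -(mellin (theta (wigner (diffD v) (mulX u))) (ν + 1) +
        mellin (theta (wigner (mulX v) (diffD u))) (ν + 1)) := by
    have a := ((rapidDecay_wigner v u).hasSum_eisenstein hν).mul_left ν
    have b := (((rapidDecay_wigner (diffD v) (mulX u)).hasSum_eisenstein hν).add
      ((rapidDecay_wigner (mulX v) (diffD u)).hasSum_eisenstein hν)).neg
    refine a.unique (b.congr_fun fun m => ?_)
    exact mul_integral_cpow_mul_ray v u m (by linarith)
  simp only [eisReg_eq_mul _ _ h1 h2, eisenstein_eq_mellin _ _ hν]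
  linear_combination (ν - 1) * e

/-- The right side is of the same type as `eisReg v u`, so each application gains a factor 1/ν.
Analyticity of both sides away from −1 extends the identity from Re ν > 1 to the line Re ν = 1 and
beyond. -/
theorem mul_eisReg (v u : 𝓢(ℝ, ℂ)) {ν : ℂ} (hν : ν ≠ -1) :
    ν * eisReg v u ν = -(eisReg (diffD v) (mulX u) ν + eisReg (mulX v) (diffD u) ν) := by
  have hopen : IsOpen ({-1} : Set ℂ)ᶜ := isOpen_compl_singleton
  have hconn : IsPreconnected ({-1} : Set ℂ)ᶜ :=
    (isConnected_compl_singleton_of_one_lt_rank (by simp) _).isPreconnected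
  have d1 : DifferentiableOn ℂ (fun ν => ν * eisReg v u ν) ({-1} : Set ℂ)ᶜ := fun z hz =>
    (differentiableAt_id.mul (differentiableAt_eisReg v u hz)).differentiableWithinAt
  have d2 : DifferentiableOn ℂ
      (fun ν => -(eisReg (diffD v) (mulX u) ν + eisReg (mulX v) (diffD u) ν)) ({-1} : Set ℂ)ᶜ :=
    fun z hz => (((differentiableAt_eisReg _ _ hz).add
      (differentiableAt_eisReg _ _ hz)).neg).differentiableWithinAt
  have h2 : (2 : ℂ) ∈ ({-1} : Set ℂ)ᶜ := by
    simp only [mem_compl_iff, mem_singleton_iff]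
    norm_num [Complex.ext_iff]
  have hnear : (fun ν => ν * eisReg v u ν) =ᶠ[𝓝 (2 : ℂ)]
      fun ν => -(eisReg (diffD v) (mulX u) ν + eisReg (mulX v) (diffD u) ν) := by
    have : {z : ℂ | 1 < z.re} ∈ 𝓝 (2 : ℂ) :=
      (isOpen_lt continuous_const Complex.continuous_re).mem_nhds (by norm_num)
    filter_upwards [this] with z hz using mul_eisReg_of_one_lt v u hz
  exact (d1.analyticOnNhd hopen).eqOn_of_preconnected_of_eventuallyEq
    (d2.analyticOnNhd hopen) hconn h2 hnear hν

/-- Inside the strip t^{σ−1} is dominated by the sum of its values at the two edges. -/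
theorem exists_norm_mellin_le {f : ℝ → ℂ} {a b : ℝ} (ha : MellinConvergent f a)
    (hb : MellinConvergent f b) :
    ∃ C : ℝ, ∀ s : ℂ, a ≤ s.re → s.re ≤ b → ‖mellin f s‖ ≤ C := by
  refine ⟨∫ t in Ioi (0 : ℝ), (‖(t : ℂ) ^ ((a : ℂ) - 1) • f t‖ + ‖(t : ℂ) ^ ((b : ℂ) - 1) • f t‖),
    fun s h1 h2 => ?_⟩
  refine norm_integral_le_of_norm_le (ha.norm.add hb.norm) ?_
  filter_upwards [ae_restrict_mem measurableSet_Ioi] with t ht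
  have ht0 : (0 : ℝ) < t := ht
  simp only [norm_smul, norm_cpow_eq_rpow_re_of_pos ht0, sub_re, one_re, ofReal_re]
  rw [← add_mul]
  gcongr
  rcases le_total t 1 with h | h
  · exact (Real.rpow_le_rpow_of_exponent_ge ht0 h (by linarith)).trans
      (le_add_of_nonneg_right (by positivity))
  · exact (Real.rpow_le_rpow_of_exponent_le h (by linarith)).trans
      (le_add_of_nonneg_left (by positivity))

/-- In the strip `Λ₀` is an absolutely convergent Mellin integral with real part between 2 and 3,
hence bounded; only the factor ν − 1 grows. -/
theorem exists_norm_eisReg_le_add (v u : 𝓢(ℝ, ℂ)) :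
    ∃ C : ℝ, 0 ≤ C ∧ ∀ ν : ℂ, 1 ≤ ν.re → ν.re ≤ 2 → ‖eisReg v u ν‖ ≤ C * ‖ν‖ := by
  set P := wignerPair v u
  have hc : ∀ s : ℂ, MellinConvergent P.f_modif s := fun s => by
    obtain ⟨t, ht⟩ := exists_gt s.re
    obtain ⟨w, hw⟩ := exists_lt s.re
    exact mellinConvergent_of_isBigO_rpow P.hf_modif_int
      (P.isStrongFEPair_toStrongFEPair.hf_top _) ht
      (P.isStrongFEPair_toStrongFEPair.hf_zero _) hw
  obtain ⟨C, H⟩ := exists_norm_mellin_le (hc ((2 : ℝ) : ℂ)) (hc ((3 : ℝ) : ℂ))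
  refine ⟨2 * |C| + 1 * ‖wigner v u 0‖ + ‖wigner v (reflect u) 0‖, by positivity,
    fun ν h1 h2 => ?_⟩
  have h3 : 1 ≤ ‖ν‖ := h1.trans (re_le_norm ν)
  have h4 : ‖ν - 1‖ ≤ 2 * ‖ν‖ := (norm_sub_le _ _).trans (by rw [norm_one]; linarith)
  have h5 : ‖P.Λ₀ (ν + 1)‖ ≤ |C| := by
    refine (H (ν + 1) ?_ ?_).trans (le_abs_self C) <;> simp only [add_re, one_re] <;> linarith
  have h6 : ‖(ν - 1) / (ν + 1)‖ ≤ 1 := by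
    rw [norm_div]
    refine div_le_one_of_le₀ ?_ (norm_nonneg _)
    rw [← sq_le_sq₀ (norm_nonneg _) (norm_nonneg _), Complex.sq_norm, Complex.sq_norm,
      normSq_apply, normSq_apply]
    simp only [sub_re, add_re, one_re, sub_im, add_im, one_im]
    nlinarith
  calc ‖eisReg v u ν‖ ≤ ‖(ν - 1) * P.Λ₀ (ν + 1)‖ + ‖(ν - 1) / (ν + 1) * wigner v u 0‖ +
        ‖wigner v (reflect u) 0‖ := (norm_add_le _ _).trans (by gcongr; exact norm_sub_le _ _)
    _ ≤ 2 * ‖ν‖ * |C| + 1 * ‖wigner v u 0‖ + ‖wigner v (reflect u) 0‖ := by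
        rw [norm_mul, norm_mul]
        gcongr
    _ ≤ 2 * ‖ν‖ * |C| + 1 * ‖wigner v u 0‖ * ‖ν‖ + ‖wigner v (reflect u) 0‖ * ‖ν‖ := by
        have a := le_mul_of_one_le_right (norm_nonneg (wigner v u 0)) h3
        have b := le_mul_of_one_le_right (norm_nonneg (wigner v (reflect u) 0)) h3
        linarith
    _ = _ := by ring

theorem exists_norm_eisReg_le (N : ℕ) (v u : 𝓢(ℝ, ℂ)) :
    ∃ C : ℝ, 0 ≤ C ∧ ∀ ν : ℂ, 1 ≤ ν.re → ν.re ≤ 2 → ‖eisReg v u ν‖ ≤ C * ‖ν‖ * (‖ν‖ ^ N)⁻¹ := by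
  induction N generalizing v u with
  | zero =>
    obtain ⟨C, hC, H⟩ := exists_norm_eisReg_le_add v u
    exact ⟨C, hC, fun ν h1 h2 => by simpa using H ν h1 h2⟩
  | succ N ih =>
    obtain ⟨C₁, hC₁, H₁⟩ := ih (diffD v) (mulX u)
    obtain ⟨C₂, hC₂, H₂⟩ := ih (mulX v) (diffD u)
    refine ⟨C₁ + C₂, by positivity, fun ν h1 h2 => ?_⟩
    have h3 : 0 < ‖ν‖ := by linarith [re_le_norm ν]
    have hne : ν ≠ -1 := by rintro rfl; norm_num at h1
    have h4 : ‖ν‖ * ‖eisReg v u ν‖ ≤ (C₁ + C₂) * ‖ν‖ * (‖ν‖ ^ N)⁻¹ := by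
      rw [← norm_mul, mul_eisReg v u hne, norm_neg]
      refine (norm_add_le _ _).trans ((add_le_add (H₁ ν h1 h2) (H₂ ν h1 h2)).trans (le_of_eq ?_))
      ring
    rw [pow_succ, mul_inv, ← mul_assoc, ← div_eq_mul_inv, le_div_iff₀ h3]
    linarith

/-- The function `(1 - 2^{-ν})⁻¹ ζ(ν)⁻¹ ⟨E_{-ν}, Wig(v,u)⟩`, with its singularity at `1` removed. -/
def lineKernel (v u : 𝓢(ℝ, ℂ)) (ν : ℂ) : ℂ :=
  (1 - (2 : ℂ) ^ (-ν))⁻¹ * (eisReg v u ν / riemannZeta₁ ν)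

theorem lineKernel_eq (v u : 𝓢(ℝ, ℂ)) {ν : ℂ} (h1 : ν ≠ 1) (h2 : ν ≠ -1) :
    lineKernel v u ν = (1 - (2 : ℂ) ^ (-ν))⁻¹ / riemannZeta ν * eisenstein ν (wigner v u) := by
  rw [lineKernel, eisReg_eq_mul v u h1 h2, riemannZeta₁_eq_mul h1,
    mul_div_mul_left _ _ (sub_ne_zero.mpr h1)]
  ring

theorem differentiableAt_lineKernel (v u : 𝓢(ℝ, ℂ)) {ν : ℂ} (hν : 1 ≤ ν.re) :
    DifferentiableAt ℂ (lineKernel v u) ν := by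
  have h2 : ν ≠ -1 := by rintro rfl; norm_num at hν
  have d1 : DifferentiableAt ℂ (fun ν : ℂ => (2 : ℂ) ^ (-ν)) ν :=
    differentiableAt_id.neg.const_cpow (Or.inl two_ne_zero)
  exact ((d1.const_sub 1).inv (one_sub_two_cpow_ne_zero (by linarith))).mul
    ((differentiableAt_eisReg v u h2).div (differentiable_riemannZeta₁ ν)
      (riemannZeta₁_ne_zero_of_one_le_re hν))

theorem continuous_lineKernel (v u : 𝓢(ℝ, ℂ)) {a : ℝ} (ha : 1 ≤ a) :
    Continuous fun y : ℝ => lineKernel v u (a + y * I) := by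
  refine continuous_iff_continuousAt.mpr fun y => ?_
  have h : ContinuousAt (lineKernel v u) (a + y * I) :=
    (differentiableAt_lineKernel v u (by simpa using ha)).continuousAt
  have h2 : ContinuousAt (fun y : ℝ => (a : ℂ) + y * I) y := by fun_prop
  exact ContinuousAt.comp (f := fun y : ℝ => (a : ℂ) + y * I) h h2

theorem exists_norm_lineKernel_le (N : ℕ) (v u : 𝓢(ℝ, ℂ)) :
    ∃ C : ℝ, 0 ≤ C ∧ ∀ a y : ℝ, 1 ≤ a → a ≤ 2 →
      ‖lineKernel v u (a + y * I)‖ ≤ C * ((1 + |y|) ^ N)⁻¹ := by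
  -- Of the N + 7 powers, one pays for the factor |ν| in the bound and six for the lower bound on
  -- ζ₁.
  obtain ⟨C, hC, H⟩ := exists_norm_eisReg_le (N + 7) v u
  obtain ⟨c, hc, hζ⟩ := exists_le_norm_riemannZeta₁
  refine ⟨2 * (C * 2 ^ (N + 6)) / c, by positivity, fun a y h1 h2 => ?_⟩
  set ν : ℂ := a + y * I with hν
  have hre : ν.re = a := by simp [hν]
  have him : ν.im = y := by simp [hν]
  have h3 : 1 ≤ ‖ν‖ := h1.trans (hre ▸ re_le_norm ν)
  have h4 : |y| ≤ ‖ν‖ := him ▸ abs_im_le_norm ν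
  have hy := abs_nonneg y
  have h5 : (1 + |y|) / 2 ≤ ‖ν‖ := by linarith
  have e1 : ‖eisReg v u ν‖ ≤ C * 2 ^ (N + 6) * ((1 + |y|) ^ (N + 6))⁻¹ := by
    refine (H ν (hre ▸ h1) (hre ▸ h2)).trans ?_
    have : C * ‖ν‖ * (‖ν‖ ^ (N + 7))⁻¹ = C * (‖ν‖ ^ (N + 6))⁻¹ := by
      have : ‖ν‖ ≠ 0 := by linarith
      rw [pow_succ _ (N + 6)]
      field_simp
    rw [this, mul_assoc]
    have e : (2 : ℝ) ^ (N + 6) * ((1 + |y|) ^ (N + 6))⁻¹ = (((1 + |y|) / 2) ^ (N + 6))⁻¹ := by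
      rw [div_pow, inv_div]; rfl
    rw [e]
    gcongr
  have e2 : c * ((1 + |y|) ^ 6)⁻¹ ≤ ‖riemannZeta₁ ν‖ := by
    rw [← div_eq_mul_inv, div_le_iff₀ (by positivity)]
    exact hζ a y h1 h2
  have e3 : 1 / 2 ≤ ‖1 - (2 : ℂ) ^ (-ν)‖ := by
    have h6 : ‖(2 : ℂ) ^ (-ν)‖ ≤ 1 / 2 := by
      have := norm_natCast_cpow_neg (s := ν) (by linarith [hre]) 2
      push_cast at this
      rw [this, hre, one_div, ← Real.rpow_neg_one]
      exact Real.rpow_le_rpow_of_exponent_le (by norm_num) (by linarith)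
    have := norm_sub_norm_le (1 : ℂ) ((2 : ℂ) ^ (-ν))
    rw [norm_one] at this
    linarith
  rw [lineKernel, norm_mul, norm_inv, norm_div]
  calc ‖1 - (2 : ℂ) ^ (-ν)‖⁻¹ * (‖eisReg v u ν‖ / ‖riemannZeta₁ ν‖)
      ≤ (1 / 2)⁻¹ * ((C * 2 ^ (N + 6) * ((1 + |y|) ^ (N + 6))⁻¹) / (c * ((1 + |y|) ^ 6)⁻¹)) := by
        gcongr
    _ = _ := by
        rw [pow_add (1 + |y|)]
        field_simp

theorem integrable_lineKernel (v u : 𝓢(ℝ, ℂ)) {a : ℝ} (h1 : 1 ≤ a) (h2 : a ≤ 2) :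
    Integrable fun y : ℝ => lineKernel v u (a + y * I) := by
  obtain ⟨C, hC, H⟩ := exists_norm_lineKernel_le 2 v u
  exact (integrable_inv_one_add_abs_sq.const_mul C).mono'
    (continuous_lineKernel v u h1).aestronglyMeasurable (ae_of_all _ fun y => H a y h1 h2)

/-! ### The line integral as a Möbius sum of lattice sums -/

/-- The integral `(2π)⁻¹ ∫ x^ν lineKernel(ν) dy` over the line `ν = a + iy`. -/
def lineIntegral (v u : 𝓢(ℝ, ℂ)) (a x : ℝ) : ℂ :=
  (2 * Real.pi : ℂ)⁻¹ * ∫ y : ℝ, (x : ℂ) ^ ((a : ℂ) + y * I) * lineKernel v u (a + y * I)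

theorem norm_ofReal_cpow_line {x : ℝ} (hx : 0 < x) (a y : ℝ) :
    ‖(x : ℂ) ^ ((a : ℂ) + y * I)‖ = x ^ a := by
  rw [norm_cpow_eq_rpow_re_of_pos hx]
  simp

theorem exists_norm_lineIntegral_le (v u : 𝓢(ℝ, ℂ)) :
    ∃ C : ℝ, 0 ≤ C ∧ ∀ x : ℝ, 0 < x → ‖lineIntegral v u 1 x‖ ≤ C * x := by
  refine ⟨‖(2 * Real.pi : ℂ)⁻¹‖ * ∫ y : ℝ, ‖lineKernel v u (1 + y * I)‖, by positivity,
    fun x hx => ?_⟩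
  rw [lineIntegral, norm_mul, mul_assoc]
  gcongr
  refine (norm_integral_le_integral_norm _).trans (le_of_eq ?_)
  rw [← integral_mul_const]
  refine integral_congr_ae (ae_of_all _ fun y => ?_)
  simp only
  rw [norm_mul, norm_ofReal_cpow_line hx, Real.rpow_one, mul_comm]
  simp

/-- The Dirichlet series of 1/ζ is used only for a > 1, so the line Re ν = 1 is reached as a limit;
the decay of the kernel, uniform for 1 ≤ a ≤ 2, provides the domination. -/
theorem tendsto_lineIntegral (v u : 𝓢(ℝ, ℂ)) {x : ℝ} (hx : 0 < x) :
    Tendsto (fun a => lineIntegral v u a x) (𝓝[>] 1) (𝓝 (lineIntegral v u 1 x)) := by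
  obtain ⟨C, hC, H⟩ := exists_norm_lineKernel_le 2 v u
  refine Tendsto.const_mul _ ?_
  have hnear : ∀ᶠ a in 𝓝[>] (1 : ℝ), 1 ≤ a ∧ a ≤ 2 := by
    filter_upwards [Ioc_mem_nhdsGT (one_lt_two (α := ℝ))] with a ha using ⟨ha.1.le, ha.2⟩
  have hx0 : (x : ℂ) ≠ 0 := by exact_mod_cast hx.ne'
  refine tendsto_integral_filter_of_dominated_convergence
    (fun y => max x (x ^ 2) * (C * ((1 + |y|) ^ 2)⁻¹)) ?_ ?_
    ((integrable_inv_one_add_abs_sq.const_mul C).const_mul _) ?_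
  · filter_upwards [hnear] with a ha
    refine (Continuous.mul ?_ (continuous_lineKernel v u ha.1)).aestronglyMeasurable
    exact Continuous.const_cpow (by fun_prop) (Or.inl hx0)
  · filter_upwards [hnear] with a ha
    refine ae_of_all _ fun y => ?_
    rw [norm_mul, norm_ofReal_cpow_line hx]
    gcongr
    · rcases le_total x 1 with h | h
      · refine le_max_of_le_left ?_
        simpa using Real.rpow_le_rpow_of_exponent_ge hx h ha.1
      · refine le_max_of_le_right ?_
        have := Real.rpow_le_rpow_of_exponent_le h ha.2
        rwa [Real.rpow_two] at this
    · exact H a y ha.1 ha.2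
  · refine ae_of_all _ fun y => ?_
    have c1 : ContinuousAt (fun ν : ℂ => (x : ℂ) ^ ν * lineKernel v u ν) ((1 : ℝ) + y * I) := by
      refine ContinuousAt.mul ?_ (differentiableAt_lineKernel v u (by simp)).continuousAt
      exact (continuous_id.const_cpow (Or.inl hx0)).continuousAt
    have c2 : ContinuousAt (fun a : ℝ => (a : ℂ) + y * I) 1 := by fun_prop
    have := ContinuousAt.comp (f := fun a : ℝ => (a : ℂ) + y * I) c1 c2
    exact this.tendsto.mono_left nhdsWithin_le_nhds

/-- The sum of `oddMoebius n · (n/x) Θ(n/x)`, where `Θ` is the lattice sum of `Wig(v,u)`. -/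
def thetaSeries (v u : 𝓢(ℝ, ℂ)) (x : ℝ) : ℂ :=
  ∑' n : ℕ, (oddMoebius n : ℂ) * ((n / x : ℝ) * theta (wigner v u) (n / x))

theorem continuousAt_theta_wigner (v u : 𝓢(ℝ, ℂ)) {t : ℝ} (ht : 0 < t) :
    ContinuousAt (theta (wigner v u)) t :=
  (rapidDecay_wigner v u).continuousOn_theta.continuousAt (Ioi_mem_nhds ht)

theorem mellin_theta_eq_div (v u : 𝓢(ℝ, ℂ)) {ν : ℂ} (hν : 1 < ν.re) :
    mellin (theta (wigner v u)) (ν + 1) = eisReg v u ν / (ν - 1) := by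
  have h1 : ν ≠ 1 := by rintro rfl; simp at hν
  have h2 : ν ≠ -1 := by rintro rfl; norm_num at hν
  rw [eq_div_iff (sub_ne_zero.mpr h1), eisReg_eq_mul v u h1 h2, eisenstein_eq_mellin v u hν,
    mul_comm]

theorem integrable_mellin_theta (v u : 𝓢(ℝ, ℂ)) {a : ℝ} (h1 : 1 < a) (h2 : a ≤ 2) :
    Integrable fun y : ℝ => mellin (theta (wigner v u)) ((a : ℂ) + y * I + 1) := by
  obtain ⟨C, hC, H⟩ := exists_norm_eisReg_le 3 v u
  have hre : ∀ y : ℝ, ((a : ℂ) + y * I).re = a := fun y => by simp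
  have e : (fun y : ℝ => mellin (theta (wigner v u)) ((a : ℂ) + y * I + 1)) =
      fun y : ℝ => eisReg v u (a + y * I) / ((a : ℂ) + y * I - 1) := by
    funext y
    exact mellin_theta_eq_div v u (by rw [hre]; exact h1)
  have hne : ∀ y : ℝ, (a : ℂ) + y * I - 1 ≠ 0 := fun y h => by
    have := congrArg re h
    simp at this
    linarith
  have hne2 : ∀ y : ℝ, (a : ℂ) + y * I ≠ -1 := fun y h => by
    have := congrArg re h
    simp at this
    linarith
  rw [e]
  refine Integrable.mono' (integrable_inv_one_add_abs_sq.const_mul (C * 4 / (a - 1))) ?_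
    (ae_of_all _ fun y => ?_)
  · refine Continuous.aestronglyMeasurable (Continuous.div ?_ (by fun_prop) hne)
    refine continuous_iff_continuousAt.mpr fun y => ?_
    exact ContinuousAt.comp (f := fun y : ℝ => (a : ℂ) + y * I)
      (differentiableAt_eisReg v u (hne2 y)).continuousAt (by fun_prop)
  · have h3 : 1 ≤ ‖(a : ℂ) + y * I‖ := h1.le.trans (by simpa using re_le_norm ((a : ℂ) + y * I))
    have h4 : |y| ≤ ‖(a : ℂ) + y * I‖ := by simpa using abs_im_le_norm ((a : ℂ) + y * I)
    have hy := abs_nonneg y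
    have h5 : (1 + |y|) / 2 ≤ ‖(a : ℂ) + y * I‖ := by linarith
    have h6 : a - 1 ≤ ‖(a : ℂ) + y * I - 1‖ := by simpa using re_le_norm ((a : ℂ) + y * I - 1)
    have h7 := H (a + y * I) (by rw [hre]; exact h1.le) (by rw [hre]; exact h2)
    have h8 : C * ‖(a : ℂ) + y * I‖ * (‖(a : ℂ) + y * I‖ ^ 3)⁻¹ =
        C * (‖(a : ℂ) + y * I‖ ^ 2)⁻¹ := by
      have : ‖(a : ℂ) + y * I‖ ≠ 0 := by linarith
      field_simp
    have h9 : (‖(a : ℂ) + y * I‖ ^ 2)⁻¹ ≤ 4 * ((1 + |y|) ^ 2)⁻¹ := by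
      have : 4 * ((1 + |y|) ^ 2)⁻¹ = (((1 + |y|) / 2) ^ 2)⁻¹ := by
        rw [div_pow, inv_div]
        ring
      rw [this]
      gcongr
    have ha : 0 < a - 1 := by linarith
    rw [norm_div]
    calc _ ≤ C * (4 * ((1 + |y|) ^ 2)⁻¹) / (a - 1) := by
          gcongr
          rw [h8] at h7
          exact h7.trans (by gcongr)
      _ = _ := by ring

/-- Mellin inversion for the lattice sum. -/
theorem integral_cpow_mul_mellin_theta (v u : 𝓢(ℝ, ℂ)) {a x : ℝ} (h1 : 1 < a) (h2 : a ≤ 2)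
    (hx : 0 < x) :
    (2 * Real.pi : ℂ)⁻¹ * ∫ y : ℝ, (x : ℂ) ^ ((a : ℂ) + y * I) *
      mellin (theta (wigner v u)) ((a : ℂ) + y * I + 1) =
      (x⁻¹ : ℝ) * theta (wigner v u) x⁻¹ := by
  have hx' : 0 < x⁻¹ := inv_pos.mpr hx
  have hx0 : (x : ℂ) ≠ 0 := by exact_mod_cast hx.ne'
  have hM : MellinConvergent (theta (wigner v u)) ((a + 1 : ℝ) : ℂ) := by
    have h3 : (wignerPair v u).k < (((a + 1 : ℝ) : ℂ)).re := by
      simp only [wignerPair, ofReal_re]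
      linarith
    have := ((wignerPair v u).hasMellin h3).1
    simpa only [wignerPair, add_sub_cancel_left] using this
  have hV : VerticalIntegrable (mellin (theta (wigner v u))) (a + 1) := by
    refine (integrable_mellin_theta v u h1 h2).congr (ae_of_all _ fun y => ?_)
    simp only
    congr 1
    push_cast
    ring
  have key := mellinInv_mellin_eq (a + 1) _ hx' hM hV (continuousAt_theta_wigner v u hx')
  rw [← key, mellinInv, Complex.real_smul]
  have e : ∀ y : ℝ, ((x⁻¹ : ℝ) : ℂ) ^ (-(((a + 1 : ℝ) : ℂ) + y * I)) •
      mellin (theta (wigner v u)) (((a + 1 : ℝ) : ℂ) + y * I) =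
      (x : ℂ) * ((x : ℂ) ^ ((a : ℂ) + y * I) *
        mellin (theta (wigner v u)) ((a : ℂ) + y * I + 1)) := by
    intro y
    have e1 : (((a + 1 : ℝ) : ℂ) + y * I) = (a : ℂ) + y * I + 1 := by push_cast; ring
    have e2 : ((x⁻¹ : ℝ) : ℂ) ^ (-((a : ℂ) + y * I + 1)) = (x : ℂ) ^ ((a : ℂ) + y * I) * x := by
      rw [ofReal_inv, inv_cpow _ _ (by rw [arg_ofReal_of_nonneg hx.le]; exact Real.pi_pos.ne),
        ← cpow_neg, neg_neg, cpow_add _ _ hx0, cpow_one]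
    rw [e1, e2, smul_eq_mul]
    ring
  simp only [e]
  rw [integral_const_mul]
  generalize (∫ y : ℝ, (x : ℂ) ^ ((a : ℂ) + y * I) *
    mellin (theta (wigner v u)) ((a : ℂ) + y * I + 1)) = J
  push_cast
  field_simp

/-- On Re ν = a > 1 the Möbius series converges absolutely, and Mellin inversion applies to each
term with x/n in place of x. The result does not involve a. -/
theorem lineIntegral_eq_thetaSeries_of_one_lt (v u : 𝓢(ℝ, ℂ)) {a x : ℝ} (h1 : 1 < a) (h2 : a ≤ 2)
    (hx : 0 < x) : lineIntegral v u a x = thetaSeries v u x := by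
  set M : ℝ → ℂ := fun y => mellin (theta (wigner v u)) ((a : ℂ) + y * I + 1) with hM
  have hMi : Integrable M := integrable_mellin_theta v u h1 h2
  have hx0 : (x : ℂ) ≠ 0 := by exact_mod_cast hx.ne'
  have hre : ∀ y : ℝ, ((a : ℂ) + y * I).re = a := fun y => by simp
  set F : ℕ → ℝ → ℂ := fun n y =>
    (x : ℂ) ^ ((a : ℂ) + y * I) * ((oddMoebius n : ℂ) * (n : ℂ) ^ (-((a : ℂ) + y * I))) * M y
    with hF
  have hnorm : ∀ n y, ‖F n y‖ = x ^ a * ‖(oddMoebius n : ℂ) * (n : ℂ) ^ (-(a : ℂ))‖ * ‖M y‖ := by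
    intro n y
    simp only [hF, norm_mul, norm_ofReal_cpow_line hx]
    rw [norm_natCast_cpow_neg (by rw [hre]; linarith), norm_natCast_cpow_neg (s := (a : ℂ))
      (by rw [ofReal_re]; linarith), hre, ofReal_re]
  have hmeas : ∀ n, AEStronglyMeasurable (F n) := by
    intro n
    rcases eq_or_ne n 0 with rfl | hn
    · have : F 0 = fun _ => 0 := by
        funext y
        simp [hF, oddMoebius]
      rw [this]
      exact aestronglyMeasurable_const
    · have hn0 : (n : ℂ) ≠ 0 := by exact_mod_cast hn
      refine AEStronglyMeasurable.mul (Continuous.aestronglyMeasurable ?_) hMi.aestronglyMeasurable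
      exact (Continuous.const_cpow (by fun_prop) (Or.inl hx0)).mul
        (continuous_const.mul (Continuous.const_cpow (by fun_prop) (Or.inl hn0)))
  have hint : ∀ n, Integrable (F n) := fun n =>
    (hMi.norm.const_mul _).mono' (hmeas n) (ae_of_all _ fun y => (hnorm n y).le)
  have hsum : Summable fun n => ∫ y, ‖F n y‖ := by
    have e : (fun n => ∫ y, ‖F n y‖) = fun n =>
        x ^ a * ‖(oddMoebius n : ℂ) * (n : ℂ) ^ (-(a : ℂ))‖ * ∫ y, ‖M y‖ := by
      funext n
      simp only [hnorm]
      rw [integral_const_mul]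
    rw [e]
    exact ((summable_norm_mul_cpow (g := oddMoebius) norm_oddMoebius_le
      (by simpa using h1)).mul_left _).mul_right _
  have key := hasSum_integral_of_summable_integral_norm hint hsum
  have hK : ∀ y : ℝ, ∑' n, F n y = (x : ℂ) ^ ((a : ℂ) + y * I) * lineKernel v u (a + y * I) := by
    intro y
    have h3 : 1 < ((a : ℂ) + y * I).re := by rw [hre]; exact h1
    have h4 : (a : ℂ) + y * I ≠ 1 := by intro h; rw [h] at h3; simp at h3
    have h5 : (a : ℂ) + y * I ≠ -1 := by intro h; rw [h] at h3; norm_num at h3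
    simp only [hF]
    rw [tsum_mul_right, tsum_mul_left, tsum_oddMoebius h3, lineKernel_eq v u h4 h5,
      eisenstein_eq_mellin v u h3, mul_assoc]
  have hterm : ∀ n : ℕ, (2 * Real.pi : ℂ)⁻¹ * ∫ y, F n y =
      (oddMoebius n : ℂ) * ((n / x : ℝ) * theta (wigner v u) (n / x)) := by
    intro n
    rcases eq_or_ne n 0 with rfl | hn
    · simp [hF, oddMoebius]
    have hn0 : (0 : ℝ) < n := by exact_mod_cast Nat.pos_of_ne_zero hn
    have h3 := integral_cpow_mul_mellin_theta v u h1 h2 (div_pos hx hn0)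
    rw [inv_div] at h3
    rw [← h3]
    have e : ∀ y : ℝ, F n y = (oddMoebius n : ℂ) * (((x / n : ℝ) : ℂ) ^ ((a : ℂ) + y * I) *
        mellin (theta (wigner v u)) ((a : ℂ) + y * I + 1)) := by
      intro y
      have e1 : ((x / n : ℝ) : ℂ) ^ ((a : ℂ) + y * I) =
          (x : ℂ) ^ ((a : ℂ) + y * I) * (n : ℂ) ^ (-((a : ℂ) + y * I)) := by
        rw [div_eq_mul_inv, ofReal_mul, mul_cpow_ofReal_nonneg hx.le (by positivity), ofReal_inv,
          inv_cpow _ _ (by rw [arg_ofReal_of_nonneg hn0.le]; exact Real.pi_pos.ne), ← cpow_neg,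
          ofReal_natCast]
      rw [e1]
      simp only [hF, hM]
      ring
    simp only [e]
    rw [integral_const_mul]
    ring
  have key2 := key.mul_left (2 * Real.pi : ℂ)⁻¹
  simp only [hterm, hK] at key2
  exact key2.tsum_eq.symm

theorem lineIntegral_eq_thetaSeries (v u : 𝓢(ℝ, ℂ)) {x : ℝ} (hx : 0 < x) :
    lineIntegral v u 1 x = thetaSeries v u x := by
  refine tendsto_nhds_unique (tendsto_lineIntegral v u hx)
    (tendsto_const_nhds.congr' ?_)
  filter_upwards [Ioc_mem_nhdsGT (one_lt_two (α := ℝ))] with a ha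
  exact (lineIntegral_eq_thetaSeries_of_one_lt v u ha.1 ha.2 hx).symm

/-- Useful as x → 0, where it gives decay of every order; for large x the bound O(x) of the line
integral is the relevant one. -/
theorem exists_norm_thetaSeries_le (v u : 𝓢(ℝ, ℂ)) {N : ℕ} (hN : 2 ≤ N) :
    ∃ C : ℝ, 0 ≤ C ∧ ∀ x : ℝ, 0 < x → ‖thetaSeries v u x‖ ≤ C * x ^ N := by
  obtain ⟨C, hC, H⟩ := (rapidDecay_wigner v u).exists_norm_theta_le (N := N + 1) (by omega)
  have hs : Summable fun n : ℕ => ((n : ℝ) ^ N)⁻¹ := Real.summable_nat_pow_inv.mpr (by omega)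
  refine ⟨C * ∑' n : ℕ, ((n : ℝ) ^ N)⁻¹, mul_nonneg hC (tsum_nonneg fun n => by positivity),
    fun x hx => ?_⟩
  have hle : ∀ n : ℕ, ‖(oddMoebius n : ℂ) * ((n / x : ℝ) * theta (wigner v u) (n / x))‖ ≤
      C * x ^ N * ((n : ℝ) ^ N)⁻¹ := by
    intro n
    rcases eq_or_ne n 0 with rfl | hn
    · simp only [oddMoebius, Nat.not_odd_zero, if_false, Int.cast_zero, zero_mul, norm_zero]
      positivity
    have hn0 : (0 : ℝ) < n := by exact_mod_cast Nat.pos_of_ne_zero hn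
    have hnx : 0 < n / x := div_pos hn0 hx
    rw [norm_mul, norm_mul, norm_real, Real.norm_of_nonneg hnx.le]
    calc ‖(oddMoebius n : ℂ)‖ * (n / x * ‖theta (wigner v u) (n / x)‖)
        ≤ 1 * (n / x * (C * ((n / x) ^ (N + 1))⁻¹)) := by
          gcongr
          · exact norm_oddMoebius_le n
          · exact H _ hnx
      _ = C * x ^ N * ((n : ℝ) ^ N)⁻¹ := by
          rw [div_pow, pow_succ, pow_succ x]
          field_simp
  refine (tsum_of_norm_bounded (hs.mul_left (C * x ^ N)).hasSum hle).trans (le_of_eq ?_)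
  rw [tsum_mul_left]
  ring

/-- The lattice point `n m`. -/
def mulPt (n : ℕ) (hn : n ≠ 0) (m : LatticePt) : LatticePt :=
  ⟨((n : ℤ) * m.1.1, (n : ℤ) * m.1.2), by
    obtain ⟨⟨j, k⟩, hm⟩ := m
    intro h
    simp only [Prod.mk_eq_zero, mul_eq_zero, Nat.cast_eq_zero, hn, false_or] at h
    exact hm (Prod.ext h.1 h.2)⟩

/-- The greatest common divisor of the coordinates of a lattice point. -/
def gcdPt (m : LatticePt) : ℕ := Int.gcd m.1.1 m.1.2

theorem gcdPt_ne_zero (m : LatticePt) : gcdPt m ≠ 0 := by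
  obtain ⟨⟨j, k⟩, hm⟩ := m
  intro h
  obtain ⟨h1, h2⟩ := Int.gcd_eq_zero_iff.mp h
  exact hm (Prod.ext h1 h2)

theorem gcdPt_le_nrm (m : LatticePt) : (gcdPt m : ℝ) ≤ nrm m := by
  obtain ⟨⟨j, k⟩, hm⟩ := m
  simp only [nrm, gcdPt, Prod.norm_def, Real.norm_eq_abs]
  rcases eq_or_ne j 0 with rfl | hj
  · rw [Int.gcd_zero_left]
    refine le_max_of_le_right (le_of_eq ?_)
    rw [Nat.cast_natAbs, Int.cast_abs]
  · refine le_max_of_le_left ?_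
    rw [← Int.cast_abs, ← Nat.cast_natAbs]
    exact_mod_cast Nat.le_of_dvd (Int.natAbs_pos.mpr hj) (Int.gcd_dvd_natAbs_left j k)

theorem tsum_mulPt (n : ℕ) (hn : n ≠ 0) (f : LatticePt → ℂ) :
    ∑' m, f (mulPt n hn m) = ∑' m, if n ∣ gcdPt m then f m else 0 := by
  have hinj : Function.Injective (mulPt n hn) := by
    rintro ⟨⟨j, k⟩, hm⟩ ⟨⟨j', k'⟩, hm'⟩ h
    have hn' : (n : ℤ) ≠ 0 := by exact_mod_cast hn
    simp only [mulPt, Subtype.mk.injEq, Prod.mk.injEq, mul_eq_mul_left_iff, hn', or_false] at h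
    ext
    · exact h.1
    · exact h.2
  rw [← hinj.tsum_eq (f := fun m => if n ∣ gcdPt m then f m else 0)]
  · refine tsum_congr fun m => ?_
    rw [if_pos]
    simp only [gcdPt, mulPt, Int.gcd_mul_left]
    exact Dvd.intro _ rfl
  · intro m hm
    have hd : n ∣ gcdPt m := by
      by_contra h
      simp [h] at hm
    obtain ⟨⟨j, k⟩, hm0⟩ := m
    have h1 : (n : ℤ) ∣ j := (Int.natCast_dvd_natCast.mpr hd).trans (Int.gcd_dvd_left j k)
    have h2 : (n : ℤ) ∣ k := (Int.natCast_dvd_natCast.mpr hd).trans (Int.gcd_dvd_right j k)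
    obtain ⟨j', rfl⟩ := h1
    obtain ⟨k', rfl⟩ := h2
    refine ⟨⟨(j', k'), ?_⟩, rfl⟩
    intro h
    simp only [Prod.mk_eq_zero] at h
    exact hm0 (by simp [h.1, h.2, Prod.zero_eq_mk])

/-- In ∑ μ(n) n Wig(nm/Q), summed over n and m, collect the terms with the same point nm. A lattice
point receives the sum of μ(n) n over the odd divisors n of its gcd, which is `oddCoeff`. -/
theorem thetaSeries_natCast (v u : 𝓢(ℝ, ℂ)) {Q : ℕ} (hQ : Q ≠ 0) :
    thetaSeries v u Q = hermForm v u Q := by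
  set h := wigner v u with hh
  have hQ0 : (0 : ℝ) < Q := by exact_mod_cast Nat.pos_of_ne_zero hQ
  have hQi : (0 : ℝ) < (Q : ℝ)⁻¹ := inv_pos.mpr hQ0
  set f : LatticePt → ℂ := fun m => h (ray m (Q : ℝ)⁻¹) with hf
  set G : LatticePt → ℕ → ℂ := fun m n =>
    if n ∣ gcdPt m then (oddMoebius n : ℂ) * n * f m else 0 with hG
  have hsupp : ∀ m, ∀ n ∉ (gcdPt m).divisors, G m n = 0 := by
    intro m n hn
    have : ¬ n ∣ gcdPt m := fun hd => hn (Nat.mem_divisors.mpr ⟨hd, gcdPt_ne_zero m⟩)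
    simp [hG, this]
  have hGle : ∀ m n, ‖G m n‖ ≤ nrm m * ‖f m‖ := by
    intro m n
    have hm := nrm_pos m
    simp only [hG]
    split_ifs with hd
    · rw [norm_mul, norm_mul, Complex.norm_natCast]
      have h1 : (n : ℝ) ≤ nrm m := (Nat.cast_le.mpr (Nat.le_of_dvd
        (Nat.pos_of_ne_zero (gcdPt_ne_zero m)) hd)).trans (gcdPt_le_nrm m)
      calc ‖(oddMoebius n : ℂ)‖ * n * ‖f m‖ ≤ 1 * nrm m * ‖f m‖ := by
            gcongr
            exact norm_oddMoebius_le n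
        _ = _ := by rw [one_mul]
    · rw [norm_zero]
      positivity
  have hsum : Summable (Function.uncurry G) := by
    refine Summable.of_norm ((summable_prod_of_nonneg fun _ => norm_nonneg _).mpr ⟨fun m => ?_, ?_⟩)
    · exact summable_of_ne_finset_zero (s := (gcdPt m).divisors) fun n hn => by
        simp only [Function.uncurry, hsupp m n hn, norm_zero]
    -- Of five powers of decay, one is spent on the size of n and one on the number of divisors,
    -- both at most the norm of m; the three left make the lattice sum converge.
    · obtain ⟨C, hC, H⟩ := (rapidDecay_wigner v u).exists_norm_ray_le 5
      refine Summable.of_nonneg_of_le (fun m => tsum_nonneg fun _ => norm_nonneg _) (fun m => ?_)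
        ((summable_nrm_rpow (k := 3) (by norm_num)).mul_left (C * (((Q : ℝ)⁻¹) ^ 5)⁻¹))
      have hm := nrm_pos m
      rw [tsum_eq_sum (s := (gcdPt m).divisors) fun n hn => by
        simp only [Function.uncurry, hsupp m n hn, norm_zero]]
      calc ∑ n ∈ (gcdPt m).divisors, ‖Function.uncurry G (m, n)‖
          ≤ ∑ n ∈ (gcdPt m).divisors, nrm m * ‖f m‖ := Finset.sum_le_sum fun n _ => hGle m n
        _ = (gcdPt m).divisors.card * (nrm m * ‖f m‖) := by rw [Finset.sum_const, nsmul_eq_mul]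
        _ ≤ nrm m * (nrm m * (C * (((Q : ℝ)⁻¹) ^ 5)⁻¹ * nrm m ^ (-((5 : ℕ) : ℝ)))) := by
            gcongr
            · exact (Nat.cast_le.mpr (Nat.card_divisors_le_self _)).trans (gcdPt_le_nrm m)
            · exact H m _ hQi
        _ = C * (((Q : ℝ)⁻¹) ^ 5)⁻¹ * (nrm m * nrm m * nrm m ^ (-((5 : ℕ) : ℝ))) := by ring
        _ = _ := by
            congr 1
            have : nrm m * nrm m = nrm m ^ (2 : ℝ) := by rw [Real.rpow_two]; ring
            rw [this, ← Real.rpow_add hm]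
            norm_num
  have hcomm := hsum.tsum_comm
  have h1 : ∀ n : ℕ, (oddMoebius n : ℂ) * (((n / Q : ℝ) : ℂ) * theta h (n / Q)) =
      (Q : ℂ)⁻¹ * ∑' m, G m n := by
    intro n
    rcases eq_or_ne n 0 with rfl | hn
    · simp [hG, oddMoebius]
    have e1 : theta h (n / Q) = ∑' m, f (mulPt n hn m) := by
      refine tsum_congr fun m => ?_
      simp only [hf, ray, mulPt]
      congr 2 <;> push_cast <;> field_simp
    rw [e1, tsum_mulPt n hn]
    have e2 : ∀ m, G m n = (oddMoebius n : ℂ) * n * (if n ∣ gcdPt m then f m else 0) := by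
      intro m
      simp only [hG]
      split_ifs <;> simp
    simp only [e2]
    rw [tsum_mul_left]
    push_cast
    ring
  have h2 : ∀ m, ∑' n, G m n = (oddCoeff (gcdPt m) : ℂ) * f m := by
    intro m
    rw [tsum_eq_sum (s := (gcdPt m).divisors) (hsupp m), ← sum_divisors_oddMoebius_mul
      (gcdPt_ne_zero m)]
    push_cast
    rw [Finset.sum_mul]
    refine Finset.sum_congr rfl fun n hn => ?_
    simp only [hG]
    rw [if_pos (Nat.dvd_of_mem_divisors hn)]
  rw [thetaSeries]
  simp only [← hh]
  simp only [h1]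
  rw [tsum_mul_left, hcomm]
  simp only [h2]
  rw [hermForm, tHalfInfty, ← tsum_mul_left]
  refine tsum_congr fun m => ?_
  simp only [rescale, hf, ray, gcdPt, ← hh]
  rw [mul_comm (m.1.1 : ℝ), mul_comm (m.1.2 : ℝ)]
  push_cast
  ring

/-! ### The series for F₀(s) when Re s > 2 -/

/-- The Dirichlet series of the squarefree odd integers. -/
def sqfSeries (w : ℂ) : ℂ := ∑' n : ℕ, (sqfOddInd n : ℂ) * (n : ℂ) ^ (-w)

/-- At y = 0 the factors `riemannZeta` and `eisenstein` carry only conventional values, whereas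
`lineKernel` is continuous. The excluded point is negligible for the integral. -/
theorem F0Integrand_eq (v u : 𝓢(ℝ, ℂ)) {s : ℂ} (hs : 2 < s.re) {y : ℝ} (hy : y ≠ 0) :
    F0Integrand v u s (1 + y * I) =
      sqfSeries (s - (1 + y * I)) * lineKernel v u (1 + y * I) := by
  have h1 : (1 : ℂ) + y * I ≠ 1 := by
    intro h
    have := congrArg im h
    simp at this
    exact hy this
  have h2 : (1 : ℂ) + y * I ≠ -1 := by
    intro h
    have := congrArg re h
    norm_num at this
  rw [sqfSeries, tsum_sqfOddInd (by simp; linarith), lineKernel_eq v u h1 h2, F0Integrand, neg_sub,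
    neg_add_eq_sub, mul_assoc]

theorem ae_F0Integrand_eq (v u : 𝓢(ℝ, ℂ)) {s : ℂ} (hs : 2 < s.re) :
    (fun y : ℝ => F0Integrand v u s (1 + y * I)) =ᵐ[volume]
      fun y : ℝ => sqfSeries (s - (1 + y * I)) * lineKernel v u (1 + y * I) := by
  have h : ∀ᵐ y : ℝ, y ≠ 0 := by simp [ae_iff, measure_singleton]
  filter_upwards [h] with y hy using F0Integrand_eq v u hs hy

theorem norm_sqfOddInd_mul_cpow (n : ℕ) {w : ℂ} (hw : 0 < w.re) :
    ‖(sqfOddInd n : ℂ) * (n : ℂ) ^ (-w)‖ = ‖(sqfOddInd n : ℂ) * (n : ℂ) ^ (-(w.re : ℂ))‖ := by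
  rw [norm_mul, norm_mul, norm_natCast_cpow_neg hw, norm_natCast_cpow_neg (by simpa using hw),
    ofReal_re]

theorem re_sub_line (s : ℂ) (y : ℝ) : (s - (1 + y * I)).re = s.re - 1 := by simp

theorem continuous_sqfSeries_line {s : ℂ} (hs : 2 < s.re) :
    Continuous fun y : ℝ => sqfSeries (s - (1 + y * I)) := by
  have h := summable_norm_mul_cpow (g := sqfOddInd) norm_sqfOddInd_le
    (s := ((s.re - 1 : ℝ) : ℂ)) (by rw [ofReal_re]; linarith)
  refine continuous_tsum (fun n => ?_) h fun n y => ?_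
  · rcases eq_or_ne n 0 with rfl | hn
    · simp only [sqfOddInd, not_squarefree_zero, false_and, if_false, Int.cast_zero, zero_mul]
      exact continuous_const
    · exact continuous_const.mul (Continuous.const_cpow (by fun_prop)
        (Or.inl (by exact_mod_cast hn)))
  · rw [norm_sqfOddInd_mul_cpow n (by rw [re_sub_line]; linarith), re_sub_line]

theorem exists_norm_sqfSeries_le {σ : ℝ} (hσ : 1 < σ) :
    ∃ C : ℝ, ∀ w : ℂ, w.re = σ → ‖sqfSeries w‖ ≤ C := by
  have h := summable_norm_mul_cpow (g := sqfOddInd) norm_sqfOddInd_le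
    (s := (σ : ℂ)) (by rwa [ofReal_re])
  refine ⟨_, fun w hw => tsum_of_norm_bounded h.hasSum fun n => ?_⟩
  rw [norm_sqfOddInd_mul_cpow n (by linarith), hw]

theorem integrable_F0Integrand (v u : 𝓢(ℝ, ℂ)) {s : ℂ} (hs : 2 < s.re) :
    Integrable fun y : ℝ => F0Integrand v u s (1 + y * I) := by
  obtain ⟨C, H⟩ := exists_norm_sqfSeries_le (σ := s.re - 1) (by linarith)
  have hK := integrable_lineKernel v u le_rfl one_le_two
  rw [ofReal_one] at hK
  refine Integrable.congr ?_ (ae_F0Integrand_eq v u hs).symm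
  exact hK.bdd_mul (continuous_sqfSeries_line hs).aestronglyMeasurable
    (ae_of_all _ fun y => H _ (re_sub_line s y))

theorem F0_eq (v u : 𝓢(ℝ, ℂ)) {s : ℂ} (hs : 2 < s.re) :
    F0 v u s = (2 * Real.pi : ℂ)⁻¹ *
      ∫ y : ℝ, sqfSeries (s - (1 + y * I)) * lineKernel v u (1 + y * I) := by
  rw [F0, integral_mul_const, integral_congr_ae (ae_F0Integrand_eq v u hs), mul_inv]
  field_simp

/-- As Re (s − ν) > 1 on the line, the series may be integrated term by term; n^{-(s−ν)} = n^{-s}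
n^ν makes each term n^{-s} times the line integral at x = n. -/
theorem hasSum_F0_nat (v u : 𝓢(ℝ, ℂ)) {s : ℂ} (hs : 2 < s.re) :
    HasSum (fun n : ℕ => (sqfOddInd n : ℂ) * ((n : ℂ) ^ (-s) * hermForm v u n)) (F0 v u s) := by
  set K : ℝ → ℂ := fun y => lineKernel v u (1 + y * I) with hK
  have hKi : Integrable K := by
    have := integrable_lineKernel v u le_rfl one_le_two
    rwa [ofReal_one] at this
  set F : ℕ → ℝ → ℂ := fun n y =>
    (sqfOddInd n : ℂ) * (n : ℂ) ^ (-(s - (1 + y * I))) * K y with hF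
  have hnorm : ∀ n y, ‖F n y‖ =
      ‖(sqfOddInd n : ℂ) * (n : ℂ) ^ (-((s.re - 1 : ℝ) : ℂ))‖ * ‖K y‖ := by
    intro n y
    simp only [hF]
    rw [norm_mul, norm_sqfOddInd_mul_cpow n (by rw [re_sub_line]; linarith), re_sub_line]
  have hmeas : ∀ n, AEStronglyMeasurable (F n) := by
    intro n
    refine AEStronglyMeasurable.mul (Continuous.aestronglyMeasurable ?_) hKi.aestronglyMeasurable
    rcases eq_or_ne n 0 with rfl | hn
    · simp only [sqfOddInd, not_squarefree_zero, false_and, if_false, Int.cast_zero, zero_mul]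
      exact continuous_const
    · exact continuous_const.mul (Continuous.const_cpow (by fun_prop)
        (Or.inl (by exact_mod_cast hn)))
  have hint : ∀ n, Integrable (F n) := fun n =>
    (hKi.norm.const_mul _).mono' (hmeas n) (ae_of_all _ fun y => (hnorm n y).le)
  have hsum : Summable fun n => ∫ y, ‖F n y‖ := by
    have e : (fun n => ∫ y, ‖F n y‖) = fun n =>
        ‖(sqfOddInd n : ℂ) * (n : ℂ) ^ (-((s.re - 1 : ℝ) : ℂ))‖ * ∫ y, ‖K y‖ := by
      funext n
      simp only [hnorm]
      rw [integral_const_mul]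
    rw [e]
    exact (summable_norm_mul_cpow (g := sqfOddInd) norm_sqfOddInd_le
      (by rw [ofReal_re]; linarith)).mul_right _
  have key := (hasSum_integral_of_summable_integral_norm hint hsum).mul_left (2 * Real.pi : ℂ)⁻¹
  have hR : (2 * Real.pi : ℂ)⁻¹ * ∫ y, ∑' n, F n y = F0 v u s := by
    rw [F0_eq v u hs]
    congr 1
    refine integral_congr_ae (ae_of_all _ fun y => ?_)
    simp only [hF, sqfSeries]
    rw [tsum_mul_right]
  have hterm : ∀ n : ℕ, (2 * Real.pi : ℂ)⁻¹ * ∫ y, F n y =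
      (sqfOddInd n : ℂ) * ((n : ℂ) ^ (-s) * hermForm v u n) := by
    intro n
    rcases eq_or_ne n 0 with rfl | hn
    · simp [hF, sqfOddInd]
    have hn0 : (n : ℂ) ≠ 0 := by exact_mod_cast hn
    rw [← thetaSeries_natCast v u hn, ← lineIntegral_eq_thetaSeries v u
      (by exact_mod_cast Nat.pos_of_ne_zero hn), lineIntegral]
    have e : ∀ y : ℝ, F n y = (sqfOddInd n : ℂ) * (n : ℂ) ^ (-s) *
        (((n : ℝ) : ℂ) ^ (((1 : ℝ) : ℂ) + y * I) * lineKernel v u (((1 : ℝ) : ℂ) + y * I)) := by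
      intro y
      simp only [hF, hK, ofReal_one, ofReal_natCast]
      rw [neg_sub, sub_eq_neg_add, cpow_add _ _ hn0]
      ring
    simp only [e]
    rw [integral_const_mul]
    ring
  simp only [hterm, hR] at key
  exact key

theorem hasSum_F0Term (v u : 𝓢(ℝ, ℂ)) {s : ℂ} (hs : 2 < s.re) :
    HasSum (F0Term v u s) (F0 v u s) := by
  have h : HasSum (indicator {Q : ℕ | Squarefree Q ∧ Odd Q}
      fun n : ℕ => (n : ℂ) ^ (-s) * hermForm v u n) (F0 v u s) := by
    refine (hasSum_F0_nat v u hs).congr_fun fun n => ?_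
    by_cases hn : Squarefree n ∧ Odd n
    · rw [indicator_of_mem (show n ∈ {Q : ℕ | Squarefree Q ∧ Odd Q} from hn), sqfOddInd, if_pos hn]
      simp
    · rw [indicator_of_notMem (show n ∉ {Q : ℕ | Squarefree Q ∧ Odd Q} from hn), sqfOddInd,
        if_neg hn]
      simp
  exact hasSum_subtype_iff_indicator.mpr h

/-- The coefficients are O(n) by the bound on the line integral, so F₀ is an L-series with abscissa
of absolute convergence at most 2. -/
theorem analyticOnNhd_F0 (v u : 𝓢(ℝ, ℂ)) : AnalyticOnNhd ℂ (F0 v u) {s : ℂ | 2 < s.re} := by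
  have hopen : IsOpen {s : ℂ | 2 < s.re} := isOpen_lt continuous_const continuous_re
  set f : ℕ → ℂ := fun n => (sqfOddInd n : ℂ) * hermForm v u n with hf
  obtain ⟨C, hC, H⟩ := exists_norm_lineIntegral_le v u
  have habs : LSeries.abscissaOfAbsConv f ≤ ((1 : ℝ) : EReal) + 1 := by
    refine LSeries.abscissaOfAbsConv_le_of_le_const_mul_rpow ⟨C, fun n hn => ?_⟩
    have hn0 : (0 : ℝ) < n := by exact_mod_cast Nat.pos_of_ne_zero hn
    have h1 := H n hn0
    rw [lineIntegral_eq_thetaSeries v u hn0, thetaSeries_natCast v u hn] at h1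
    rw [hf, Real.rpow_one, norm_mul]
    exact (mul_le_of_le_one_left (norm_nonneg _) (norm_sqfOddInd_le n)).trans h1
  have heq : EqOn (F0 v u) (LSeries f) {s : ℂ | 2 < s.re} := by
    intro s hs
    rw [← (hasSum_F0_nat v u hs).tsum_eq, LSeries]
    refine tsum_congr fun n => ?_
    rcases eq_or_ne n 0 with rfl | hn
    · simp [sqfOddInd]
    · rw [LSeries.term_of_ne_zero hn, cpow_neg, hf]
      ring
  have hd : DifferentiableOn ℂ (LSeries f) {s : ℂ | 2 < s.re} := by
    refine (LSeries_differentiableOn f).mono fun s hs => ?_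
    refine habs.trans_lt ?_
    have : ((1 : ℝ) : EReal) + 1 = ((2 : ℝ) : EReal) := by
      rw [← EReal.coe_one, ← EReal.coe_add]
      norm_num
    rw [this]
    exact EReal.coe_lt_coe_iff.mpr hs
  exact (hd.congr heq).analyticOnNhd hopen

/-! ### Mellin transform of the line integral, and Abel summation -/

theorem mul_lineKernel (v u : 𝓢(ℝ, ℂ)) {ν : ℂ} (hν : ν ≠ -1) :
    ν * lineKernel v u ν =
      -(lineKernel (diffD v) (mulX u) ν + lineKernel (mulX v) (diffD u) ν) := by
  have h := mul_eisReg v u hν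
  simp only [lineKernel]
  linear_combination (1 - (2 : ℂ) ^ (-ν))⁻¹ * (riemannZeta₁ ν)⁻¹ * h

theorem mellin_comp_mul_inv (g : ℝ → ℂ) (ν : ℂ) {a : ℝ} (ha : 0 < a) :
    mellin (fun x => g (a * x⁻¹)) (-ν) = (a : ℂ) ^ (-ν) * mellin g ν := by
  have h1 := mellin_comp_inv (fun t => g (a * t)) (-ν)
  rw [neg_neg, mellin_comp_mul_left g ν ha, smul_eq_mul] at h1
  exact h1

theorem mellinConvergent_comp_mul_inv {g : ℝ → ℂ} {ν : ℂ} {a : ℝ} (ha : 0 < a)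
    (hg : MellinConvergent g ν) : MellinConvergent (fun x => g (a * x⁻¹)) (-ν) := by
  have h1 := (MellinConvergent.comp_mul_left ha).mpr hg
  have h2 := MellinConvergent.comp_rpow (f := fun t => g (a * t)) (s := -ν) (a := -1) (by norm_num)
  simp only [Real.rpow_neg_one, ofReal_neg, ofReal_one, neg_div_neg_eq, div_one] at h2
  exact h2.mpr h1

/-- The term μ(n) (n/x) Θ(n/x) has, at −ν, the transform μ(n) n^{-ν} times that of Θ at ν + 1;
summing over n restores 1/ζ. -/
theorem mellin_lineIntegral (v u : 𝓢(ℝ, ℂ)) {ν : ℂ} (hν : 1 < ν.re) :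
    mellin (lineIntegral v u 1) (-ν) = lineKernel v u ν := by
  have h1 : ν ≠ 1 := by rintro rfl; simp at hν
  have h2 : ν ≠ -1 := by rintro rfl; norm_num at hν
  set θ := theta (wigner v u) with hθ
  set g : ℝ → ℂ := fun t => (t : ℂ) ^ (1 : ℂ) • θ t with hg
  have hM : MellinConvergent θ (ν + 1) := by
    have h3 : (wignerPair v u).k < (ν + 1).re := by
      simp only [wignerPair, add_re, one_re]
      linarith
    have := ((wignerPair v u).hasMellin h3).1
    simpa only [wignerPair, add_sub_cancel_left] using this
  have hgM : MellinConvergent g ν := MellinConvergent.cpow_smul.mpr hM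
  have hgm : mellin g ν = mellin θ (ν + 1) := mellin_cpow_smul θ ν 1
  set F : ℕ → ℝ → ℂ := fun n x =>
    (x : ℂ) ^ (-ν - 1) • ((oddMoebius n : ℂ) * g (n * x⁻¹)) with hF
  have hF0 : F 0 = fun _ => 0 := by
    funext x
    simp [hF, oddMoebius]
  have hint : ∀ n, IntegrableOn (F n) (Ioi 0) := by
    intro n
    rcases eq_or_ne n 0 with rfl | hn
    · rw [hF0]
      exact integrableOn_zero
    · have hn0 : (0 : ℝ) < n := by exact_mod_cast Nat.pos_of_ne_zero hn
      exact ((mellinConvergent_comp_mul_inv hn0 hgM).const_smul (oddMoebius n : ℂ))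
  have hterm : ∀ n, ∫ x in Ioi (0 : ℝ), F n x =
      (oddMoebius n : ℂ) * (n : ℂ) ^ (-ν) * mellin θ (ν + 1) := by
    intro n
    rcases eq_or_ne n 0 with rfl | hn
    · simp [hF0, oddMoebius]
    · have hn0 : (0 : ℝ) < n := by exact_mod_cast Nat.pos_of_ne_zero hn
      have h3 := mellin_comp_mul_inv g ν hn0
      rw [hgm, ofReal_natCast] at h3
      rw [mul_assoc, ← h3, mellin, ← integral_const_mul]
      refine integral_congr_ae (ae_of_all _ fun x => ?_)
      simp only [hF, smul_eq_mul]
      ring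
  have hsum : Summable fun n => ∫ x in Ioi (0 : ℝ), ‖F n x‖ := by
    -- Absolute convergence is read off the same scaling formula, applied to the norm of g and the
    -- real exponent Re ν.
    set g₂ : ℝ → ℂ := fun t => (‖g t‖ : ℂ) with hg₂
    have e : ∀ n, ∫ x in Ioi (0 : ℝ), ‖F n x‖ =
        ‖(oddMoebius n : ℂ) * (n : ℂ) ^ (-(ν.re : ℂ))‖ * ‖mellin g₂ ν.re‖ := by
      intro n
      rcases eq_or_ne n 0 with rfl | hn
      · simp [hF0, oddMoebius]
      have hn0 : (0 : ℝ) < n := by exact_mod_cast Nat.pos_of_ne_zero hn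
      have h3 := mellin_comp_mul_inv g₂ ν.re hn0
      rw [ofReal_natCast] at h3
      have h4 : ((∫ x in Ioi (0 : ℝ), ‖F n x‖ : ℝ) : ℂ) =
          (‖(oddMoebius n : ℂ)‖ : ℂ) * mellin (fun x => g₂ (n * x⁻¹)) (-(ν.re : ℂ)) := by
        rw [← integral_complex_ofReal, mellin, ← integral_const_mul]
        refine setIntegral_congr_fun measurableSet_Ioi fun x hx => ?_
        have hx0 : (0 : ℝ) < x := hx
        have e1 : (x : ℂ) ^ (-(ν.re : ℂ) - 1) = ((x ^ (-ν.re - 1) : ℝ) : ℂ) := by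
          rw [ofReal_cpow hx0.le]
          push_cast
          rfl
        simp only [hF, hg₂, norm_mul, norm_cpow_eq_rpow_re_of_pos hx0, smul_eq_mul, e1,
          sub_re, neg_re, one_re]
        push_cast
        ring
      have h5 := congrArg norm h4
      rw [norm_real, Real.norm_of_nonneg (integral_nonneg fun _ => norm_nonneg _), h3, norm_mul,
        norm_mul, norm_real, norm_norm] at h5
      rw [h5, norm_mul, mul_assoc]
    simp only [e]
    exact (summable_norm_mul_cpow (g := oddMoebius) norm_oddMoebius_le
      (by rwa [ofReal_re])).mul_right _
  have key := hasSum_integral_of_summable_integral_norm hint hsum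
  have hL : ∫ x in Ioi (0 : ℝ), ∑' n, F n x = mellin (lineIntegral v u 1) (-ν) := by
    rw [mellin]
    refine setIntegral_congr_fun measurableSet_Ioi fun x hx => ?_
    have hx0 : (0 : ℝ) < x := hx
    simp only [hF, smul_eq_mul]
    rw [tsum_mul_left, lineIntegral_eq_thetaSeries v u hx0, thetaSeries]
    congr 1
    refine tsum_congr fun n => ?_
    simp only [hg, hθ, smul_eq_mul, cpow_one, div_eq_mul_inv]
  rw [← hL, ← key.tsum_eq]
  simp only [hterm]
  rw [tsum_mul_right, tsum_oddMoebius hν, lineKernel_eq v u h1 h2, eisenstein_eq_mellin v u hν]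

theorem continuousOn_lineIntegral (v u : 𝓢(ℝ, ℂ)) :
    ContinuousOn (lineIntegral v u 1) (Ioi 0) := by
  refine continuousOn_of_forall_continuousAt fun x hx => ?_
  have hx0 : (0 : ℝ) < x := hx
  have hK := integrable_lineKernel v u le_rfl one_le_two
  have hnear : ∀ᶠ z in 𝓝 x, 0 < z ∧ z < x + 1 :=
    Ioo_mem_nhds hx0 (by linarith)
  refine ContinuousAt.mul continuousAt_const ?_
  refine continuousAt_of_dominated (bound := fun y => (x + 1) * ‖lineKernel v u ((1 : ℝ) + y * I)‖)
    ?_ ?_ (hK.norm.const_mul _) ?_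
  · filter_upwards [hnear] with z hz
    exact ((Continuous.const_cpow (by fun_prop)
      (Or.inl (by exact_mod_cast hz.1.ne'))).aestronglyMeasurable).mul hK.aestronglyMeasurable
  · filter_upwards [hnear] with z hz
    refine ae_of_all _ fun y => ?_
    rw [norm_mul, norm_ofReal_cpow_line hz.1, Real.rpow_one]
    gcongr
    exact hz.2.le
  · exact ae_of_all _ fun y =>
      (continuousAt_ofReal_cpow_const x _ (Or.inr hx0.ne')).mul continuousAt_const

theorem lineIntegral_isBigO_atTop (v u : 𝓢(ℝ, ℂ)) :
    lineIntegral v u 1 =O[atTop] (· ^ (-(-1) : ℝ)) := by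
  obtain ⟨C, hC, H⟩ := exists_norm_lineIntegral_le v u
  refine Asymptotics.IsBigO.of_bound C ?_
  filter_upwards [eventually_gt_atTop 0] with x hx
  rw [neg_neg, Real.rpow_one, Real.norm_of_nonneg hx.le]
  exact H x hx

theorem lineIntegral_isBigO_zero (v u : 𝓢(ℝ, ℂ)) (r : ℝ) :
    lineIntegral v u 1 =O[𝓝[>] 0] (· ^ r) := by
  obtain ⟨N, hN⟩ := exists_nat_ge (max 2 r)
  obtain ⟨C, hC, H⟩ := exists_norm_thetaSeries_le v u (N := N)
    (by exact_mod_cast (le_max_left _ _).trans hN)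
  refine Asymptotics.IsBigO.of_bound C ?_
  filter_upwards [Ioc_mem_nhdsGT (zero_lt_one (α := ℝ))] with x hx
  rw [lineIntegral_eq_thetaSeries v u hx.1, Real.norm_of_nonneg (Real.rpow_nonneg hx.1.le _)]
  refine (H x hx.1).trans ?_
  rw [← Real.rpow_natCast]
  gcongr ?_ * ?_
  exact Real.rpow_le_rpow_of_exponent_ge hx.1 hx.2 ((le_max_right _ _).trans hN)

theorem locallyIntegrableOn_lineIntegral (v u : 𝓢(ℝ, ℂ)) :
    LocallyIntegrableOn (lineIntegral v u 1) (Ioi 0) :=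
  (continuousOn_lineIntegral v u).locallyIntegrableOn measurableSet_Ioi

theorem monotone_sqfCount : Monotone sqfCount := by
  intro x y hxy
  refine Finset.sum_le_sum_of_subset_of_nonneg
    (Finset.Icc_subset_Icc_right (Nat.floor_le_floor hxy)) fun k _ _ => ?_
  unfold sqfOddInd
  split_ifs <;> simp

theorem abs_sqfCount_le {x : ℝ} (hx : 0 ≤ x) : |sqfCount x| ≤ x := by
  have h1 : |sqfCount x| ≤ ∑ k ∈ Finset.Icc 1 ⌊x⌋₊, (1 : ℝ) := by
    refine (Finset.abs_sum_le_sum_abs _ _).trans (Finset.sum_le_sum fun k _ => ?_)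
    simpa [Complex.norm_intCast] using norm_sqfOddInd_le k
  refine h1.trans ?_
  simpa using Nat.floor_le hx

/-- The integral of `sqfCount(x) x^{-w-1}`. -/
def countMellin (w : ℂ) : ℂ := ∫ x in Ioi (1 : ℝ), (sqfCount x : ℂ) * (x : ℂ) ^ (-(w + 1))

theorem sqfSeries_eq_integral {w : ℂ} (hw : 1 < w.re) : sqfSeries w = w * countMellin w := by
  have h0 : (fun n => ∑ k ∈ Finset.Icc 1 n, ‖(sqfOddInd k : ℂ)‖) =O[atTop]
      fun n : ℕ => (n : ℝ) ^ (1 : ℝ) := by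
    refine Asymptotics.IsBigO.of_bound 1 (Eventually.of_forall fun n => ?_)
    rw [Real.norm_of_nonneg (Finset.sum_nonneg fun _ _ => norm_nonneg _), Real.rpow_one,
      Real.norm_of_nonneg (Nat.cast_nonneg _), one_mul]
    refine (Finset.sum_le_sum fun k _ => norm_sqfOddInd_le k).trans ?_
    simp
  have key := LSeries_eq_mul_integral' (fun n => (sqfOddInd n : ℂ)) zero_le_one hw h0
  have e : sqfSeries w = LSeries (fun n => (sqfOddInd n : ℂ)) w := by
    refine tsum_congr fun n => ?_
    rcases eq_or_ne n 0 with rfl | hn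
    · simp [sqfOddInd]
    · rw [LSeries.term_of_ne_zero hn, cpow_neg, div_eq_mul_inv]
  rw [e, key]
  congr 1
  refine integral_congr_ae (ae_of_all _ fun x => ?_)
  simp only [sqfCount]
  push_cast
  rfl

/-- The integral of `sqfCount(x) x^{-s-1}` against the line integral. -/
def countTransform (v u : 𝓢(ℝ, ℂ)) (s : ℂ) : ℂ :=
  ∫ x in Ioi (1 : ℝ), (sqfCount x : ℂ) * (x : ℂ) ^ (-s - 1) * lineIntegral v u 1 x

/-- Fubini's theorem: N(x) ≤ x leaves the majorant x^{1 − Re s}, integrable at infinity because Re s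
> 2. -/
theorem countTransform_eq (v u : 𝓢(ℝ, ℂ)) {s : ℂ} (hs : 2 < s.re) :
    Integrable (fun y : ℝ => countMellin (s - (1 + y * I)) * lineKernel v u (1 + y * I)) ∧
    (2 * Real.pi : ℂ)⁻¹ * ∫ y : ℝ, countMellin (s - (1 + y * I)) * lineKernel v u (1 + y * I) =
      countTransform v u s := by
  have hK := integrable_lineKernel v u le_rfl one_le_two
  rw [ofReal_one] at hK
  set Φ : ℝ → ℝ → ℂ := fun y x => (sqfCount x : ℂ) * (x : ℂ) ^ (-(s - (1 + y * I) + 1)) *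
    lineKernel v u (1 + y * I) with hΦ
  have hx1 : IntegrableOn (fun x : ℝ => x ^ (1 - s.re)) (Ioi 1) :=
    integrableOn_Ioi_rpow_of_lt (by linarith) zero_lt_one
  have hint : Integrable (Function.uncurry Φ) (volume.prod (volume.restrict (Ioi (1 : ℝ)))) := by
    refine Integrable.mono' (hK.norm.mul_prod hx1) ?_ ?_
    · refine AEStronglyMeasurable.mul (Measurable.aestronglyMeasurable ?_) ?_
      · have h1 : Measurable sqfCount := monotone_sqfCount.measurable
        fun_prop
      · exact hK.aestronglyMeasurable.comp_fst
    · have hae : ∀ᵐ z : ℝ × ℝ ∂(volume.prod (volume.restrict (Ioi (1 : ℝ)))), z.2 ∈ Ioi (1 : ℝ) :=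
        Measure.quasiMeasurePreserving_snd.ae (ae_restrict_mem measurableSet_Ioi)
      filter_upwards [hae] with z hz
      obtain ⟨y, x⟩ := z
      have hx0 : (0 : ℝ) < x := zero_lt_one.trans hz
      have hre : (-(s - (1 + y * I) + 1)).re = -s.re := by simp; ring
      simp only [Function.uncurry, hΦ]
      rw [norm_mul, norm_mul, norm_real, norm_cpow_eq_rpow_re_of_pos hx0, hre, mul_comm,
        sub_eq_add_neg, Real.rpow_add hx0, Real.rpow_one]
      gcongr
      exact abs_sqfCount_le hx0.le
  have hswap := integral_integral_swap hint
  have e1 : ∀ y : ℝ, countMellin (s - (1 + y * I)) * lineKernel v u (1 + y * I) =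
      ∫ x in Ioi (1 : ℝ), Φ y x := fun y => (integral_mul_const _ _).symm
  simp only [e1]
  refine ⟨hint.integral_prod_left, ?_⟩
  rw [hswap, countTransform, ← integral_const_mul]
  refine setIntegral_congr_fun measurableSet_Ioi fun x hx => ?_
  have hx0 : (x : ℂ) ≠ 0 := by exact_mod_cast (zero_lt_one.trans hx).ne'
  simp only [lineIntegral]
  have e2 : ∀ y : ℝ, Φ y x = (sqfCount x : ℂ) * (x : ℂ) ^ (-s - 1) *
      ((x : ℂ) ^ (((1 : ℝ) : ℂ) + y * I) * lineKernel v u (((1 : ℝ) : ℂ) + y * I)) := by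
    intro y
    have : -(s - (1 + y * I) + 1) = (-s - 1) + (1 + y * I) := by ring
    simp only [hΦ, ofReal_one]
    rw [this, cpow_add _ _ hx0]
    ring
  simp only [e2]
  rw [integral_const_mul]
  ring

/-- Abel summation of the Dirichlet series at s − ν brings out a factor s − ν, and `mul_lineKernel`
absorbs ν into the kernels of two other pairs. These terms stand for the derivative of the line
integral in a partial summation of ∑ Q^{-s} L(Q). -/
theorem F0_eq_countTransform (v u : 𝓢(ℝ, ℂ)) {s : ℂ} (hs : 2 < s.re) :
    F0 v u s = s * countTransform v u s + countTransform (diffD v) (mulX u) s +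
      countTransform (mulX v) (diffD u) s := by
  obtain ⟨i0, e0⟩ := countTransform_eq v u hs
  obtain ⟨i1, e1⟩ := countTransform_eq (diffD v) (mulX u) hs
  obtain ⟨i2, e2⟩ := countTransform_eq (mulX v) (diffD u) hs
  have e : ∀ y : ℝ, sqfSeries (s - (1 + y * I)) * lineKernel v u (1 + y * I) =
      s * (countMellin (s - (1 + y * I)) * lineKernel v u (1 + y * I)) +
        countMellin (s - (1 + y * I)) * lineKernel (diffD v) (mulX u) (1 + y * I) +
        countMellin (s - (1 + y * I)) * lineKernel (mulX v) (diffD u) (1 + y * I) := by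
    intro y
    have hne : (1 : ℂ) + y * I ≠ -1 := fun h => by
      have := congrArg re h
      norm_num at this
    rw [sqfSeries_eq_integral (by rw [re_sub_line]; linarith)]
    linear_combination -countMellin (s - (1 + y * I)) * mul_lineKernel v u hne
  rw [F0_eq v u hs, ← e0, ← e1, ← e2]
  simp only [e]
  have i3 := i0.const_mul s
  have h4 := integral_add (i3.add i1) i2
  simp only [Pi.add_apply] at h4
  rw [h4, integral_add i3 i1, integral_const_mul]
  ring

/-! ### Main term and remainder in the half-plane Re s > 3/2 -/

theorem mellin_indicator {S : Set ℝ} (hS : MeasurableSet S) (hS0 : S ⊆ Ioi 0) (f : ℝ → ℂ) (s : ℂ) :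
    mellin (S.indicator f) s = ∫ x in S, (x : ℂ) ^ (s - 1) • f x := by
  have e : (fun x : ℝ => (x : ℂ) ^ (s - 1) • S.indicator f x) =
      S.indicator fun x : ℝ => (x : ℂ) ^ (s - 1) • f x := by
    funext x
    by_cases hx : x ∈ S <;> simp [hx]
  rw [mellin, e, setIntegral_indicator hS, inter_eq_right.mpr hS0]

theorem mellinConvergent_indicator {S : Set ℝ} (hS : MeasurableSet S) (hS0 : S ⊆ Ioi 0)
    {f : ℝ → ℂ} {s : ℂ} (h : MellinConvergent (S.indicator f) s) :
    IntegrableOn (fun x : ℝ => (x : ℂ) ^ (s - 1) • f x) S := by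
  refine (h.mono_set hS0).congr_fun (fun x hx => ?_) hS
  simp only
  rw [indicator_of_mem hx]

theorem locallyIntegrableOn_indicator {f : ℝ → ℂ} {T S : Set ℝ} (hf : LocallyIntegrableOn f T)
    (hS : MeasurableSet S) : LocallyIntegrableOn (S.indicator f) T := fun x hx => by
  obtain ⟨U, hU, hi⟩ := hf x hx
  exact ⟨U, hU, hi.indicator hS⟩

theorem indicator_Ioc_isBigO_atTop (f : ℝ → ℂ) (r : ℝ) :
    (Ioc (0 : ℝ) 1).indicator f =O[atTop] (· ^ r) := by
  refine Asymptotics.IsBigO.of_bound 0 ?_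
  filter_upwards [eventually_gt_atTop 1] with x hx
  rw [indicator_of_notMem (fun h => absurd h.2 (not_le.mpr hx)), norm_zero, zero_mul]

theorem indicator_Ioi_isBigO_zero (f : ℝ → ℂ) (r : ℝ) :
    (Ioi (1 : ℝ)).indicator f =O[𝓝[>] 0] (· ^ r) := by
  refine Asymptotics.IsBigO.of_bound 0 ?_
  filter_upwards [Ioc_mem_nhdsGT (zero_lt_one (α := ℝ))] with x hx
  rw [indicator_of_notMem (show x ∉ Ioi (1 : ℝ) from not_lt.mpr hx.2), norm_zero, zero_mul]

/-- The line integral, cut off at `1`. -/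
def lowerCut (v u : 𝓢(ℝ, ℂ)) : ℝ → ℂ := (Ioc (0 : ℝ) 1).indicator (lineIntegral v u 1)

/-- The error term of the counting function times the line integral, cut off at `1`. -/
def upperCut (v u : 𝓢(ℝ, ℂ)) : ℝ → ℂ :=
  (Ioi (1 : ℝ)).indicator fun x => ((sqfCount x - sqfDensity * x : ℝ) : ℂ) * lineIntegral v u 1 x

theorem locallyIntegrableOn_upperCut (v u : 𝓢(ℝ, ℂ)) :
    LocallyIntegrableOn (upperCut v u) (Ioi 0) := by
  refine locallyIntegrableOn_indicator ?_ measurableSet_Ioi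
  have h1 : LocallyIntegrable fun x : ℝ => sqfCount x - sqfDensity * x :=
    monotone_sqfCount.locallyIntegrable.sub
      (Continuous.locallyIntegrable (continuous_const.mul continuous_id))
  have h2 : LocallyIntegrable fun x : ℝ => ((sqfCount x - sqfDensity * x : ℝ) : ℂ) := fun x => by
    obtain ⟨U, hU, hi⟩ := h1 x
    exact ⟨U, hU, hi.ofReal⟩
  exact (h2.locallyIntegrableOn _).mul_continuousOn (continuousOn_lineIntegral v u)
    isOpen_Ioi.isLocallyClosed

theorem upperCut_isBigO_atTop (v u : 𝓢(ℝ, ℂ)) {θ : ℝ} (h0 : 1 / 2 < θ) (h1 : θ ≤ 1) :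
    upperCut v u =O[atTop] (· ^ (-(-(θ + 1)))) := by
  obtain ⟨C, hC, H⟩ := exists_norm_lineIntegral_le v u
  obtain ⟨D, hD, G⟩ := exists_abs_sqfCount_sub_le h0 h1
  refine Asymptotics.IsBigO.of_bound (D * C) ?_
  filter_upwards [eventually_gt_atTop 1] with x hx
  have hx0 : 0 < x := zero_lt_one.trans hx
  rw [upperCut, indicator_of_mem (show x ∈ Ioi (1 : ℝ) from hx), norm_mul, norm_real, neg_neg,
    Real.norm_of_nonneg (Real.rpow_nonneg hx0.le _), Real.rpow_add hx0, Real.rpow_one]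
  calc _ ≤ (D * x ^ θ) * (C * x) := by
        gcongr
        · exact G x hx0
        · exact H x hx0
    _ = _ := by ring

/-- The midpoint of 1/2 and σ − 1, capped at 1 as the counting estimate demands. The sum θ + 1 joins
the error in the count and the linear growth of the line integral. -/
theorem exists_exponent {σ : ℝ} (hσ : 3 / 2 < σ) : ∃ θ : ℝ, 1 / 2 < θ ∧ θ ≤ 1 ∧ θ + 1 < σ := by
  refine ⟨min 1 ((1 / 2 + (σ - 1)) / 2), lt_min (by norm_num) (by linarith), min_le_left _ _, ?_⟩
  linarith [min_le_right 1 ((1 / 2 + (σ - 1)) / 2)]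

theorem differentiable_mellin_lowerCut (v u : 𝓢(ℝ, ℂ)) : Differentiable ℂ (mellin (lowerCut v u)) :=
  fun s => by
    obtain ⟨a, ha⟩ := exists_gt s.re
    obtain ⟨b, hb⟩ := exists_lt s.re
    refine mellin_differentiableAt_of_isBigO_rpow
      (locallyIntegrableOn_indicator (locallyIntegrableOn_lineIntegral v u) measurableSet_Ioc)
      (indicator_Ioc_isBigO_atTop _ (-a)) ha ?_ hb
    refine Asymptotics.IsBigO.trans (Asymptotics.isBigO_of_le _ fun x => ?_)
      (lineIntegral_isBigO_zero v u (-b))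
    exact norm_indicator_le_norm_self _ _

theorem differentiableAt_mellin_upperCut (v u : 𝓢(ℝ, ℂ)) {s : ℂ} (hs : 3 / 2 < s.re) :
    DifferentiableAt ℂ (mellin (upperCut v u)) (-s) := by
  obtain ⟨θ, h0, h1, h2⟩ := exists_exponent hs
  obtain ⟨b, hb⟩ := exists_lt (-s).re
  exact mellin_differentiableAt_of_isBigO_rpow (locallyIntegrableOn_upperCut v u)
    (upperCut_isBigO_atTop v u h0 h1) (by rw [neg_re]; linarith)
    (indicator_Ioi_isBigO_zero _ (-b)) hb

theorem mellinConvergent_upperCut (v u : 𝓢(ℝ, ℂ)) {s : ℂ} (hs : 3 / 2 < s.re) :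
    MellinConvergent (upperCut v u) (-s) := by
  obtain ⟨θ, h0, h1, h2⟩ := exists_exponent hs
  obtain ⟨b, hb⟩ := exists_lt (-s).re
  exact mellinConvergent_of_isBigO_rpow (locallyIntegrableOn_upperCut v u)
    (upperCut_isBigO_atTop v u h0 h1) (by rw [neg_re]; linarith)
    (indicator_Ioi_isBigO_zero _ (-b)) hb

/-- The part of `countTransform` which is analytic for `Re s > 3/2`. -/
def countRemainder (v u : 𝓢(ℝ, ℂ)) (s : ℂ) : ℂ :=
  -(sqfDensity : ℂ) * mellin (lowerCut v u) (1 - s) + mellin (upperCut v u) (-s)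

theorem differentiableAt_countRemainder (v u : 𝓢(ℝ, ℂ)) {s : ℂ} (hs : 3 / 2 < s.re) :
    DifferentiableAt ℂ (countRemainder v u) s := by
  have h1 : DifferentiableAt ℂ (fun s => mellin (lowerCut v u) (1 - s)) s :=
    (differentiable_mellin_lowerCut v u (1 - s)).comp s (differentiableAt_id.const_sub 1)
  have h2 : DifferentiableAt ℂ (fun s => mellin (upperCut v u) (-s)) s :=
    (differentiableAt_mellin_upperCut v u hs).comp s differentiableAt_id.neg
  exact (h1.const_mul _).add h2

/-- The part δx of the count yields the integral of x^{-s} L(x) over (1, ∞), that is, the full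
Mellin transform K(s − 1) minus the integral over (0, 1]. The latter is entire in s, as L vanishes
to every order at 0. -/
theorem countTransform_eq_add (v u : 𝓢(ℝ, ℂ)) {s : ℂ} (hs : 2 < s.re) :
    countTransform v u s = sqfDensity * lineKernel v u (s - 1) + countRemainder v u s := by
  have hb : MellinConvergent (lineIntegral v u 1) (1 - s) := by
    obtain ⟨b, hb⟩ := exists_lt (1 - s).re
    exact mellinConvergent_of_isBigO_rpow (locallyIntegrableOn_lineIntegral v u)
      (lineIntegral_isBigO_atTop v u) (by simp; linarith) (lineIntegral_isBigO_zero v u (-b)) hb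
  have hR := mellinConvergent_indicator measurableSet_Ioi (Ioi_subset_Ioi zero_le_one)
    (mellinConvergent_upperCut v u (s := s) (by linarith))
  have hm := mellin_lineIntegral v u (ν := s - 1) (by simp; linarith)
  rw [neg_sub] at hm
  have hsplit : mellin (lineIntegral v u 1) (1 - s) =
      (∫ x in Ioc (0 : ℝ) 1, (x : ℂ) ^ (1 - s - 1) • lineIntegral v u 1 x) +
        ∫ x in Ioi (1 : ℝ), (x : ℂ) ^ (1 - s - 1) • lineIntegral v u 1 x := by
    rw [mellin, ← Ioc_union_Ioi_eq_Ioi (zero_le_one (α := ℝ)),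
      setIntegral_union (Ioc_disjoint_Ioi le_rfl) measurableSet_Ioi
        (hb.mono_set Ioc_subset_Ioi_self) (hb.mono_set (Ioi_subset_Ioi zero_le_one))]
  have h1 := mellin_indicator (measurableSet_Ioc (a := (0 : ℝ)) (b := 1)) Ioc_subset_Ioi_self
    (lineIntegral v u 1) (1 - s)
  have h2 := mellin_indicator measurableSet_Ioi (Ioi_subset_Ioi zero_le_one)
    (fun x => ((sqfCount x - sqfDensity * x : ℝ) : ℂ) * lineIntegral v u 1 x) (-s)
  have h3 : countTransform v u s =
      ∫ x in Ioi (1 : ℝ), ((sqfDensity : ℂ) * ((x : ℂ) ^ (1 - s - 1) • lineIntegral v u 1 x) +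
        (x : ℂ) ^ (-s - 1) •
          (((sqfCount x - sqfDensity * x : ℝ) : ℂ) * lineIntegral v u 1 x)) := by
    refine setIntegral_congr_fun measurableSet_Ioi fun x hx => ?_
    have hx0 : (x : ℂ) ≠ 0 := by exact_mod_cast (zero_lt_one.trans hx).ne'
    have e : (x : ℂ) ^ (1 - s - 1) = (x : ℂ) ^ (-s - 1) * x := by
      rw [show 1 - s - 1 = (-s - 1) + 1 by ring, cpow_add _ _ hx0, cpow_one]
    simp only [smul_eq_mul, e]
    push_cast
    ring
  have hi : IntegrableOn (fun x : ℝ => (sqfDensity : ℂ) *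
      ((x : ℂ) ^ (1 - s - 1) • lineIntegral v u 1 x)) (Ioi 1) :=
    (hb.mono_set (Ioi_subset_Ioi zero_le_one)).const_mul _
  rw [h3, integral_add hi hR, integral_const_mul, countRemainder, lowerCut, upperCut, h1, h2, ← hm,
    hsplit]
  ring

/-- Up to a function which is analytic for `Re s > 3/2`, `F_0(s)` is a multiple of
`⟨E_{1-s}, Wig(v,u)⟩ / ζ(s-1)`. -/
theorem exists_F0_eq (v u : 𝓢(ℝ, ℂ)) :
    ∃ B : ℂ → ℂ, AnalyticOnNhd ℂ B {s : ℂ | 3 / 2 < s.re} ∧ ∀ s : ℂ, 2 < s.re →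
      F0 v u s = sqfDensity * lineKernel v u (s - 1) + B s := by
  refine ⟨fun s => s * countRemainder v u s + countRemainder (diffD v) (mulX u) s +
    countRemainder (mulX v) (diffD u) s, ?_, fun s hs => ?_⟩
  · refine DifferentiableOn.analyticOnNhd (fun s hs => ?_)
      (isOpen_lt continuous_const continuous_re)
    exact (((differentiableAt_id.mul (differentiableAt_countRemainder v u hs)).add
      (differentiableAt_countRemainder _ _ hs)).add
        (differentiableAt_countRemainder _ _ hs)).differentiableWithinAt
  · have hne : s - 1 ≠ -1 := fun h => by
      have := congrArg re h
      simp at this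
      linarith
    have h := mul_lineKernel v u hne
    rw [F0_eq_countTransform v u hs, countTransform_eq_add v u hs, countTransform_eq_add _ _ hs,
      countTransform_eq_add _ _ hs]
    -- The three main terms add up to δ (s K(s − 1) − (s − 1) K(s − 1)) = δ K(s − 1).
    linear_combination (sqfDensity : ℂ) * h

/-! ### Analytic continuation of F₀ and zeros of ζ -/

theorem analyticAt_eisReg_sub_one (v u : 𝓢(ℝ, ℂ)) {s : ℂ} (hs : 1 < s.re) :
    AnalyticAt ℂ (fun s => (1 - (2 : ℂ) ^ (-(s - 1)))⁻¹ * eisReg v u (s - 1)) s := by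
  have hopen : IsOpen {s : ℂ | 1 < s.re} := isOpen_lt continuous_const continuous_re
  refine (DifferentiableOn.analyticOnNhd (fun z hz => ?_) hopen) s hs
  have hz1 : 1 < z.re := hz
  have hne : z - 1 ≠ -1 := fun h => by
    have := congrArg re h
    simp at this
    linarith
  have h1 : 1 - (2 : ℂ) ^ (-(z - 1)) ≠ 0 := one_sub_two_cpow_ne_zero (by simp; linarith)
  have d1 : DifferentiableAt ℂ (fun s : ℂ => (2 : ℂ) ^ (-(s - 1))) z :=
    ((differentiableAt_id.sub_const 1).neg).const_cpow (Or.inl two_ne_zero)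
  have d2 : DifferentiableAt ℂ (fun s : ℂ => eisReg v u (s - 1)) z :=
    (differentiableAt_eisReg v u hne).comp z (differentiableAt_id.sub_const 1)
  exact (((d1.const_sub 1).inv h1).mul d2).differentiableWithinAt

/-- The product `ζ₁(s-1) F₀(s)` extends to an analytic function `R` on `Re s > 3/2`, which controls
`⟨E_{-ρ}, Wig(v,u)⟩` at the zeros `ρ` of the zeta function. -/
theorem exists_zeta_mul_F0_eq (v u : 𝓢(ℝ, ℂ)) :
    ∃ R : ℂ → ℂ, AnalyticOnNhd ℂ R {s : ℂ | 3 / 2 < s.re} ∧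
      (∀ s : ℂ, 2 < s.re → riemannZeta₁ (s - 1) * F0 v u s = R s) ∧
      ∀ ρ : ℂ, 1 / 2 < ρ.re → ρ ≠ 1 → riemannZeta ρ = 0 → R (1 + ρ) = 0 →
        eisenstein ρ (wigner v u) = 0 := by
  obtain ⟨B, hB, H⟩ := exists_F0_eq v u
  refine ⟨fun s => sqfDensity * ((1 - (2 : ℂ) ^ (-(s - 1)))⁻¹ * eisReg v u (s - 1)) +
    riemannZeta₁ (s - 1) * B s, fun s hs => ?_, fun s hs => ?_, fun ρ h0 h1 hζ hR => ?_⟩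
  · have hs1 : 3 / 2 < s.re := hs
    have hζ : AnalyticAt ℂ (fun s => riemannZeta₁ (s - 1)) s :=
      (differentiable_riemannZeta₁.comp (differentiable_id.sub_const 1)).analyticAt s
    exact (analyticAt_const.mul (analyticAt_eisReg_sub_one v u (by linarith))).add
      (hζ.mul (hB s hs))
  · have hne : riemannZeta₁ (s - 1) ≠ 0 :=
      riemannZeta₁_ne_zero_of_one_le_re (by simp; linarith)
    rw [H s hs, lineKernel]
    field_simp
  -- At s = 1 + ρ the term with B drops out with ζ₁(ρ) = 0, while δ, ρ − 1 and the factor at the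
  -- prime 2 are nonzero.
  · simp only [add_sub_cancel_left, riemannZeta₁_eq_mul h1, hζ, mul_zero, zero_mul, add_zero] at hR
    have hne : ρ ≠ -1 := by rintro rfl; norm_num at h0
    have h2 : 1 - (2 : ℂ) ^ (-ρ) ≠ 0 := one_sub_two_cpow_ne_zero (by linarith)
    have h3 : (sqfDensity : ℂ) ≠ 0 := by exact_mod_cast sqfDensity_ne_zero
    rw [eisReg_eq_mul v u h1 hne] at hR
    simpa [h2, h3, inv_eq_zero, sub_eq_zero, h1] using hR

/-- Permanence of an analytic relation `φ F = R` under analytic continuation of `F` along a path. -/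
theorem ContinuesAlong.exists_mul_eq {F φ R : ℂ → ℂ} {a b : ℂ} {γ : Path a b} {U : Set ℂ}
    (hF : ContinuesAlong F γ) (hφ : AnalyticOnNhd ℂ φ U) (hR : AnalyticOnNhd ℂ R U)
    (hγ : ∀ t, γ t ∈ U) (ha : ∀ᶠ z in 𝓝 a, φ z * F z = R z) :
    ∃ c : ℂ, φ b * c = R b := by
  obtain ⟨G, hG, h0, hloc⟩ := hF
  -- The parameters at which the germ satisfies the relation form an open set by local coherence,
  -- and a closed one by the identity theorem on a small ball around γ t.
  set S : Set unitInterval := {t | (fun z => φ z * G t z) =ᶠ[𝓝 (γ t)] R} with hS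
  have hrel : ∀ t, ∀ᶠ t' in 𝓝 t,
      (t' ∈ S ↔ (fun z => φ z * G t z) =ᶠ[𝓝 (γ t')] R) := by
    intro t
    filter_upwards [hloc t] with t' ht'
    have h : (fun z => φ z * G t' z) =ᶠ[𝓝 (γ t')] fun z => φ z * G t z := by
      filter_upwards [ht'] with z hz
      rw [hz]
    exact ⟨fun h1 => h.symm.trans h1, fun h1 => h.trans h1⟩
  have hopen : IsOpen S := by
    refine isOpen_iff_mem_nhds.mpr fun t ht => ?_
    have h1 : ∀ᶠ t' in 𝓝 t, (fun z => φ z * G t z) =ᶠ[𝓝 (γ t')] R :=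
      γ.continuous.continuousAt.eventually (eventually_eventually_nhds.mpr ht)
    filter_upwards [h1, hrel t] with t' h2 h3 using h3.mpr h2
  have hclosed : IsClosed S := by
    refine isOpen_compl_iff.mp (isOpen_iff_mem_nhds.mpr fun t ht => ?_)
    have hA : AnalyticAt ℂ (fun z => φ z * G t z) (γ t) := (hφ _ (hγ t)).mul (hG t)
    obtain ⟨r, hr, hA'⟩ := hA.exists_ball_analyticOnNhd
    obtain ⟨r', hr', hR'⟩ := (hR _ (hγ t)).exists_ball_analyticOnNhd
    have hball : ∀ᶠ t' in 𝓝 t, γ t' ∈ Metric.ball (γ t) (min r r') :=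
      γ.continuous.continuousAt.eventually (Metric.ball_mem_nhds _ (lt_min hr hr'))
    filter_upwards [hball, hrel t] with t' h1 h2 h3
    have hpre : IsPreconnected (Metric.ball (γ t) (min r r')) :=
      (convex_ball _ _).isPreconnected
    have heq := (hA'.mono (Metric.ball_subset_ball (min_le_left r r'))
      ).eqOn_of_preconnected_of_eventuallyEq
      (hR'.mono (Metric.ball_subset_ball (min_le_right r r'))) hpre h1 (h2.mp h3)
    exact ht (heq.eventuallyEq_of_mem (Metric.ball_mem_nhds _ (lt_min hr hr')))
  have h0S : (0 : unitInterval) ∈ S := by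
    change (fun z => φ z * G 0 z) =ᶠ[𝓝 (γ 0)] R
    rw [γ.source]
    filter_upwards [h0, ha] with z h1 h2
    rw [h1, h2]
  have huniv : S = univ := IsClopen.eq_univ ⟨hclosed, hopen⟩ ⟨0, h0S⟩
  have h1S : (1 : unitInterval) ∈ S := huniv ▸ mem_univ _
  have h1 : (fun z => φ z * G 1 z) =ᶠ[𝓝 (γ 1)] R := h1S
  rw [γ.target] at h1
  exact ⟨G 1 b, h1.self_of_nhds⟩

theorem analyticOnNhd_riemannZeta₁_sub_one (U : Set ℂ) :
    AnalyticOnNhd ℂ (fun s => riemannZeta₁ (s - 1)) U := fun s _ =>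
  (differentiable_riemannZeta₁.comp (differentiable_id.sub_const 1)).analyticAt s

theorem riemannZeta_ne_zero_of_continuesAlong {ρ : ℂ} (h0 : 1 / 2 < ρ.re) (h1 : ρ ≠ 1)
    (v u : 𝓢(ℝ, ℂ)) (hE : eisenstein ρ (wigner v u) ≠ 0) {s₁ : ℂ} (γ : Path s₁ (1 + ρ))
    (hs₁ : 2 < s₁.re) (hγ : ∀ t, 3 / 2 < (γ t).re) (hF : ContinuesAlong (F0Series v u) γ) :
    riemannZeta ρ ≠ 0 := by
  intro hζ
  obtain ⟨R, hR, hRF, hRρ⟩ := exists_zeta_mul_F0_eq v u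
  have ha : ∀ᶠ s in 𝓝 s₁, riemannZeta₁ (s - 1) * F0Series v u s = R s := by
    filter_upwards [(isOpen_lt continuous_const continuous_re).mem_nhds hs₁] with s hs
    rw [F0Series, (hasSum_F0Term v u hs).tsum_eq]
    exact hRF s hs
  obtain ⟨c, hc⟩ := hF.exists_mul_eq (analyticOnNhd_riemannZeta₁_sub_one _) hR hγ ha
  refine hE (hRρ ρ h0 h1 hζ ?_)
  rw [← hc, add_sub_cancel_left, riemannZeta₁_eq_mul h1, hζ, mul_zero, zero_mul]

theorem eisenstein_eq_zero_of_continuation {ρ : ℂ} (h0 : 1 / 2 < ρ.re) (h1 : ρ ≠ 1)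
    (hζ : riemannZeta ρ = 0) (v u : 𝓢(ℝ, ℂ)) {G : ℂ → ℂ}
    (hG : AnalyticOnNhd ℂ G {s : ℂ | 3 / 2 < s.re}) (hGF : ∀ s : ℂ, 2 < s.re → G s = F0 v u s) :
    eisenstein ρ (wigner v u) = 0 := by
  obtain ⟨R, hR, hRF, hRρ⟩ := exists_zeta_mul_F0_eq v u
  refine hRρ ρ h0 h1 hζ ?_
  have hpre : IsPreconnected {s : ℂ | 3 / 2 < s.re} :=
    (convex_halfSpace_re_gt (3 / 2)).isPreconnected
  have h3 : (3 : ℂ) ∈ {s : ℂ | 3 / 2 < s.re} := by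
    simp only [mem_ofPred_eq, re_ofNat]
    norm_num
  have hnear : (fun s => riemannZeta₁ (s - 1) * G s) =ᶠ[𝓝 (3 : ℂ)] R := by
    filter_upwards [(isOpen_lt continuous_const continuous_re).mem_nhds
      (show (2 : ℝ) < (3 : ℂ).re by norm_num)] with s hs
    rw [hGF s hs]
    exact hRF s hs
  have heq := ((analyticOnNhd_riemannZeta₁_sub_one _).mul hG).eqOn_of_preconnected_of_eventuallyEq
    hR hpre h3 hnear
  have hρ : (1 + ρ) ∈ {s : ℂ | 3 / 2 < s.re} := by
    simp only [mem_ofPred_eq, add_re, one_re]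
    linarith
  have h2 := heq hρ
  simp only [add_sub_cancel_left, riemannZeta₁_eq_mul h1, hζ, mul_zero,
    zero_mul] at h2
  exact h2.symm

/-- By the functional equation 1 − s is a zero too, so Re s ≥ 1/2, unless the cosine vanishes. Then
s = −2k with k ≥ 0 since Re s ≤ 1/2; k = 0 is impossible because ζ(0) ≠ 0, and k > 0 is a trivial
zero. -/
theorem riemannHypothesis_of_re_le (h : ∀ ρ : ℂ, riemannZeta ρ = 0 → ρ.re ≤ 1 / 2) :
    RiemannHypothesis := by
  intro s hs htriv _
  refine le_antisymm (h s hs) ?_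
  have hs0 : s ≠ 0 := by
    rintro rfl
    rw [riemannZeta_zero] at hs
    norm_num at hs
  have hre := h s hs
  have h1 : ∀ n : ℕ, 1 - s ≠ -n := fun n hn => by
    have := congrArg re hn
    simp at this
    have hn0 : (0 : ℝ) ≤ n := Nat.cast_nonneg n
    linarith
  have h2 : (1 : ℂ) - s ≠ 1 := by simpa using hs0
  have hfe := riemannZeta_one_sub h1 h2
  rw [sub_sub_cancel, hs] at hfe
  have hΓ : Complex.Gamma (1 - s) ≠ 0 := Gamma_ne_zero h1
  have hπ : (2 * (Real.pi : ℂ)) ^ (-(1 - s)) ≠ 0 := by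
    rw [Ne, cpow_eq_zero_iff]
    have : (Real.pi : ℂ) ≠ 0 := by exact_mod_cast Real.pi_ne_zero
    simp [this]
  have hprod : Complex.cos (Real.pi * (1 - s) / 2) * riemannZeta (1 - s) = 0 := by
    have := hfe.symm
    rw [mul_assoc _ (Complex.cos _)] at this
    exact (mul_eq_zero.mp this).resolve_left (mul_ne_zero (mul_ne_zero two_ne_zero hπ) hΓ)
  rcases mul_eq_zero.mp hprod with hcos | hζ
  · exfalso
    obtain ⟨k, hk⟩ := Complex.cos_eq_zero_iff.mp hcos
    have hπ0 : (Real.pi : ℂ) ≠ 0 := by exact_mod_cast Real.pi_ne_zero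
    have hsk : s = -2 * (k : ℂ) := by
      have h3 : (Real.pi : ℂ) * (1 - s) = Real.pi * (2 * k + 1) := by linear_combination 2 * hk
      have h4 := mul_left_cancel₀ hπ0 h3
      linear_combination -h4
    have hkre : s.re = -2 * (k : ℝ) := by
      rw [hsk]
      simp
    have hk0 : (-1 : ℝ) < k := by linarith
    have hk1 : (-1 : ℤ) < k := by exact_mod_cast hk0
    have hk2 : k ≠ 0 := by
      rintro rfl
      exact hs0 (by simpa using hsk)
    refine htriv ⟨(k - 1).toNat, ?_⟩
    have h5 : (((k - 1).toNat : ℤ) : ℂ) = ((k - 1 : ℤ) : ℂ) := by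
      rw [Int.toNat_of_nonneg (by omega)]
    rw [Int.cast_natCast] at h5
    rw [h5, hsk]
    push_cast
    ring
  · have := h _ hζ
    simp at this
    linarith

/-! ### Test functions with a nonzero Eisenstein pairing -/

theorem int_eq_one_of_near {j k : ℤ} {t : ℝ} (ht : 0 < t) (h1 : |(j : ℝ) * t - 2| < 1 / 8)
    (h2 : |(k : ℝ) * t⁻¹ - 1 / 2| < 1 / 8) : j = 1 ∧ k = 1 := by
  rw [abs_lt] at h1 h2
  have hj : (0 : ℝ) < j := by
    by_contra h
    nlinarith
  have ht' : 0 < t⁻¹ := inv_pos.mpr ht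
  have hk : (0 : ℝ) < k := by
    by_contra h
    nlinarith
  have hprod : (j : ℝ) * k = (j * t) * (k * t⁻¹) := by field_simp
  -- Here (2 + 1/8)(1/2 + 1/8) = 85/64 < 2.
  have hlt : (j : ℝ) * k < 2 := by
    rw [hprod]
    nlinarith
  have hj' : 0 < j := by exact_mod_cast hj
  have hk' : 0 < k := by exact_mod_cast hk
  have hlt' : j * k < 2 := by exact_mod_cast hlt
  constructor <;> nlinarith

/-- Two functions supported close to `5/2` and `3/2`. -/
structure NearPair (r : ℝ) (v u : 𝓢(ℝ, ℂ)) : Prop where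
  le : r ≤ 1 / 8
  left : ∀ x, v x ≠ 0 → |x - 5 / 2| < r
  right : ∀ x, u x ≠ 0 → |x - 3 / 2| < r

theorem NearPair.near_of_kern_ne_zero {r : ℝ} {v u : 𝓢(ℝ, ℂ)} (h : NearPair r v u) {a b : ℝ}
    (hk : kern v u a b ≠ 0) : |a - 2| < r ∧ |b - 1 / 2| < r := by
  have h1 : v (a + b) ≠ 0 := fun h0 => hk (by simp [kern, h0])
  have h2 : u (a - b) ≠ 0 := fun h0 => hk (by simp [kern, h0])
  have h3 := abs_lt.mp (h.left _ h1)
  have h4 := abs_lt.mp (h.right _ h2)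
  constructor <;> rw [abs_lt] <;> constructor <;> linarith

theorem NearPair.wigner_zero {r : ℝ} {v u : 𝓢(ℝ, ℂ)} (h : NearPair r v u) :
    wigner v u 0 = 0 := by
  have e : ∀ t : ℝ, (starRingEnd ℂ) (v ((0 : ℝ × ℝ).1 + t)) * u ((0 : ℝ × ℝ).1 - t) = 0 := by
    intro t
    by_contra hne
    have := (abs_lt.mp (h.near_of_kern_ne_zero hne).1).1
    have hle := h.le
    simp only [Prod.fst_zero] at this
    linarith
  simp only [wigner, e, zero_mul, integral_zero]

/-- The centres 5/2 and 3/2 are 2 ± 1/2, which confines `kern` to a neighbourhood of (2, 1/2). Since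
2 · 1/2 = 1, a point (jt, k/t) of the Poisson sum can lie there only if jk = 1 with j, k > 0; the
term at the origin vanishes as well. -/
theorem NearPair.theta_eq {r : ℝ} {v u : 𝓢(ℝ, ℂ)} (h : NearPair r v u) {t : ℝ} (ht : 0 < t) :
    theta (wigner v u) t = (t : ℂ)⁻¹ * kern v u t t⁻¹ := by
  have key := lattice_sum_eq v u ht
  rw [h.wigner_zero, zero_add] at key
  rw [key, tsum_eq_single ((1, 1) : ℤ × ℤ)]
  · simp
  · rintro ⟨j, k⟩ hq
    by_contra hne
    obtain ⟨h1, h2⟩ := h.near_of_kern_ne_zero hne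
    obtain ⟨rfl, rfl⟩ := int_eq_one_of_near ht (h1.trans_le h.le) (h2.trans_le h.le)
    exact hq rfl

theorem NearPair.theta_eq_zero {r : ℝ} {v u : 𝓢(ℝ, ℂ)} (h : NearPair r v u) {t : ℝ} (ht : 0 < t)
    (ht2 : r ≤ |t - 2|) : theta (wigner v u) t = 0 := by
  rw [h.theta_eq ht]
  by_contra hne
  exact absurd (h.near_of_kern_ne_zero (right_ne_zero_of_mul hne)).1 (not_lt.mpr ht2)

theorem NearPair.theta_isBigO_atTop {r : ℝ} {v u : 𝓢(ℝ, ℂ)} (h : NearPair r v u) (c : ℝ) :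
    theta (wigner v u) =O[atTop] (· ^ c) := by
  refine Asymptotics.IsBigO.of_bound 0 ?_
  filter_upwards [eventually_gt_atTop 3] with t ht
  have hle := h.le
  rw [h.theta_eq_zero (by linarith) (le_abs.mpr (Or.inl (by linarith))), norm_zero, zero_mul]

theorem NearPair.theta_isBigO_zero {r : ℝ} {v u : 𝓢(ℝ, ℂ)} (h : NearPair r v u) (c : ℝ) :
    theta (wigner v u) =O[𝓝[>] 0] (· ^ c) := by
  refine Asymptotics.IsBigO.of_bound 0 ?_
  filter_upwards [Ioc_mem_nhdsGT (zero_lt_one (α := ℝ))] with t ht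
  have hle := h.le
  have ht1 := ht.2
  rw [h.theta_eq_zero ht.1 (le_abs.mpr (Or.inr (by linarith))), norm_zero, zero_mul]

theorem NearPair.mellinConvergent {r : ℝ} {v u : 𝓢(ℝ, ℂ)} (h : NearPair r v u) (s : ℂ) :
    MellinConvergent (theta (wigner v u)) s := by
  obtain ⟨a, ha⟩ := exists_gt s.re
  obtain ⟨b, hb⟩ := exists_lt s.re
  exact mellinConvergent_of_isBigO_rpow
    ((rapidDecay_wigner v u).continuousOn_theta.locallyIntegrableOn measurableSet_Ioi)
    (h.theta_isBigO_atTop (-a)) ha (h.theta_isBigO_zero (-b)) hb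

/-- As `theta` vanishes near 0 and near infinity, its Mellin transform is entire and must be the
continuation. -/
theorem NearPair.eisenstein_eq {r : ℝ} {v u : 𝓢(ℝ, ℂ)} (h : NearPair r v u) {ν : ℂ} (h1 : ν ≠ 1)
    (h2 : ν ≠ -1) : eisenstein ν (wigner v u) = mellin (theta (wigner v u)) (ν + 1) := by
  have hd : Differentiable ℂ (mellin (theta (wigner v u))) := fun s => by
    obtain ⟨a, ha⟩ := exists_gt s.re
    obtain ⟨b, hb⟩ := exists_lt s.re
    exact mellin_differentiableAt_of_isBigO_rpow
      ((rapidDecay_wigner v u).continuousOn_theta.locallyIntegrableOn measurableSet_Ioi)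
      (h.theta_isBigO_atTop (-a)) ha (h.theta_isBigO_zero (-b)) hb
  have hc : IsEisensteinContinuation (wigner v u)
      fun ν => mellin (theta (wigner v u)) (ν + 1) :=
    ⟨(hd.comp (differentiable_id.add_const 1)).differentiableOn,
      fun ν hν => (rapidDecay_wigner v u).mellin_theta hν⟩
  exact PseudoArith.eisenstein_eq hc h1 h2

theorem exists_eisenstein_ne_zero {ρ : ℂ} (h1 : ρ ≠ 1) (h2 : ρ ≠ -1) :
    ∃ v u : 𝓢(ℝ, ℂ), HasCompactSupport v ∧ HasCompactSupport u ∧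
      eisenstein ρ (wigner v u) ≠ 0 := by
  -- Normalised by ψ(2) = 1, so that Re ψ > 0 near 2. The lattice sum is nonnegative, supported
  -- there once r is small, and positive at 2, so its integral against ψ has positive real part.
  set ψ : ℝ → ℂ := fun t => (2 : ℂ) ^ (-ρ) * (t : ℂ) ^ ρ with hψ
  have hψ2 : ψ 2 = 1 := by
    simp only [hψ, ofReal_ofNat]
    rw [← cpow_add _ _ two_ne_zero, neg_add_cancel, cpow_zero]
  have hψc : ContinuousAt ψ 2 :=
    continuousAt_const.mul (continuousAt_ofReal_cpow_const 2 ρ (Or.inr two_ne_zero))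
  have hpos : ∀ᶠ t in 𝓝 (2 : ℝ), 0 < (ψ t).re := by
    have hc : ContinuousAt (fun t => (ψ t).re) 2 := continuous_re.continuousAt.comp hψc
    refine hc.eventually (lt_mem_nhds ?_)
    simp only [hψ2]
    norm_num
  obtain ⟨δ, hδ, hball⟩ := Metric.eventually_nhds_iff.mp hpos
  set r : ℝ := min δ (1 / 8) with hr
  have hr0 : 0 < r := lt_min hδ (by norm_num)
  let f : ∀ c : ℝ, ContDiffBump c := fun c => ⟨r / 2, r, by linarith, by linarith⟩
  have hcs : ∀ c, HasCompactSupport fun x : ℝ => (f c x : ℂ) := fun c =>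
    (f c).hasCompactSupport.comp_left (g := ((↑) : ℝ → ℂ)) ofReal_zero
  have hcd : ∀ c, ContDiff ℝ ∞ fun x : ℝ => (f c x : ℂ) := fun c =>
    ofRealCLM.contDiff.comp (f c).contDiff
  set w : ℝ → 𝓢(ℝ, ℂ) := fun c => (hcs c).toSchwartzMap (hcd c) with hw
  have hwv : ∀ c x, w c x = (f c x : ℂ) := fun c x => rfl
  have hsupp : ∀ c x, w c x ≠ 0 → |x - c| < r := by
    intro c x hx
    by_contra hge
    refine hx ?_
    rw [hwv, (f c).zero_of_le_dist (by rw [Real.dist_eq]; exact not_lt.mp hge), ofReal_zero]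
  have hN : NearPair r (w (5 / 2)) (w (3 / 2)) :=
    ⟨min_le_right _ _, hsupp _, hsupp _⟩
  refine ⟨w (5 / 2), w (3 / 2), hcs _, hcs _, ?_⟩
  rw [hN.eisenstein_eq h1 h2]
  set θ := theta (wigner (w (5 / 2)) (w (3 / 2))) with hθ
  set g : ℝ → ℝ := fun t => t⁻¹ * (f (5 / 2) (t + t⁻¹) * f (3 / 2) (t - t⁻¹)) with hg
  have hθg : ∀ t : ℝ, 0 < t → θ t = (g t : ℂ) := by
    intro t ht
    rw [hθ, hN.theta_eq ht]
    simp only [hg, kern, hwv, conj_ofReal]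
    push_cast
    ring
  have hg0 : ∀ t : ℝ, 0 < t → 0 ≤ g t := fun t ht =>
    mul_nonneg (inv_pos.mpr ht).le (mul_nonneg (f _).nonneg (f _).nonneg)
  intro hzero
  have hint := (hN.mellinConvergent (ρ + 1)).const_mul ((2 : ℂ) ^ (-ρ))
  have hψg : ∀ t : ℝ, 0 < t →
      ((2 : ℂ) ^ (-ρ) * ((t : ℂ) ^ (ρ + 1 - 1) • θ t)).re = (ψ t).re * g t := by
    intro t ht
    rw [hθg t ht, add_sub_cancel_right, smul_eq_mul, ← mul_assoc]
    exact re_mul_ofReal _ _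
  have hI : ∫ t in Ioi (0 : ℝ), (ψ t).re * g t = 0 := by
    have e : ∫ t in Ioi (0 : ℝ), (2 : ℂ) ^ (-ρ) * ((t : ℂ) ^ (ρ + 1 - 1) • θ t) = 0 := by
      rw [integral_const_mul]
      have : ∫ t in Ioi (0 : ℝ), (t : ℂ) ^ (ρ + 1 - 1) • θ t = 0 := hzero
      rw [this, mul_zero]
    have e2 := integral_re hint
    simp only [RCLike.re_eq_complex_re] at e2
    rw [e, zero_re] at e2
    refine Eq.trans ?_ e2
    exact setIntegral_congr_fun measurableSet_Ioi fun t ht => (hψg t ht).symm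
  have hnn : 0 ≤ᵐ[volume.restrict (Ioi (0 : ℝ))] fun t => (ψ t).re * g t := by
    filter_upwards [ae_restrict_mem measurableSet_Ioi] with t ht
    have ht0 : (0 : ℝ) < t := ht
    rcases lt_or_ge |t - 2| r with hlt | hge
    · exact mul_nonneg (hball (by rw [Real.dist_eq]; exact hlt.trans_le (min_le_left _ _))).le
        (hg0 t ht0)
    · have h0 : (g t : ℂ) = 0 := by rw [← hθg t ht0, hθ, hN.theta_eq_zero ht0 hge]
      rw [ofReal_eq_zero.mp h0, mul_zero]
      rfl
  have hi : IntegrableOn (fun t => (ψ t).re * g t) (Ioi 0) :=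
    IntegrableOn.congr_fun hint.re (fun t ht => hψg t ht) measurableSet_Ioi
  have hlt : 0 < ∫ t in Ioi (0 : ℝ), (ψ t).re * g t := by
    rw [setIntegral_pos_iff_support_of_nonneg_ae hnn hi]
    refine Measure.measure_pos_of_mem_nhds (x := (2 : ℝ)) volume ?_
    have hgc : ContinuousAt g 2 := by
      have c1 : ContinuousAt (fun t : ℝ => t⁻¹) 2 := continuousAt_inv₀ two_ne_zero
      exact c1.mul (((f (5 / 2)).continuous.continuousAt.comp (continuousAt_id.add c1)).mul
        ((f (3 / 2)).continuous.continuousAt.comp (continuousAt_id.sub c1)))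
    have hg2 : 0 < g 2 := by
      have e1 : f (5 / 2) ((2 : ℝ) + 2⁻¹) = 1 := by
        have : (2 : ℝ) + 2⁻¹ = 5 / 2 := by norm_num
        rw [this]
        exact (f (5 / 2)).eventuallyEq_one.self_of_nhds
      have e2 : f (3 / 2) ((2 : ℝ) - 2⁻¹) = 1 := by
        have : (2 : ℝ) - 2⁻¹ = 3 / 2 := by norm_num
        rw [this]
        exact (f (3 / 2)).eventuallyEq_one.self_of_nhds
      simp only [hg, e1, e2]
      norm_num
    have hgpos : ∀ᶠ t in 𝓝 (2 : ℝ), 0 < g t := hgc.eventually (lt_mem_nhds hg2)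
    filter_upwards [hpos, hgpos, lt_mem_nhds (zero_lt_two (α := ℝ))] with t a b c
    exact ⟨(mul_pos a b).ne', c⟩
  exact hlt.ne' hI

end PseudoArith

end

/-! ### The three assertions -/

theorem theorem5p3 :
    -- `F_0` is well defined and analytic for `Re s > 2`; its two definitions agree there
    (∀ v u : 𝓢(ℝ, ℂ),
      (∀ s : ℂ, 2 < s.re →
        Integrable (fun y : ℝ => PseudoArith.F0Integrand v u s (1 + y * I)) ∧
        HasSum (PseudoArith.F0Term v u s) (PseudoArith.F0 v u s)) ∧
      AnalyticOnNhd ℂ (PseudoArith.F0 v u) {s : ℂ | 2 < s.re}) ∧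
    -- the criterion for the Riemann hypothesis
    ((∀ v u : ℝ → ℂ, ContDiff ℝ ∞ v → HasCompactSupport v →
        ContDiff ℝ ∞ u → HasCompactSupport u →
        ∃ G : ℂ → ℂ, AnalyticOnNhd ℂ G {s : ℂ | 3 / 2 < s.re} ∧
          ∀ s : ℂ, 2 < s.re → G s = PseudoArith.F0 v u s) →
      (∀ ρ : ℂ, riemannZeta ρ = 0 → ρ.re ≤ 1 / 2) ∧ RiemannHypothesis) ∧
    -- the local version
    (∀ ρ : ℂ, 1 / 2 < ρ.re → ρ ≠ 1 → ∀ v u : 𝓢(ℝ, ℂ),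
      PseudoArith.eisenstein ρ (PseudoArith.wigner v u) ≠ 0 →
      ∀ (s₁ : ℂ) (γ : Path s₁ (1 + ρ)), 2 < s₁.re → (∀ t, 3 / 2 < (γ t).re) →
        PseudoArith.ContinuesAlong (PseudoArith.F0Series v u) γ →
        riemannZeta ρ ≠ 0) := by
  refine ⟨fun v u => ⟨fun s hs => ⟨PseudoArith.integrable_F0Integrand v u hs,
    PseudoArith.hasSum_F0Term v u hs⟩, PseudoArith.analyticOnNhd_F0 v u⟩, fun hyp => ?_,
    fun ρ h0 h1 v u hE s₁ γ hs₁ hγ hF =>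
      PseudoArith.riemannZeta_ne_zero_of_continuesAlong h0 h1 v u hE γ hs₁ hγ hF⟩
  have hre : ∀ ρ : ℂ, riemannZeta ρ = 0 → ρ.re ≤ 1 / 2 := by
    intro ρ hζ
    by_contra hlt
    have h0 : 1 / 2 < ρ.re := not_le.mp hlt
    -- The value assigned to `riemannZeta` at its pole is nonzero.
    have h1 : ρ ≠ 1 := by
      rintro rfl
      exact riemannZeta_one_ne_zero hζ
    have h2 : ρ ≠ -1 := by
      rintro rfl
      norm_num at h0
    obtain ⟨v, u, hv, hu, hE⟩ := PseudoArith.exists_eisenstein_ne_zero h1 h2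
    obtain ⟨G, hG, hGF⟩ := hyp v u (v.smooth ⊤) hv (u.smooth ⊤) hu
    exact hE (PseudoArith.eisenstein_eq_zero_of_continuation h0 h1 hζ v u hG hGF)
  exact ⟨hre, PseudoArith.riemannHypothesis_of_re_le hre⟩
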